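/- Let $\Omega\subset\mathbb R^2$ be open and bounded, and let $f\in L^1(\Omega)$ with $f\ge 0$ a.e. and $\int_\Omega f>0$. Let $\mathcal M(\overline\Omega)$ and $\mathcal M^2(\overline\Omega)$ be the spaces of finite signed, respectively $\mathbb R^2$-valued, Borel measures on $\overline\Omega$, and let $C^1(\overline\Omega)$ be the set of restrictions to $\overline\Omega$ of $C^1$ functions on $\mathbb R^2$. Consider the following two situations. (a) (Compliance problem) $1<q<\infty$; the fields are $v\in V:=L^q(\Omega,\mathbb R^2)$, with $E(v):=\frac1q\int_\Omega|v|^q\,dx$ and $\langle v,\nabla\psi\rangle:=\int_\Omega v\cdot\nabla\psi\,dx$. (b) (Average distance problem, $q=1$) the fields are $v\in V:=\mathcal M^2(\overline\Omega)$, with $E(v):=|v|(\overline\Omega)$ and $\langle v,\nabla\psi\rangle:=\int\nabla\psi\cdot dv$. We say that $\operatorname{div}v\in\mathcal M(\overline\Omega)$ if there is a (necessarily unique) $\mu=:\operatorname{div}v\in\mathcal M(\overline\Omega)$ with $\langle v,\nabla\psi\rangle=-\int\psi\,d\mu$ for all $\psi\in C^1(\overline\Omega)$ (this includes the Neumann condition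 $v\cdot n=0$). Let $\mathcal K$ be the set of nonempty closed connected subsets of $\overline\Omega$. If $\operatorname{div}v\in\mathcal M(\overline\Omega)$, let $\mathcal H^1_C(v)$ be the infimum of $\mathcal H^1(K)$ over all $K\in\mathcal K$ containing $\operatorname{spt}(\operatorname{div}v+f)$ (with $\inf\emptyset=+\infty$), where $f$ is identified with the measure $f\,dx$ on $\Omega$. For $(v,\varphi,y)\in V\times L^2(\Omega)\times\overline\Omega$ put $$F_0(v,\varphi,y)=E(v)+|\operatorname{div}v|(\overline\Omega)+\mathcal H^1_C(v)$$ if $\operatorname{div}v\in\mathcal M(\overline\Omega)$, $y\in\operatorname{spt}(\operatorname{div}v+f)$ and $\varphi=1$ a.e. on $\Omega$, and $F_0(v,\varphi,y)=+\infty$ otherwise. Let $\mathcal A$ be the set of pairs $(K,v)\in\mathcal K\times V$ such that $\langle v,\nabla\psi\rangle=\int_\Omega f\psi\,dx$ for all $\psi\in C^1(\overline\Omega)$ with $\psi=0$ on $K$ (that is, $-\operatorname{div}v=f$ off $K$ with Neumann conditions, in the weak sense), and put $J(K,v)=E(v)+\mathcal H^1(K)$. Then, in both situations: 1. $F_0$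 attains its infimum on $V\times L^2(\Omega)\times\overline\Omega$, and it has a minimizer of finite value if and only if $J(K,v)<\infty$ for some $(K,v)\in\mathcal A$. 2. $\min F_0=\inf_{(K,v)\in\mathcal A}J(K,v)+2\int_\Omega f\,dx$ in $[0,+\infty]$. 3. Calling a minimizer *finite* if its value is finite: $(v,\varphi,y)$ is a finite minimizer of $F_0$ if and only if $\varphi=1$ a.e. on $\Omega$, $y\in\operatorname{spt}(\operatorname{div}v+f)$, and there is a $K$ such that $(K,v)$ is a finite minimizer of $J$ on $\mathcal A$ (for such a $(K,v)$ one has $\operatorname{div}v\in\mathcal M(\overline\Omega)$). 4. $(K,v)$ is a finite minimizer of $J$ on $\mathcal A$ if and only if $(v,\varphi,y)$ is a finite minimizer of $F_0$ for some $\varphi$ and $y$, $K\in\mathcal K$, $\operatorname{spt}(\operatorname{div}v+f)\subset K$ and $\mathcal H^1(K)=\mathcal H^1_C(v)$. -/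

import Mathlib

open MeasureTheory Set
open scoped ENNReal

noncomputable section

namespace ConnectedSets

/-- The Euclidean plane. -/
abbrev Plane := EuclideanSpace ℝ (Fin 2)

/-- The fields `v ∈ L^q(Ω, ℝ²)`. -/
abbrev LqField (Ω : Set Plane) (q : ℝ) := Lp Plane (ENNReal.ofReal q) (volume.restrict Ω)

/-- The finite `ℝ²`-valued Borel measures on the closure of `Ω`, seen as vector measures on the
plane that are concentrated on the closure of `Ω`. -/
abbrev MeasureField (Ω : Set Plane) :=
  {v : VectorMeasure Plane Plane // v.variation (closure Ω)ᶜ = 0}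

/-- `(1/q) ∫_Ω |v|^q dx`. -/
def lqEnergy {Ω : Set Plane} {q : ℝ} (v : LqField Ω q) : ℝ≥0∞ :=
  ENNReal.ofReal (1 / q) * ∫⁻ x in Ω, ‖v x‖ₑ ^ q

/-- The norm `|v|(closure Ω)` of a vector measure. -/
def massEnergy {Ω : Set Plane} (v : MeasureField Ω) : ℝ≥0∞ :=
  v.1.variation univ

/-- The functional `ψ ↦ ∫_Ω v · ∇ψ dx` for `v ∈ L^q`. -/
def lqPairing {Ω : Set Plane} {q : ℝ} (v : LqField Ω q) (ψ : Plane → ℝ) : ℝ :=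
  ∫ x in Ω, inner ℝ (gradient ψ x) (v x)

/-- The functional `ψ ↦ ∫ ∇ψ · dv` for a vector measure `v`. -/
def massPairing {Ω : Set Plane} (v : MeasureField Ω) (ψ : Plane → ℝ) : ℝ :=
  v.1.integral (fun x => gradient ψ x) (innerSL ℝ)

/- In what follows a field `v` enters only through the functional `T ψ = ∫ ∇ψ · dv`. The space
`C¹(closure Ω)` consists of the restrictions of the `C¹` functions on the plane. -/

/-- The signed measure `μ` on the closure of `Ω` is the divergence of the field, the Neumann
condition `v · n = 0` included: `∫ ∇ψ · dv = -∫ ψ dμ` for all `ψ ∈ C¹(closure Ω)`. -/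
def IsDivergence (Ω : Set Plane) (T : (Plane → ℝ) → ℝ) (μ : SignedMeasure Plane) : Prop :=
  μ.variation (closure Ω)ᶜ = 0 ∧
    ∀ ψ : Plane → ℝ, ContDiff ℝ 1 ψ →
      T ψ = -VectorMeasure.integral μ ψ (ContinuousLinearMap.lsmul ℝ ℝ)

/-- The divergence of the field is a finite signed measure on the closure of `Ω`. -/
def HasMeasureDivergence (Ω : Set Plane) (T : (Plane → ℝ) → ℝ) : Prop :=
  ∃ μ : SignedMeasure Plane, IsDivergence Ω T μ

open Classical in
/-- The divergence of a field whose divergence is a measure (it is then unique). -/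
def divergence (Ω : Set Plane) (T : (Plane → ℝ) → ℝ) : SignedMeasure Plane :=
  if h : HasMeasureDivergence Ω T then h.choose else 0

/-- The support of the measure `div v + f`, where `f` is a density on `Ω`. -/
def sourceSupport (Ω : Set Plane) (f : Plane → ℝ) (T : (Plane → ℝ) → ℝ) : Set Plane :=
  (divergence Ω T + (volume.restrict Ω).withDensityᵥ f).variation.support

/-- The closed connected subsets of the closure of `Ω`. -/
def continua (Ω : Set Plane) : Set (Set Plane) :=
  {K | K ⊆ closure Ω ∧ IsClosed K ∧ IsConnected K}

/-- The infimum of `H¹(K)` over the closed connected `K ⊆ closure Ω` containing `A`. -/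
def steinerLength (Ω A : Set Plane) : ℝ≥0∞ :=
  ⨅ K ∈ {K | K ∈ continua Ω ∧ A ⊆ K}, μH[1] K

/-- The length of the connected envelope of the support of `div v + f`. -/
def connectedLength (Ω : Set Plane) (f : Plane → ℝ) (T : (Plane → ℝ) → ℝ) : ℝ≥0∞ :=
  steinerLength Ω (sourceSupport Ω f T)

open Classical in
/-- The limit functional for fields `v ∈ V` with energy `e v` and gradient pairing `T v`:
`e v + |div v|(closure Ω) + H¹_C(v)` if `div v` is a measure on the closure of `Ω`, `y` belongs to
the support of `div v + f` and `φ = 1` a.e. on `Ω`; `+∞` otherwise. -/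
def limitFunctional {V : Type*} (e : V → ℝ≥0∞) (T : V → (Plane → ℝ) → ℝ)
    (Ω : Set Plane) (f : Plane → ℝ)
    (z : V × Lp ℝ 2 (volume.restrict Ω) × closure Ω) : ℝ≥0∞ :=
  if HasMeasureDivergence Ω (T z.1) ∧ (z.2.2 : Plane) ∈ sourceSupport Ω f (T z.1) ∧
      z.2.1 =ᵐ[volume.restrict Ω] (fun _ => (1 : ℝ)) then
    e z.1 + (divergence Ω (T z.1)).variation univ + connectedLength Ω f (T z.1)
  else ⊤

/-- The pairs `(K, v)` with `K ⊆ closure Ω` closed and connected and `-div v = f` off `K` with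
Neumann conditions: `∫ ∇ψ · dv = ∫_Ω f ψ dx` for all `ψ ∈ C¹(closure Ω)` with `ψ = 0` on `K`. -/
def admissiblePairs {V : Type*} (T : V → (Plane → ℝ) → ℝ) (Ω : Set Plane) (f : Plane → ℝ) :
    Set (Set Plane × V) :=
  {p | p.1 ∈ continua Ω ∧ ∀ ψ : Plane → ℝ, ContDiff ℝ 1 ψ → (∀ x ∈ p.1, ψ x = 0) →
    T p.2 ψ = ∫ x in Ω, f x * ψ x}

/-- The functional `e v + H¹(K)` of the dual problem. -/
def dualFunctional {V : Type*} (e : V → ℝ≥0∞) (p : Set Plane × V) : ℝ≥0∞ :=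
  e p.2 + μH[1] p.1

/-- `a` is a minimizer of `F` on `s`, with a finite value. -/
def IsFiniteMinimizer {α : Type*} (F : α → ℝ≥0∞) (s : Set α) (a : α) : Prop :=
  a ∈ s ∧ F a < ⊤ ∧ ∀ b ∈ s, F a ≤ F b

/-- The functional `F₀` of the compliance problem, on `L^q × L² × closure Ω`. -/
def F0 (Ω : Set Plane) (f : Plane → ℝ) (q : ℝ) :
    LqField Ω q × Lp ℝ 2 (volume.restrict Ω) × closure Ω → ℝ≥0∞ :=
  limitFunctional lqEnergy lqPairing Ω f

/-- The functional `F₀` of the average distance problem (`q = 1`, fields are vector measures). -/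
def F0Mass (Ω : Set Plane) (f : Plane → ℝ) :
    MeasureField Ω × Lp ℝ 2 (volume.restrict Ω) × closure Ω → ℝ≥0∞ :=
  limitFunctional massEnergy massPairing Ω f

/-- The admissible pairs of the dual of the compliance problem, with fields in `L^q`. -/
def admissibleLq (Ω : Set Plane) (f : Plane → ℝ) (q : ℝ) : Set (Set Plane × LqField Ω q) :=
  admissiblePairs lqPairing Ω f

/-- The admissible pairs of the dual of the average distance problem, with measure fields. -/
def admissibleMass (Ω : Set Plane) (f : Plane → ℝ) : Set (Set Plane × MeasureField Ω) :=
  admissiblePairs massPairing Ω f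

/-- `(1/q) ∫_Ω |v|^q dx + H¹(K)`. -/
def dualLq (Ω : Set Plane) (q : ℝ) : Set Plane × LqField Ω q → ℝ≥0∞ :=
  dualFunctional lqEnergy

/-- `|v|(closure Ω) + H¹(K)`. -/
def dualMass (Ω : Set Plane) : Set Plane × MeasureField Ω → ℝ≥0∞ :=
  dualFunctional massEnergy

end ConnectedSets

end

/-!
Why the limit functional and the dual problem have the same minimizers.

Suppose that `div v + f` is a measure supported in a continuum `K` of finite length. Then `v`
balances `f` off `K`, and `div v` is `-f` off the Lebesgue null set `K` and has total mass zero,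
so that `|div v| ≥ 2 ∫ f` (`isBalancedOff_of_sourceSupport_subset`). Hence the limit functional
is at least the dual functional plus `2 ∫ f`. Equality needs the converse: the divergence of an
optimal `v` is a measure, and `|div v| = 2 ∫ f`. Both follow once the distribution `div v + f` is
known to be nonnegative, because it is then a measure on `K` with total mass `∫ f`
(`exists_isDivergence`).

Nonnegativity comes from duality. Both spaces of fields are the dual of the continuous vector
fields for a seminorm that only depends on the pointwise norm (`EnergyDuality`, proved for measures
in `energyDuality_mass` and for `L^q` in `energyDuality_lq`). For a test function `ψ ≤ 0` on `K`
the positive part vanishes on `K` and has a smaller gradient, so a field `v` that balances `f` off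
`K` satisfies `∫ f ψ ≤ ‖v‖ s(∇ψ)` for all such `ψ`, and the Hahn–Banach theorem, in
the form of Mazur and Orlicz, turns this into a field `v'` with `‖v'‖ ≤ ‖v‖` and `div v' + f ≥ 0`
(`exists_isDivNonneg`). In `L^q` an optimal field is unique by strict convexity, so it equals `v'`.
A field of least mass need not be unique, but there an almost optimal test function `ψ` can be
compared with the positive part of `ψ - t φ` to get the same conclusion for every optimal field
(`isDivNonneg_of_minimal`).

Minimizers exist by the direct method (`exists_minimal_pair`). Continua converge in the Hausdorff
distance along an ultrafilter, and their length is lower semicontinuous by Gołąb's theorem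
(`exists_continuum_limit`); fields converge weakly along the ultrafilter since they form a dual
space (`exists_weak_limit`); and `div v + f ≥ 0` makes the balance off `K` stable
(`isBalancedOff_of_tendsto`). Gołąb's theorem is proved by covering a continuum by small open sets
and grouping them, along the connections between them, into few pieces of controlled diameter.
-/

noncomputable section

open Filter Topology Metric

namespace ConnectedSets

/-! ### Gołąb's theorem -/

section Golab

variable {Y : Type*} [MetricSpace Y]

/-- A finite set of indices is grown if its elements can be listed in such a way that, along the
family `U`, every set but the first meets an earlier one. -/
inductive Grown {ι : Type*} [DecidableEq ι] (U : ι → Set Y) : Finset ι → Prop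
  | single (i : ι) : Grown U {i}
  | adjoin {s : Finset ι} (hs : Grown U s) {i j : ι} (hi : i ∉ s) (hj : j ∈ s)
      (hij : (U j ∩ U i).Nonempty) : Grown U (insert i s)

/-- A finite family of open sets that covers a preconnected set, each of them meeting it, is
grown. -/
theorem grown_of_isPreconnected {ι : Type*} [DecidableEq ι] {U : ι → Set Y} {C : Set Y}
    (hC : IsPreconnected C) (hU : ∀ i, IsOpen (U i)) {F : Finset ι} (hF : F.Nonempty)
    (hcov : C ⊆ ⋃ i ∈ F, U i) (hmeet : ∀ i ∈ F, (C ∩ U i).Nonempty) : Grown U F := by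
  classical
  obtain ⟨i₀, hi₀⟩ := hF
  have hne : (F.powerset.filter (Grown U)).Nonempty :=
    ⟨{i₀}, by simp [Finset.mem_filter, hi₀, Grown.single]⟩
  obtain ⟨s, hs, hmax⟩ := Finset.exists_max_image _ Finset.card hne
  rw [Finset.mem_filter, Finset.mem_powerset] at hs
  obtain ⟨hsF, hsG⟩ := hs
  have hs_ne : s.Nonempty := by
    cases hsG with
    | single i => simp
    | adjoin => simp
  by_contra hcon
  have hsne : s ≠ F := fun h => hcon (h ▸ hsG)
  obtain ⟨i₁, hi₁F, hi₁s⟩ : ∃ i ∈ F, i ∉ s := by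
    by_contra! h
    exact hsne (Finset.Subset.antisymm hsF h)
  obtain ⟨i₂, hi₂⟩ := hs_ne
  have hA : IsOpen (⋃ i ∈ s, U i) := isOpen_biUnion fun i _ => hU i
  have hB : IsOpen (⋃ i ∈ F \ s, U i) := isOpen_biUnion fun i _ => hU i
  have hAB : C ⊆ (⋃ i ∈ s, U i) ∪ ⋃ i ∈ F \ s, U i := by
    intro x hx
    obtain ⟨i, hi, hxi⟩ := mem_iUnion₂.1 (hcov hx)
    by_cases his : i ∈ s
    · exact Or.inl (mem_iUnion₂.2 ⟨i, his, hxi⟩)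
    · exact Or.inr (mem_iUnion₂.2 ⟨i, Finset.mem_sdiff.2 ⟨hi, his⟩, hxi⟩)
  obtain ⟨x, -, hxA, hxB⟩ := hC _ _ hA hB hAB
    ((hmeet i₂ (hsF hi₂)).mono (inter_subset_inter_right _
      (subset_biUnion_of_mem (u := U) (Finset.mem_coe.2 hi₂))))
    ((hmeet i₁ hi₁F).mono (inter_subset_inter_right _
      (subset_biUnion_of_mem (u := U) (Finset.mem_coe.2 (Finset.mem_sdiff.2 ⟨hi₁F, hi₁s⟩)))))
  obtain ⟨j, hj, hxj⟩ := mem_iUnion₂.1 hxA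
  obtain ⟨i, hi, hxi⟩ := mem_iUnion₂.1 hxB
  rw [Finset.mem_sdiff] at hi
  have hg : Grown U (insert i s) := hsG.adjoin hi.2 hj ⟨x, hxj, hxi⟩
  have := hmax (insert i s) (by
    rw [Finset.mem_filter, Finset.mem_powerset]
    exact ⟨Finset.insert_subset hi.1 hsF, hg⟩)
  rw [Finset.card_insert_of_notMem hi.2] at this
  omega

/-- Greedy grouping of a grown family of sets `U i` of size at most `w i ≤ ε` into few pieces of
size less than `2 δ`. Each index `i` carries an open piece `O i ⊇ U i` of size `c i < δ`. The index
that was added last is removed, and its open piece is merged into that of an index it touches;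
when the result has size at least `δ` it is closed, and the open piece of the remaining index is
restarted as `U j`, at a cost of at most `ε`. -/
theorem Grown.exists_pieces {ι : Type*} [DecidableEq ι] {U : ι → Set Y} {w : ι → ℝ} {ε δ : ℝ}
    (hεδ : ε < δ) (hw0 : ∀ i, 0 ≤ w i) (hwε : ∀ i, w i ≤ ε)
    (hwU : ∀ i, ediam (U i) ≤ ENNReal.ofReal (w i)) {s : Finset ι} (hs : Grown U s) :
    ∀ (O : ι → Set Y) (c : ι → ℝ), (∀ i ∈ s, U i ⊆ O i) →
      (∀ i ∈ s, ediam (O i) ≤ ENNReal.ofReal (c i) ∧ 0 ≤ c i ∧ c i < δ) →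
      ∃ L : List (Set Y × ℝ), (∀ i ∈ s, ∀ x ∈ O i, ∃ q ∈ L, x ∈ q.1) ∧
        (∀ q ∈ L, ediam q.1 ≤ ENNReal.ofReal q.2 ∧ 0 ≤ q.2 ∧ q.2 < 2 * δ) ∧
        (L.map Prod.snd).sum ≤ ∑ i ∈ s, c i + ((L.length : ℝ) - 1) * ε ∧
        ((L.length : ℝ) - 1) * δ ≤ (L.map Prod.snd).sum := by
  induction hs with
  | single i =>
    intro O c hUO hO
    have h := hO i (by simp)
    refine ⟨[(O i, c i)], by simp, ?_, by simp, by simpa using h.2.1⟩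
    simp only [List.mem_singleton, forall_eq]
    exact ⟨h.1, h.2.1, by linarith [h.2.1, h.2.2]⟩
  | @adjoin s hs i j hi hj hij ih =>
    intro O c hUO hO
    obtain ⟨hdi, hi0, hiδ⟩ := hO i (by simp)
    obtain ⟨hdj, hj0, hjδ⟩ := hO j (by simp [hj])
    have hmerge : ediam (O j ∪ O i) ≤ ENNReal.ofReal (c j + c i) := by
      rw [ENNReal.ofReal_add hj0 hi0]
      refine (ediam_union_le ?_).trans (add_le_add hdj hdi)
      exact hij.mono (inter_subset_inter (hUO j (by simp [hj])) (hUO i (by simp)))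
    have hrest : ∀ k ∈ s, k ∈ insert i s := fun k hk => Finset.mem_insert_of_mem hk
    rcases lt_or_ge (c j + c i) δ with hlt | hge
    · obtain ⟨L, hL1, hL2, hL3, hL4⟩ := ih (Function.update O j (O j ∪ O i))
        (Function.update c j (c j + c i)) (by
          intro k hk
          rcases eq_or_ne k j with rfl | hkj
          · simpa using (hUO k (hrest k hk)).trans subset_union_left
          · simpa [hkj] using hUO k (hrest k hk)) (by
          intro k hk
          rcases eq_or_ne k j with rfl | hkj
          · simpa using ⟨hmerge, by linarith, hlt⟩
          · simpa [hkj] using hO k (hrest k hk))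
      refine ⟨L, ?_, hL2, ?_, hL4⟩
      · intro k hk x hx
        rcases Finset.mem_insert.1 hk with rfl | hk
        · exact hL1 j hj x (by simp [hx])
        · rcases eq_or_ne k j with rfl | hkj
          · exact hL1 k hj x (by simp [hx])
          · exact hL1 k hk x (by simpa [hkj] using hx)
      · rw [Finset.sum_update_of_mem hj] at hL3
        rw [Finset.sum_insert hi, ← Finset.add_sum_erase s c hj, ← Finset.sdiff_singleton_eq_erase]
        linarith
    · obtain ⟨L, hL1, hL2, hL3, hL4⟩ := ih (Function.update O j (U j))
        (Function.update c j (w j)) (by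
          intro k hk
          rcases eq_or_ne k j with rfl | hkj
          · simp
          · simpa [hkj] using hUO k (hrest k hk)) (by
          intro k hk
          rcases eq_or_ne k j with rfl | hkj
          · simpa using ⟨hwU k, hw0 k, (hwε k).trans_lt hεδ⟩
          · simpa [hkj] using hO k (hrest k hk))
      refine ⟨(O j ∪ O i, c j + c i) :: L, ?_, ?_, ?_, ?_⟩
      · intro k hk x hx
        rcases Finset.mem_insert.1 hk with rfl | hk
        · exact ⟨_, List.mem_cons_self, Or.inr hx⟩
        · rcases eq_or_ne k j with rfl | hkj
          · exact ⟨_, List.mem_cons_self, Or.inl hx⟩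
          · obtain ⟨q, hq, hxq⟩ := hL1 k hk x (by simpa [hkj] using hx)
            exact ⟨q, List.mem_cons_of_mem _ hq, hxq⟩
      · intro q hq
        rcases List.mem_cons.1 hq with rfl | hq
        · exact ⟨hmerge, by dsimp only; linarith, by dsimp only; linarith⟩
        · exact hL2 q hq
      · rw [Finset.sum_update_of_mem hj] at hL3
        rw [Finset.sum_insert hi, ← Finset.add_sum_erase s c hj, ← Finset.sdiff_singleton_eq_erase]
        simp only [List.map_cons, List.sum_cons, List.length_cons]
        push_cast
        have := hwε j
        linarith
      · simp only [List.map_cons, List.sum_cons, List.length_cons]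
        push_cast
        linarith

/-- A compact set of length less than `c` has a finite cover by open sets that meet it, of small
diameters with sum less than `c`. -/
theorem exists_finite_open_cover_of_hausdorffMeasure_lt [MeasurableSpace Y] [BorelSpace Y]
    {C : Set Y} (hC : IsCompact C)
    {c ε : ℝ} (hε : 0 < ε) (hCc : μH[1] C < ENNReal.ofReal c) :
    ∃ (U : ℕ → Set Y) (w : ℕ → ℝ) (F : Finset ℕ), (∀ i, IsOpen (U i)) ∧ (∀ i, 0 ≤ w i) ∧
      (∀ i, w i ≤ ε) ∧ (∀ i, ediam (U i) ≤ ENNReal.ofReal (w i)) ∧ C ⊆ ⋃ i ∈ F, U i ∧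
      (∀ i ∈ F, (C ∩ U i).Nonempty) ∧ ∑ i ∈ F, w i ≤ c := by
  classical
  obtain ⟨c', hc'1, hc'2⟩ := exists_between hCc
  have hc'top : c' ≠ ∞ := hc'2.ne_top
  have hc'r : c'.toReal < c := by
    rwa [← ENNReal.lt_ofReal_iff_toReal_lt hc'top]
  set η := c - c'.toReal with hη
  have hη0 : 0 < η := sub_pos.2 hc'r
  rw [Measure.hausdorffMeasure_apply] at hc'1
  have h1 := (le_iSup₂ (f := fun (r : ℝ≥0∞) (_ : 0 < r) =>
    ⨅ (t : ℕ → Set Y) (_ : C ⊆ ⋃ n, t n) (_ : ∀ n, ediam (t n) ≤ r),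
      ∑' n, ⨆ _ : (t n).Nonempty, ediam (t n) ^ (1 : ℝ))
    (ENNReal.ofReal (ε / 2)) (by simpa using hε)).trans_lt hc'1
  simp only [iInf_lt_iff] at h1
  obtain ⟨t, hCt, htd, hts⟩ := h1
  have hdt : ∀ n, (⨆ _ : (t n).Nonempty, ediam (t n) ^ (1 : ℝ)) = ediam (t n) := by
    intro n
    rcases (t n).eq_empty_or_nonempty with h | h
    · simp [h]
    · simp [h]
  simp only [hdt] at hts
  have hdfin : ∀ n, ediam (t n) ≠ ∞ := fun n => ne_top_of_le_ne_top ENNReal.ofReal_ne_top (htd n)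
  obtain ⟨a, ha0, b, hab, hbη⟩ := posSumOfEncodable (half_pos (half_pos (lt_min hη0 hε))) ℕ
  have hab' : ∀ n, a n ≤ b := fun n => le_hasSum hab n fun i _ => (ha0 i).le
  have hbη' : 2 * b ≤ η := by linarith [min_le_left η ε]
  have hbε : 2 * b ≤ ε / 2 := by linarith [min_le_right η ε]
  have hopen : ∀ n, IsOpen (thickening (a n) (t n)) := fun n => isOpen_thickening
  have hcov : C ⊆ ⋃ n, thickening (a n) (t n) :=
    hCt.trans (iUnion_mono fun n => self_subset_thickening (ha0 n) _)
  obtain ⟨F₀, hF₀⟩ := hC.elim_finite_subcover _ hopen hcov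
  set F := F₀.filter fun n => (C ∩ thickening (a n) (t n)).Nonempty with hF
  refine ⟨fun n => thickening (a n) (t n), fun n => (ediam (t n)).toReal + 2 * a n, F, hopen,
    fun n => by have := ha0 n; positivity, fun n => ?_, fun n => ?_, ?_, ?_, ?_⟩
  · have h2 : (ediam (t n)).toReal ≤ ε / 2 :=
      ENNReal.toReal_le_of_le_ofReal (by positivity) (htd n)
    linarith [hab' n]
  · have h2 := ediam_thickening_le (s := t n) (a n).toNNReal
    rw [Real.coe_toNNReal _ (ha0 n).le] at h2
    refine h2.trans (le_of_eq ?_)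
    have h3 := (ha0 n).le
    rw [ENNReal.ofReal_add ENNReal.toReal_nonneg (by positivity), ENNReal.ofReal_toReal (hdfin n),
      ENNReal.ofReal_mul (by norm_num)]
    simp [ENNReal.ofReal]
  · intro x hx
    obtain ⟨n, hn, hxn⟩ := mem_iUnion₂.1 (hF₀ hx)
    exact mem_iUnion₂.2 ⟨n, Finset.mem_filter.2 ⟨hn, x, hx, hxn⟩, hxn⟩
  · intro n hn
    exact (Finset.mem_filter.1 hn).2
  · rw [Finset.sum_add_distrib, ← Finset.mul_sum]
    have h2 : ∑ n ∈ F, (ediam (t n)).toReal ≤ c'.toReal := by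
      rw [← ENNReal.toReal_sum fun n _ => hdfin n]
      exact ENNReal.toReal_mono hc'top ((ENNReal.sum_le_tsum F).trans hts.le)
    have h3 : ∑ n ∈ F, a n ≤ b := sum_le_hasSum F (fun i _ => (ha0 i).le) hab
    linarith

/-- **Gołąb's theorem.** Length is lower semicontinuous along compact connected sets: if `K` lies in
arbitrarily small neighbourhoods of compact connected sets of length less than `c`, then the length
of `K` is at most `c`. -/
theorem hausdorffMeasure_le_of_forall_subset_thickening [MeasurableSpace Y] [BorelSpace Y]
    {K : Set Y} {c : ℝ} (h : ∀ ε > 0, ∃ C : Set Y, IsCompact C ∧ IsConnected C ∧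
      μH[1] C < ENNReal.ofReal c ∧ K ⊆ thickening ε C) : μH[1] K ≤ ENNReal.ofReal c := by
  classical
  have hc : 0 < c := by
    obtain ⟨C, -, -, hC, -⟩ := h 1 one_pos
    simpa using hC.bot_lt
  -- At scale `δ` there are at most `2 c / δ + 1` pieces, each of which is enlarged by `2 ε`.
  have key : ∀ δ > 0, ∃ L : List (Set Y), K ⊆ ⋃ i : Fin L.length, L.get i ∧
      (∀ i : Fin L.length, ediam (L.get i) ≤ ENNReal.ofReal (4 * δ)) ∧
      ∑ i : Fin L.length, ediam (L.get i) ≤ ENNReal.ofReal (c + δ) := by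
    intro δ hδ
    set N : ℝ := 2 * c / δ + 1 with hN
    have hN0 : 0 < N := by positivity
    set ε : ℝ := min (δ / 2) (δ / (3 * N)) with hε
    have hε0 : 0 < ε := by positivity
    have hεδ : ε ≤ δ / 2 := min_le_left _ _
    have hεN : 3 * N * ε ≤ δ := by
      have := min_le_right (δ / 2) (δ / (3 * N))
      rw [← hε, le_div_iff₀ (by positivity)] at this
      linarith
    obtain ⟨C, hCc, hCconn, hClen, hKC⟩ := h ε hε0
    obtain ⟨U, w, F, hU, hw0, hwε, hwU, hcov, hmeet, hsum⟩ :=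
      exists_finite_open_cover_of_hausdorffMeasure_lt hCc hε0 hClen
    have hF : F.Nonempty := by
      obtain ⟨x, hx⟩ := hCconn.1
      obtain ⟨i, hi, -⟩ := mem_iUnion₂.1 (hcov hx)
      exact ⟨i, hi⟩
    obtain ⟨L, hL1, hL2, hL3, hL4⟩ :=
      (grown_of_isPreconnected hCconn.2 hU hF hcov hmeet).exists_pieces (δ := δ) (by linarith)
        hw0 hwε hwU U w (fun i _ => Subset.rfl)
        (fun i _ => ⟨hwU i, hw0 i, (hwε i).trans_lt (by linarith)⟩)
    have hk : (L.length : ℝ) ≤ N := by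
      have h1 : ((L.length : ℝ) - 1) * (δ / 2) ≤ c := by
        have h0 : (L.length : ℝ) - 1 ≥ 0 := by
          have : L ≠ [] := by
            rintro rfl
            obtain ⟨x, hx⟩ := hCconn.1
            obtain ⟨i, hi, hxi⟩ := mem_iUnion₂.1 (hcov hx)
            obtain ⟨q, hq, -⟩ := hL1 i hi x hxi
            simp at hq
          have := List.length_pos_of_ne_nil this
          have : (1 : ℝ) ≤ L.length := by exact_mod_cast this
          linarith
        nlinarith
      rw [← sub_le_iff_le_add, le_div_iff₀ hδ]
      linarith
    have hd : ∀ q ∈ L, ediam (thickening ε q.1) ≤ ENNReal.ofReal (q.2 + 2 * ε) := by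
      intro q hq
      have h2 := ediam_thickening_le (s := q.1) ε.toNNReal
      rw [Real.coe_toNNReal _ hε0.le] at h2
      refine h2.trans ?_
      rw [ENNReal.ofReal_add (hL2 q hq).2.1 (by positivity), ENNReal.ofReal_mul (by norm_num)]
      refine add_le_add (hL2 q hq).1 (le_of_eq ?_)
      simp [ENNReal.ofReal]
    refine ⟨L.map fun q => thickening ε q.1, ?_, ?_, ?_⟩
    · intro x hx
      obtain ⟨y, hy, hxy⟩ := mem_thickening_iff.1 (hKC hx)
      obtain ⟨i, hi, hyi⟩ := mem_iUnion₂.1 (hcov hy)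
      obtain ⟨q, hq, hyq⟩ := hL1 i hi y hyi
      obtain ⟨k, hk⟩ := List.get_of_mem (List.mem_map_of_mem (f := fun q => thickening ε q.1) hq)
      exact mem_iUnion.2 ⟨k, hk ▸ mem_thickening_iff.2 ⟨y, hyq, hxy⟩⟩
    · intro i
      obtain ⟨q, hq, hqi⟩ := List.mem_map.1 (List.get_mem (L.map fun q => thickening ε q.1) i)
      rw [← hqi]
      exact (hd q hq).trans (ENNReal.ofReal_le_ofReal (by linarith [(hL2 q hq).2.2]))
    · have h1 : ∀ M : List (Set Y × ℝ), (∀ q ∈ M, q ∈ L) →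
          ((M.map fun q => thickening ε q.1).map ediam).sum ≤
            ENNReal.ofReal ((M.map Prod.snd).sum + 2 * ε * M.length) ∧
          0 ≤ (M.map Prod.snd).sum := by
        intro M
        induction M with
        | nil => simp
        | cons q M ih =>
          intro hM
          obtain ⟨h2, h3⟩ := ih fun q hq => hM q (List.mem_cons_of_mem _ hq)
          have hq := hM q List.mem_cons_self
          have hq0 := (hL2 q hq).2.1
          refine ⟨?_, by simpa using add_nonneg hq0 h3⟩
          simp only [List.map_cons, List.sum_cons, List.length_cons]
          refine (add_le_add (hd q hq) h2).trans (le_of_eq ?_)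
          rw [← ENNReal.ofReal_add (by positivity) (by positivity)]
          congr 1
          push_cast
          ring
      have h4 : ∑ i : Fin (L.map fun q => thickening ε q.1).length,
          ediam ((L.map fun q => thickening ε q.1).get i) =
          ((L.map fun q => thickening ε q.1).map ediam).sum := by
        rw [← Fin.sum_univ_fun_getElem]
        rfl
      rw [h4]
      refine (h1 L fun _ h => h).1.trans (ENNReal.ofReal_le_ofReal ?_)
      nlinarith
  choose L hL1 hL2 hL3 using fun n : ℕ => key (1 / ((n : ℝ) + 1)) (by positivity)
  have hlim : Tendsto (fun n : ℕ => 1 / ((n : ℝ) + 1)) atTop (𝓝 0) :=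
    tendsto_one_div_add_atTop_nhds_zero_nat
  have h5 : Tendsto (fun n : ℕ => ENNReal.ofReal (4 * (1 / ((n : ℝ) + 1)))) atTop (𝓝 0) := by
    have := ENNReal.tendsto_ofReal (hlim.const_mul 4)
    simpa using this
  have h6 : Tendsto (fun n : ℕ => ENNReal.ofReal (c + 1 / ((n : ℝ) + 1))) atTop
      (𝓝 (ENNReal.ofReal c)) := by
    have := ENNReal.tendsto_ofReal (hlim.const_add c)
    simpa using this
  refine (Measure.hausdorffMeasure_le_liminf_sum 1 K _ h5 (fun n i => (L n).get i)
    (Eventually.of_forall hL2) (Eventually.of_forall hL1)).trans ?_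
  rw [← h6.liminf_eq]
  refine liminf_le_liminf (Eventually.of_forall fun n => ?_)
  simpa only [ENNReal.rpow_one] using hL3 n

/-- **Blaschke and Gołąb.** Every sequence of continua in a compact set has a limit, along a given
ultrafilter, which is a continuum whose length is at most the limit of the lengths. -/
theorem exists_continuum_limit [MeasurableSpace Y] [BorelSpace Y] {X : Set Y} (hX : IsCompact X)
    {K : ℕ → Set Y} (hKX : ∀ n, K n ⊆ X) (hKcl : ∀ n, IsClosed (K n))
    (hKconn : ∀ n, IsConnected (K n)) (l : Ultrafilter ℕ) :
    ∃ K' : Set Y, K' ⊆ X ∧ IsClosed K' ∧ IsConnected K' ∧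
      (∀ O, IsOpen O → K' ⊆ O → ∀ᶠ n in (l : Filter ℕ), K n ⊆ O) ∧
      ∀ b, Tendsto (fun n => μH[1] (K n)) l (𝓝 b) → μH[1] K' ≤ b := by
  let κ : ℕ → TopologicalSpace.NonemptyCompacts Y := fun n =>
    ⟨⟨K n, hX.of_isClosed_subset (hKcl n) (hKX n)⟩, (hKconn n).1⟩
  have hcomp := TopologicalSpace.NonemptyCompacts.isCompact_subsets_of_isCompact hX
  obtain ⟨κ', hκ'X, hκ'⟩ := isCompact_iff_ultrafilter_le_nhds.1 hcomp (l.map κ) (by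
    rw [le_principal_iff]
    exact Filter.mem_map.2 (univ_mem' hKX))
  have hlim : Tendsto κ l (𝓝 κ') := hκ'
  have hsub : ∀ O, IsOpen O → (κ' : Set Y) ⊆ O → ∀ᶠ n in (l : Filter ℕ), K n ⊆ O :=
    fun O hO h => hlim.eventually
      ((TopologicalSpace.NonemptyCompacts.isOpen_subsets_of_isOpen hO).mem_nhds h)
  have hmeet : ∀ O, IsOpen O → ((κ' : Set Y) ∩ O).Nonempty →
      ∀ᶠ n in (l : Filter ℕ), (K n ∩ O).Nonempty :=
    fun O hO h => hlim.eventually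
      ((TopologicalSpace.NonemptyCompacts.isOpen_inter_nonempty_of_isOpen hO).mem_nhds h)
  refine ⟨κ', hκ'X, κ'.isCompact.isClosed, ⟨κ'.nonempty, ?_⟩, hsub, ?_⟩
  · intro u v hu hv huv hKu hKv
    by_contra hcon
    rw [not_nonempty_iff_eq_empty] at hcon
    have hdisj : Disjoint ((κ' : Set Y) \ v) ((κ' : Set Y) \ u) := by
      rw [Set.disjoint_left]
      rintro x ⟨hx, hxv⟩ ⟨-, hxu⟩
      exact (huv hx).elim hxu hxv
    obtain ⟨u', v', hu', hv', huu', hvv', huv'⟩ :=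
      SeparatedNhds.of_isCompact_isCompact (κ'.isCompact.diff hv) (κ'.isCompact.diff hu) hdisj
    have hcov : (κ' : Set Y) ⊆ u' ∪ v' := by
      intro x hx
      by_cases hxv : x ∈ v
      · refine Or.inr (hvv' ⟨hx, fun hxu => ?_⟩)
        have : x ∈ (κ' : Set Y) ∩ (u ∩ v) := ⟨hx, hxu, hxv⟩
        rw [hcon] at this
        exact this
      · exact Or.inl (huu' ⟨hx, hxv⟩)
    have h1 : ((κ' : Set Y) ∩ u').Nonempty := by
      obtain ⟨x, hx, hxu⟩ := hKu
      refine ⟨x, hx, huu' ⟨hx, fun hxv => ?_⟩⟩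
      have : x ∈ (κ' : Set Y) ∩ (u ∩ v) := ⟨hx, hxu, hxv⟩
      rw [hcon] at this
      exact this
    have h2 : ((κ' : Set Y) ∩ v').Nonempty := by
      obtain ⟨x, hx, hxv⟩ := hKv
      refine ⟨x, hx, hvv' ⟨hx, fun hxu => ?_⟩⟩
      have : x ∈ (κ' : Set Y) ∩ (u ∩ v) := ⟨hx, hxu, hxv⟩
      rw [hcon] at this
      exact this
    obtain ⟨n, hn1, hn2, hn3⟩ := ((hsub _ (hu'.union hv') hcov).and
      ((hmeet _ hu' h1).and (hmeet _ hv' h2))).exists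
    obtain ⟨x, -, hxu, hxv⟩ := (hKconn n).2 u' v' hu' hv' hn1 hn2 hn3
    exact Set.disjoint_left.1 huv' hxu hxv
  · intro b hb
    refine le_of_forall_gt_imp_ge_of_dense fun c hc => ?_
    rcases eq_or_ne c ∞ with rfl | hctop
    · exact le_top
    rw [← ENNReal.ofReal_toReal hctop]
    refine hausdorffMeasure_le_of_forall_subset_thickening fun ε hε => ?_
    have h1 : ∀ᶠ n in (l : Filter ℕ), edist (κ n) κ' < ENNReal.ofReal ε :=
      (tendsto_iff_edist_tendsto_0.1 hlim).eventually_lt_const (by simpa using hε)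
    obtain ⟨n, hn1, hn2⟩ := ((hb.eventually_lt_const hc).and h1).exists
    refine ⟨K n, (κ n).isCompact, hKconn n, by rwa [ENNReal.ofReal_toReal hctop], fun x hx => ?_⟩
    rw [edist_comm] at hn2
    obtain ⟨y, hy, hxy⟩ := exists_edist_lt_of_hausdorffEDist_lt hx hn2
    refine mem_thickening_iff.2 ⟨y, hy, ?_⟩
    rwa [edist_dist, ENNReal.ofReal_lt_ofReal_iff hε] at hxy

end Golab

/-! ### Hahn–Banach extension and the dual of the continuous vector fields -/

section RieszRepresentation

open scoped CompactlySupported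

/-- A form of the Hahn–Banach theorem due to Mazur and Orlicz: a linear functional `b` on `W` that
is dominated on a cone by `p ∘ A`, where `p` is sublinear and `A` is linear, is dominated there by
`L ∘ A` for a linear functional `L ≤ p`. -/
theorem exists_linear_le_sublinear_of_le_on_cone {W E : Type*} [AddCommGroup W] [Module ℝ W]
    [AddCommGroup E] [Module ℝ E] (p : E → ℝ) (p_hom : ∀ c : ℝ, 0 < c → ∀ x, p (c • x) = c * p x)
    (p_add : ∀ x y, p (x + y) ≤ p x + p y) (A : W →ₗ[ℝ] E) (b : W →ₗ[ℝ] ℝ) (D : PointedCone ℝ W)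
    (h : ∀ w ∈ D, b w ≤ p (A w)) :
    ∃ L : E →ₗ[ℝ] ℝ, (∀ x, L x ≤ p x) ∧ ∀ w ∈ D, b w ≤ L (A w) := by
  have p_0 : p 0 = 0 := by
    have := p_hom 2 (by norm_num) 0
    rw [smul_zero] at this
    linarith
  let s : PointedCone ℝ (E × ℝ) :=
    { carrier := {z | ∃ w ∈ D, p (z.1 + A w) ≤ z.2 + b w}
      zero_mem' := ⟨0, D.zero_mem, by simp [p_0]⟩
      smul_mem' := by
        rintro ⟨c, hc⟩ ⟨x, r⟩ ⟨w, hw, hwr⟩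
        rcases eq_or_lt_of_le hc with rfl | hc'
        · exact ⟨0, D.zero_mem, by simp [p_0, Nonneg.mk_smul]⟩
        · refine ⟨c • w, D.smul_mem hc hw, ?_⟩
          simp only [Nonneg.mk_smul, Prod.smul_mk, map_smul, smul_eq_mul, ← smul_add, ← mul_add]
          rw [p_hom c hc']
          exact mul_le_mul_of_nonneg_left hwr hc
      add_mem' := by
        rintro ⟨x, r⟩ ⟨x', r'⟩ ⟨w, hw, hwr⟩ ⟨w', hw', hwr'⟩
        refine ⟨w + w', D.add_mem hw hw', ?_⟩
        have := p_add (x + A w) (x' + A w')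
        simp only at hwr hwr'
        simp only [Prod.mk_add_mk, map_add]
        rw [add_add_add_comm] at this
        linarith }
  obtain ⟨g, hg, hgs⟩ := riesz_extension s
    ((LinearMap.snd ℝ E ℝ).toPMap (Submodule.prod ⊥ ⊤)) (by
      rintro ⟨⟨x, r⟩, hx⟩ ⟨w, hw, hwr⟩
      obtain rfl : x = 0 := by simpa using hx
      have := h w hw
      rw [zero_add] at hwr
      change 0 ≤ r
      linarith) (by
      rintro ⟨x, r⟩
      exact ⟨⟨(0, p x - r), by simp⟩, 0, D.zero_mem, by simp⟩)
  have hg0 : ∀ r : ℝ, g (0, r) = r := fun r => hg ⟨(0, r), by simp⟩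
  have hgx : ∀ x r, g (x, r) = g (x, 0) + r := by
    intro x r
    conv_rhs => rw [← hg0 r, ← map_add]
    simp
  refine ⟨-(g.comp (LinearMap.inl ℝ E ℝ)), fun x => ?_, fun w hw => ?_⟩
  · have := hgs (x, p x) ⟨0, D.zero_mem, by simp⟩
    rw [hgx] at this
    change -g (x, 0) ≤ p x
    linarith
  · have := hgs (-A w, -b w) ⟨w, hw, by simp [p_0]⟩
    rw [hgx] at this
    have h2 : g (-A w, 0) = - g (A w, 0) := by simpa using map_neg g (A w, (0 : ℝ))
    change b w ≤ -g (A w, 0)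
    linarith

/-- The supremum of the norm over a compact set, as a seminorm on the continuous functions. -/
def supSeminorm {Y E : Type*} [TopologicalSpace Y] [NormedAddCommGroup E] [NormedSpace ℝ E]
    {X : Set Y} (hX : IsCompact X) : Seminorm ℝ C(Y, E) :=
  haveI : CompactSpace X := isCompact_iff_compactSpace.1 hX
  (normSeminorm ℝ C(X, E)).comp (σ₁₂ := RingHom.id ℝ)
    { toFun := fun g => g.restrict X
      map_add' := fun _ _ => rfl
      map_smul' := fun _ _ => rfl }

section supSeminorm

variable {Y E : Type*} [TopologicalSpace Y] [NormedAddCommGroup E] [NormedSpace ℝ E] {X : Set Y}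

theorem supSeminorm_le_iff (hX : IsCompact X) {g : C(Y, E)} {r : ℝ} (hr : 0 ≤ r) :
    supSeminorm hX g ≤ r ↔ ∀ x ∈ X, ‖g x‖ ≤ r := by
  have : CompactSpace X := isCompact_iff_compactSpace.1 hX
  exact (ContinuousMap.norm_le (g.restrict X) hr).trans Subtype.forall

theorem norm_le_supSeminorm (hX : IsCompact X) (g : C(Y, E)) {x : Y} (hx : x ∈ X) :
    ‖g x‖ ≤ supSeminorm hX g :=
  (supSeminorm_le_iff hX (apply_nonneg _ _)).1 le_rfl x hx

end supSeminorm

/-- A linear functional on the continuous functions that is nonnegative on the functions that are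
nonnegative on a compact set `X` is the integral against a finite measure on `X`. -/
theorem exists_measure_of_nonneg_on_isCompact {X : Set Plane} (hX : IsCompact X)
    (Λ : C(Plane, ℝ) →ₗ[ℝ] ℝ) (hΛ : ∀ g : C(Plane, ℝ), (∀ x ∈ X, 0 ≤ g x) → 0 ≤ Λ g) :
    ∃ m : Measure Plane, IsFiniteMeasure m ∧ m Xᶜ = 0 ∧ ∀ g : C(Plane, ℝ), ∫ x, g x ∂m = Λ g := by
  have hΛ0 : ∀ g : C(Plane, ℝ), (∀ x ∈ X, g x = 0) → Λ g = 0 := by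
    intro g hg
    refine le_antisymm ?_ (hΛ g fun x hx => (hg x hx).ge)
    have := hΛ (-g) fun x hx => by simp [hg x hx]
    rw [map_neg] at this
    linarith
  let Λc : C_c(Plane, ℝ) →ₚ[ℝ] ℝ := PositiveLinearMap.mk₀
    { toFun := fun g => Λ g.toContinuousMap
      map_add' := fun g g' => Λ.map_add g.toContinuousMap g'.toContinuousMap
      map_smul' := fun c g => Λ.map_smul c g.toContinuousMap }
    (fun g hg => hΛ _ fun x _ => hg x)
  set m := RealRMK.rieszMeasure Λc with hm
  have hint : ∀ g : C_c(Plane, ℝ), ∫ x, g x ∂m = Λ g.toContinuousMap :=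
    fun g => RealRMK.integral_rieszMeasure Λc g
  have hmX : m Xᶜ = 0 := by
    rw [hX.isClosed.isOpen_compl.measure_eq_iSup_isCompact]
    simp only [ENNReal.iSup_eq_zero]
    intro K hKX hK
    obtain ⟨g, hgK, hgX, hgc, hg01⟩ := exists_continuous_one_zero_of_isCompact hK hX.isClosed
      (subset_compl_iff_disjoint_right.1 hKX)
    have h1 := hint ⟨g, hgc⟩
    rw [hΛ0 _ hgX] at h1
    have h2 := (integral_eq_zero_iff_of_nonneg (fun x => (hg01 x).1)
      (g.continuous.integrable_of_hasCompactSupport hgc)).1 h1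
    refine measure_mono_null (fun x hx => ?_) (ae_iff.1 h2)
    simp [hgK hx]
  obtain ⟨χ, hχX, -, hχc, hχ01⟩ := exists_continuous_one_zero_of_isCompact hX isClosed_empty
    (disjoint_empty X)
  have hfin : IsFiniteMeasure m := by
    refine ⟨?_⟩
    have : m X < ∞ := hX.measure_lt_top
    calc m univ ≤ m X + m Xᶜ := by rw [← union_compl_self X]; exact measure_union_le _ _
      _ < ∞ := by rw [hmX, add_zero]; exact this
  refine ⟨m, hfin, hmX, fun g => ?_⟩
  have hXae : ∀ᵐ x ∂m, x ∈ X := mem_ae_iff.2 hmX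
  have h1 := hint ⟨χ * g, hχc.mul_right⟩
  have h2 : ∫ x, g x ∂m = ∫ x, (χ * g) x ∂m := by
    refine integral_congr_ae (hXae.mono fun x hx => ?_)
    simp [hχX hx]
  rw [h2]
  refine h1.trans ?_
  rw [← sub_eq_zero, ← map_sub]
  refine hΛ0 _ fun x hx => ?_
  simp [hχX hx]

theorem memLp_of_continuous_of_isCompact {X : Set Plane} (hX : IsCompact X) {m : Measure Plane}
    [IsFiniteMeasure m] (hmX : m Xᶜ = 0) {E : Type*} [NormedAddCommGroup E]
    {G : Plane → E} (hG : Continuous G) (p : ℝ≥0∞) : MemLp G p m := by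
  obtain ⟨C, hC⟩ := hX.exists_bound_of_continuousOn hG.continuousOn
  have hXae : ∀ᵐ x ∂m, x ∈ X := mem_ae_iff.2 hmX
  exact MemLp.of_bound hG.aestronglyMeasurable C (hXae.mono fun x hx => hC x hx)

/-- The Cauchy–Schwarz bound of the `L¹` norm by the `L²` norm. -/
theorem integral_norm_le_norm_mul_sqrt {m : Measure Plane} [IsFiniteMeasure m]
    (h : Lp Plane 2 m) : ∫ x, ‖h x‖ ∂m ≤ ‖h‖ * √(m.real univ) := by
  have h1 := eLpNorm_le_eLpNorm_mul_rpow_measure_univ (μ := m) (f := h) (p := 1) (q := 2)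
    (by norm_num) (Lp.aestronglyMeasurable h)
  rw [integral_norm_eq_lintegral_enorm (Lp.aestronglyMeasurable h), ← eLpNorm_one_eq_lintegral_enorm,
    Lp.norm_def]
  have h2 : (m univ ^ (1 / (1 : ℝ≥0∞).toReal - 1 / (2 : ℝ≥0∞).toReal)).toReal =
      √(m.real univ) := by
    rw [← ENNReal.toReal_rpow, Real.sqrt_eq_rpow]
    norm_num [Measure.real]
  rw [← h2, ← ENNReal.toReal_mul]
  refine ENNReal.toReal_mono (ENNReal.mul_ne_top (Lp.eLpNorm_ne_top h) ?_) h1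
  exact ENNReal.rpow_ne_top_of_nonneg (by norm_num) (measure_ne_top m _)

/-- A linear functional on the continuous vector fields that is bounded by `M` times the supremum
norm on a compact set `X` is given by a vector measure `σ m` on `X` of mass at most `M`. A measure
`m` with `L G ≤ ∫ |G| dm` is found first; `L` then extends to `L²(m)`, still under the bound by the
`L¹(m)` norm, and `σ` comes from the Riesz representation theorem in this Hilbert space. -/
theorem exists_measure_density_of_le_supSeminorm {X : Set Plane} (hX : IsCompact X)
    (L : C(Plane, Plane) →ₗ[ℝ] ℝ) {M : ℝ} (hM : 0 ≤ M)
    (hL : ∀ G, L G ≤ M * supSeminorm hX G) :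
    ∃ (m : Measure Plane) (σ : Plane → Plane), IsFiniteMeasure m ∧ m Xᶜ = 0 ∧ MemLp σ 2 m ∧
      ∫ x, ‖σ x‖ ∂m ≤ M ∧ ∀ G, L G = ∫ x, inner ℝ (G x) (σ x) ∂m := by
  obtain ⟨Λ, hΛp, hΛL⟩ := exists_linear_le_sublinear_of_le_on_cone
    (fun g : C(Plane, ℝ) => M * supSeminorm hX g)
    (fun c hc x => by
      simp only [map_smul_eq_mul, Real.norm_of_nonneg hc.le]
      ring)
    (fun x y => by
      rw [← mul_add]
      exact mul_le_mul_of_nonneg_left (map_add_le_add _ x y) hM)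
    (LinearMap.fst ℝ C(Plane, ℝ) C(Plane, Plane)) (L.comp (LinearMap.snd ℝ _ _))
    { carrier := {z | ∀ x ∈ X, ‖z.2 x‖ ≤ z.1 x}
      zero_mem' := by simp
      smul_mem' := by
        rintro ⟨c, hc⟩ ⟨g, G⟩ hg x hx
        simpa [Nonneg.mk_smul, norm_smul, abs_of_nonneg hc] using
          mul_le_mul_of_nonneg_left (hg x hx) hc
      add_mem' := by
        rintro ⟨g, G⟩ ⟨g', G'⟩ hg hg' x hx
        exact (norm_add_le _ _).trans (add_le_add (hg x hx) (hg' x hx)) }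
    (fun z hz => (hL z.2).trans (mul_le_mul_of_nonneg_left
      ((supSeminorm_le_iff hX (apply_nonneg _ _)).2 fun x hx =>
        (hz x hx).trans ((le_abs_self _).trans (norm_le_supSeminorm hX z.1 hx))) hM))
  have hΛL' : ∀ (g : C(Plane, ℝ)) (G : C(Plane, Plane)), (∀ x ∈ X, ‖G x‖ ≤ g x) → L G ≤ Λ g :=
    fun g G h => hΛL (g, G) h
  obtain ⟨m, hmfin, hmX, hm⟩ := exists_measure_of_nonneg_on_isCompact hX Λ
    (fun g hg => by simpa using hΛL' g 0 (by simpa using hg))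
  have hmass : m.real univ ≤ M := by
    have h1 : m.real univ = Λ 1 := by
      rw [← hm]
      simp
    rw [h1]
    refine (hΛp 1).trans ?_
    have : supSeminorm hX (1 : C(Plane, ℝ)) ≤ 1 :=
      (supSeminorm_le_iff hX zero_le_one).2 fun x _ => by simp
    nlinarith
  have hmem : ∀ G : C(Plane, Plane), MemLp G 2 m :=
    fun G => memLp_of_continuous_of_isCompact hX hmX G.continuous 2
  have hLG : ∀ G : C(Plane, Plane), L G ≤ ∫ x, ‖G x‖ ∂m := fun G =>
    (hΛL' ⟨fun x => ‖G x‖, by fun_prop⟩ G fun x _ => le_rfl).trans_eq (hm _).symm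
  have hint : ∀ h : Lp Plane 2 m, Integrable (fun x => ‖h x‖) m := fun h =>
    ((Lp.memLp h).integrable (by norm_num)).norm
  let A : C(Plane, Plane) →ₗ[ℝ] Lp Plane 2 m :=
    { toFun := fun G => (hmem G).toLp G
      map_add' := fun G G' => MemLp.toLp_add (hmem G) (hmem G')
      map_smul' := fun c G => MemLp.toLp_const_smul c (hmem G) }
  have hA : ∀ G, A G =ᵐ[m] G := fun G => (hmem G).coeFn_toLp
  obtain ⟨Φ, hΦ, hΦL⟩ := exists_linear_le_sublinear_of_le_on_cone
    (fun h : Lp Plane 2 m => ∫ x, ‖h x‖ ∂m)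
    (fun c hc h => by
      rw [← integral_const_mul]
      refine integral_congr_ae ((Lp.coeFn_smul c h).mono fun x hx => ?_)
      simp [hx, norm_smul, abs_of_pos hc])
    (fun h h' => by
      rw [← integral_add (hint h) (hint h')]
      refine integral_mono_ae (hint _) ((hint h).add (hint h'))
        ((Lp.coeFn_add h h').mono fun x hx => ?_)
      dsimp only
      rw [hx]
      exact norm_add_le _ _)
    A L ⊤ (fun G _ => (hLG G).trans_eq
      (integral_congr_ae ((hA G).mono fun x hx => by simp only [hx])))
  have hΦA : ∀ G, L G = Φ (A G) := fun G => le_antisymm (hΦL G trivial) (by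
    have := hΦL (-G) trivial
    rw [map_neg, map_neg, map_neg] at this
    linarith)
  have hbound : ∀ h, ‖Φ h‖ ≤ √(m.real univ) * ‖h‖ := by
    intro h
    have h1 := (hΦ h).trans (integral_norm_le_norm_mul_sqrt h)
    have h2 := (hΦ (-h)).trans (integral_norm_le_norm_mul_sqrt (-h))
    rw [norm_neg, map_neg] at h2
    rw [Real.norm_eq_abs, abs_le]
    constructor <;> linarith
  set σ : Lp Plane 2 m := (InnerProductSpace.toDual ℝ _).symm (Φ.mkContinuous _ hbound) with hσ
  have hΦσ : ∀ h, Φ h = ∫ x, inner ℝ (h x) (σ x) ∂m := by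
    intro h
    have h1 : inner ℝ σ h = Φ h := by
      rw [hσ, InnerProductSpace.toDual_symm_apply]
      rfl
    rw [← h1, real_inner_comm, L2.inner_def]
  refine ⟨m, σ, hmfin, hmX, Lp.memLp σ, ?_, fun G => ?_⟩
  · have h1 : ‖σ‖ * ‖σ‖ ≤ ∫ x, ‖σ x‖ ∂m := by
      rw [← real_inner_self_eq_norm_mul_norm, L2.inner_def, ← hΦσ]
      exact hΦ σ
    have h2 := integral_norm_le_norm_mul_sqrt σ
    have h3 : ‖σ‖ ≤ √(m.real univ) := by
      rcases (norm_nonneg σ).eq_or_lt with h0 | h0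
      · rw [← h0]
        positivity
      · exact le_of_mul_le_mul_left (h1.trans h2) h0
    have h4 : √(m.real univ) * √(m.real univ) = m.real univ :=
      Real.mul_self_sqrt measureReal_nonneg
    nlinarith [Real.sqrt_nonneg (m.real univ)]
  · rw [hΦA, hΦσ]
    exact integral_congr_ae ((hA G).mono fun x hx => by simp only [hx])

end RieszRepresentation

/-! ### Duality of the mass of vector measures -/

/-- What the argument uses of a space `V` of fields with size `N`, paired with the continuous vector
fields on the plane by `P`: it is the dual of these vector fields with respect to the seminorm `s`,
which only sees the pointwise norm on `X`. -/
structure EnergyDuality {V : Type*} (X : Set Plane) (N : V → ℝ≥0∞)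
    (P : V → (Plane → Plane) → ℝ) (s : Seminorm ℝ C(Plane, Plane)) : Prop where
  map_add : ∀ v, N v < ∞ → ∀ G H : C(Plane, Plane), P v ⇑(G + H) = P v G + P v H
  map_smul : ∀ v, N v < ∞ → ∀ (c : ℝ) (G : C(Plane, Plane)), P v ⇑(c • G) = c * P v G
  le : ∀ v, N v < ∞ → ∀ G : C(Plane, Plane), P v G ≤ (N v).toReal * s G
  exists_rep : ∀ (L : C(Plane, Plane) →ₗ[ℝ] ℝ) (M : ℝ), 0 ≤ M → (∀ G, L G ≤ M * s G) →
    ∃ v, N v ≤ ENNReal.ofReal M ∧ ∀ G : C(Plane, Plane), P v G = L G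
  mono : ∀ G H : C(Plane, Plane), (∀ x ∈ X, ‖G x‖ ≤ ‖H x‖) → s G ≤ s H

/-- The pairing of a vector measure with density `σ` with a vector field. -/
theorem integral_withDensityᵥ_innerSL {m : Measure Plane} [IsFiniteMeasure m] {σ G : Plane → Plane}
    (hσ : Integrable σ m) (hG : StronglyMeasurable G) {C : ℝ} (hC0 : 0 ≤ C)
    (hC : ∀ᵐ x ∂m, ‖G x‖ ≤ C) :
    (m.withDensityᵥ σ).integral G (innerSL ℝ) = ∫ x, inner ℝ (G x) (σ x) ∂m := by
  have hvar : (m.withDensityᵥ σ).variation = m.withDensity (fun x => ‖σ x‖ₑ) :=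
    Measure.variation_withDensityᵥ hσ
  have hvar_fin : IsFiniteMeasure (m.withDensityᵥ σ).variation := by
    rw [hvar]
    exact ⟨by simpa using! hσ.2⟩
  have hac : (m.withDensityᵥ σ).variation ≪ m := hvar ▸ withDensity_absolutelyContinuous _ _
  have hint : ∀ H : Plane → Plane, StronglyMeasurable H → (∀ᵐ x ∂m, ‖H x‖ ≤ C) →
      Integrable (fun x => inner ℝ (H x) (σ x)) m := by
    intro H hH hHC
    refine (hσ.norm.const_mul C).mono (hH.aestronglyMeasurable.inner hσ.1)
      (hHC.mono fun x hx => ?_)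
    rw [norm_mul, norm_norm, Real.norm_of_nonneg hC0]
    exact (norm_inner_le_norm _ _).trans (mul_le_mul_of_nonneg_right hx (norm_nonneg _))
  have hsimple : ∀ g : SimpleFunc Plane Plane,
      (m.withDensityᵥ σ).integral g (innerSL ℝ) = ∫ x, inner ℝ (g x) (σ x) ∂m := by
    intro g
    have hsint : ∀ g : SimpleFunc Plane Plane, (m.withDensityᵥ σ).Integrable g := fun g =>
      g.integrable_of_isFiniteMeasure
    have hsint' : ∀ g : SimpleFunc Plane Plane, Integrable (fun x => inner ℝ (g x) (σ x)) m := by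
      intro g
      obtain ⟨D, hD⟩ := g.exists_forall_norm_le
      refine (hσ.norm.const_mul D).mono (g.stronglyMeasurable.aestronglyMeasurable.inner hσ.1)
        (Eventually.of_forall fun x => ?_)
      rw [norm_mul, norm_norm]
      exact (norm_inner_le_norm _ _).trans
        (mul_le_mul_of_nonneg_right ((hD x).trans (le_abs_self D)) (norm_nonneg _))
    induction g using SimpleFunc.induction with
    | const c hs =>
      rename_i s
      rw [SimpleFunc.coe_piecewise]
      simp only [SimpleFunc.coe_const, Function.const_zero, piecewise_eq_indicator]
      change (m.withDensityᵥ σ).integral (fun x => s.indicator (fun _ => c) x) (innerSL ℝ) = _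
      rw [VectorMeasure.integral_indicator_const _ hs, withDensityᵥ_apply hσ hs]
      rw [innerSL_apply_apply, ← integral_inner hσ.integrableOn, ← integral_indicator hs]
      refine integral_congr_ae (Eventually.of_forall fun x => ?_)
      by_cases hx : x ∈ s <;> simp [hx]
    | add hdisj hf hg =>
      rename_i f g
      rw [SimpleFunc.coe_add, VectorMeasure.integral_add (hsint f) (hsint g), hf, hg,
        ← integral_add (hsint' f) (hsint' g)]
      simp [inner_add_left]
  have hlim := StronglyMeasurable.tendsto_approxBounded_ae (μ := m) hG hC
  have hle : ∀ n x, ‖hG.approxBounded C n x‖ ≤ C := fun n x => hG.norm_approxBounded_le hC0 n x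
  have h1 : Tendsto (fun n => (m.withDensityᵥ σ).integral (hG.approxBounded C n) (innerSL ℝ))
      atTop (𝓝 ((m.withDensityᵥ σ).integral G (innerSL ℝ))) := by
    refine VectorMeasure.tendsto_integral_of_dominated_convergence (fun _ => C)
      (fun n => (hG.approxBounded C n).stronglyMeasurable.aestronglyMeasurable)
      (integrable_const C) (fun n => Eventually.of_forall (hle n)) (hac.ae_le hlim)
  have h2 : Tendsto (fun n => ∫ x, inner ℝ (hG.approxBounded C n x) (σ x) ∂m)
      atTop (𝓝 (∫ x, inner ℝ (G x) (σ x) ∂m)) := by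
    refine tendsto_integral_of_dominated_convergence (fun x => C * ‖σ x‖)
      (fun n => (hint _ (hG.approxBounded C n).stronglyMeasurable
        (Eventually.of_forall (hle n))).1) (hσ.norm.const_mul C)
      (fun n => Eventually.of_forall fun x => ?_) (hlim.mono fun x hx => hx.inner tendsto_const_nhds)
    exact (norm_inner_le_norm _ _).trans (mul_le_mul_of_nonneg_right (hle n x) (norm_nonneg _))
  simp only [hsimple] at h1
  exact tendsto_nhds_unique h1 h2

theorem massEnergy_integrable {Ω : Set Plane} (hΩb : Bornology.IsBounded Ω) {v : MeasureField Ω}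
    (hv : massEnergy v < ∞) {E : Type*} [NormedAddCommGroup E] {G : Plane → E} (hG : Continuous G) :
    Integrable G v.1.variation := by
  have : IsFiniteMeasure v.1.variation := ⟨hv⟩
  exact (memLp_of_continuous_of_isCompact hΩb.isCompact_closure v.2 hG 1).integrable le_rfl

/-- The pairing of a vector measure with a continuous vector field. -/
def massPair {Ω : Set Plane} (v : MeasureField Ω) (G : Plane → Plane) : ℝ :=
  v.1.integral G (innerSL ℝ)

theorem abs_massPair_le {Ω : Set Plane} (v : MeasureField Ω) (G : Plane → Plane) :
    |massPair v G| ≤ ∫ x, ‖G x‖ ∂v.1.variation := by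
  have h := VectorMeasure.norm_integral_le_integral_norm (μ := v.1) (f := G) (B := innerSL ℝ)
  refine h.trans ?_
  refine mul_le_of_le_one_left (integral_nonneg fun _ => norm_nonneg _) ?_
  exact norm_innerSL_le _

/-- The finite vector measures on `closure Ω` are the dual of the continuous vector fields with the
supremum norm. -/
theorem energyDuality_mass {Ω : Set Plane} (hΩb : Bornology.IsBounded Ω) :
    EnergyDuality (closure Ω) (massEnergy (Ω := Ω)) massPair
      (supSeminorm hΩb.isCompact_closure) where
  map_add v hv G H := VectorMeasure.integral_add (massEnergy_integrable hΩb hv G.continuous)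
    (massEnergy_integrable hΩb hv H.continuous)
  map_smul v hv c G := VectorMeasure.integral_smul _ _ _ c
  le v hv G := by
    have : IsFiniteMeasure v.1.variation := ⟨hv⟩
    have hXae : ∀ᵐ x ∂v.1.variation, x ∈ closure Ω := mem_ae_iff.2 v.2
    refine (le_abs_self _).trans ((abs_massPair_le v G).trans ?_)
    refine (integral_mono_ae (massEnergy_integrable hΩb hv G.continuous).norm
      (integrable_const (supSeminorm hΩb.isCompact_closure G))
      (hXae.mono fun x hx => norm_le_supSeminorm _ G hx)).trans ?_
    simp [massEnergy, Measure.real]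
  exists_rep L M hM hL := by
    obtain ⟨m, σ, hm, hmX, hσ, hσM, hLσ⟩ :=
      exists_measure_density_of_le_supSeminorm hΩb.isCompact_closure L hM hL
    have hσ1 : Integrable σ m := hσ.integrable (by norm_num)
    have hvar : (m.withDensityᵥ σ).variation = m.withDensity (fun x => ‖σ x‖ₑ) :=
      Measure.variation_withDensityᵥ hσ1
    have hXae : ∀ᵐ x ∂m, x ∈ closure Ω := mem_ae_iff.2 hmX
    refine ⟨⟨m.withDensityᵥ σ, ?_⟩, ?_, fun G => ?_⟩
    · rw [hvar]
      exact withDensity_absolutelyContinuous _ _ hmX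
    · simp only [massEnergy, hvar, withDensity_apply _ MeasurableSet.univ, Measure.restrict_univ]
      rw [← ofReal_integral_norm_eq_lintegral_enorm hσ1]
      exact ENNReal.ofReal_le_ofReal hσM
    · rw [hLσ]
      exact integral_withDensityᵥ_innerSL hσ1 G.continuous.stronglyMeasurable
        (apply_nonneg (supSeminorm hΩb.isCompact_closure) G)
        (hXae.mono fun x hx => norm_le_supSeminorm _ G hx)
  mono G H h := (supSeminorm_le_iff _ (apply_nonneg _ _)).2 fun x hx =>
    (h x hx).trans (norm_le_supSeminorm _ H hx)

/-! ### The dual of the continuous fields with an `L^p` norm -/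

/-- A bound of the pairing with `σ m` by the norm of `Lᵖ(μ)` passes from continuous to bounded
measurable fields, since the former are dense in `Lʳ(m + μ)` for `r = max p 2`. -/
theorem integral_inner_le_of_bounded {m μ : Measure Plane} [IsFiniteMeasure m] [IsFiniteMeasure μ]
    {p : ℝ≥0∞} (hp1 : 1 ≤ p) (hp : p ≠ ∞) {σ : Plane → Plane} (hσ : MemLp σ 2 m) {M : ℝ}
    (h : ∀ g : C(Plane, Plane), ∫ x, inner ℝ (g x) (σ x) ∂m ≤ M * (eLpNorm g p μ).toReal)
    {G : Plane → Plane} (hG : StronglyMeasurable G) {C : ℝ} (hGC : ∀ x, ‖G x‖ ≤ C) :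
    ∫ x, inner ℝ (G x) (σ x) ∂m ≤ M * (eLpNorm G p μ).toReal := by
  have : Fact (1 ≤ p) := ⟨hp1⟩
  set r : ℝ≥0∞ := max p 2 with hr
  have hrtop : r ≠ ∞ := by simp [hr, hp]
  have hmem : ∀ (ν : Measure Plane) [IsFiniteMeasure ν] (a : ℝ≥0∞), MemLp G a ν := fun ν _ a =>
    MemLp.of_bound hG.aestronglyMeasurable C (Eventually.of_forall hGC)
  choose g hg hgr using fun n : ℕ => (hmem (m + μ) r).exists_boundedContinuous_eLpNorm_sub_le hrtop
    (ε := ((n : ℝ≥0∞))⁻¹) (by simp)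
  have hgmem : ∀ n (ν : Measure Plane) [IsFiniteMeasure ν] (a : ℝ≥0∞), MemLp (g n) a ν :=
    fun n ν _ a => MemLp.of_bound (g n).continuous.aestronglyMeasurable ‖g n‖
      (Eventually.of_forall (g n).norm_coe_le_norm)
  have hlim : ∀ (ν : Measure Plane) (a : ℝ≥0∞), ν ≤ m + μ → a ≤ r →
      Tendsto (fun n => eLpNorm (⇑(g n) - G) a ν) atTop (𝓝 0) := by
    intro ν a hν ha
    set D := (m + μ) univ ^ (1 / a.toReal - 1 / r.toReal) with hD
    rcases eq_or_ne a 0 with rfl | ha0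
    · simp
    have hDtop : D ≠ ∞ := by
      refine ENNReal.rpow_ne_top_of_nonneg ?_ (measure_ne_top _ _)
      rw [sub_nonneg]
      exact one_div_le_one_div_of_le (ENNReal.toReal_pos ha0 (ne_top_of_le_ne_top hrtop ha))
        (ENNReal.toReal_mono hrtop ha)
    have hle : ∀ n, eLpNorm (⇑(g n) - G) a ν ≤ (n : ℝ≥0∞)⁻¹ * D := by
      intro n
      rw [eLpNorm_sub_comm]
      refine (eLpNorm_mono_measure _ hν).trans
        ((eLpNorm_le_eLpNorm_mul_rpow_measure_univ ha ?_).trans (mul_le_mul_left (hg n) _))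
      exact hG.aestronglyMeasurable.sub (g n).continuous.aestronglyMeasurable
    refine tendsto_of_tendsto_of_tendsto_of_le_of_le tendsto_const_nhds ?_ (fun n => zero_le) hle
    have := ENNReal.Tendsto.mul_const (b := D) ENNReal.tendsto_inv_nat_nhds_zero (Or.inr hDtop)
    simpa using this
  have hlim2 : Tendsto (fun n => (hgmem n m 2).toLp (g n)) atTop (𝓝 ((hmem m 2).toLp G)) :=
    (Lp.tendsto_Lp_iff_tendsto_eLpNorm'' _ _ _ _).2
      (hlim m 2 (Measure.le_add_right le_rfl) (le_max_right _ _))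
  have hlimp : Tendsto (fun n => (hgmem n μ p).toLp (g n)) atTop (𝓝 ((hmem μ p).toLp G)) :=
    (Lp.tendsto_Lp_iff_tendsto_eLpNorm'' _ _ _ _).2
      (hlim μ p (Measure.le_add_left le_rfl) (le_max_left _ _))
  have hinner : ∀ (H : Plane → Plane) (hH : MemLp H 2 m),
      inner ℝ (hσ.toLp σ) (hH.toLp H) = ∫ x, inner ℝ (H x) (σ x) ∂m := by
    intro H hH
    rw [real_inner_comm, L2.inner_def]
    refine integral_congr_ae ?_
    filter_upwards [hσ.coeFn_toLp, hH.coeFn_toLp] with x hx hx'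
    rw [hx, hx']
  rw [← hinner G (hmem m 2), ← Lp.norm_toLp G (hmem μ p)]
  refine le_of_tendsto_of_tendsto
    ((tendsto_const_nhds (x := hσ.toLp σ)).inner (𝕜 := ℝ) hlim2) (hlimp.norm.const_mul M)
    (Eventually.of_forall fun n => ?_)
  dsimp only
  rw [hinner _ (hgmem n m 2), Lp.norm_toLp]
  exact h (g n).toContinuousMap

/-- The extremal case of Hölder's inequality: the `L^q` norm of an integrable field is bounded by
its norm as a functional on the bounded fields with the norm of `L^p`. -/
theorem eLpNorm_le_of_forall_bounded {μ : Measure Plane} [IsFiniteMeasure μ] {p q : ℝ}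
    (hpq : p.HolderConjugate q) {v : Plane → Plane} (hv : StronglyMeasurable v) {M : ℝ} (hM : 0 ≤ M)
    (h : ∀ (G : Plane → Plane) (C : ℝ), StronglyMeasurable G → (∀ x, ‖G x‖ ≤ C) →
      ∫ x, inner ℝ (G x) (v x) ∂μ ≤ M * (eLpNorm G (ENNReal.ofReal p) μ).toReal) :
    eLpNorm v (ENNReal.ofReal q) μ ≤ ENNReal.ofReal M := by
  have hp0 := hpq.pos
  have hq0 := hpq.symm.pos
  have hq1 := hpq.symm.lt
  have hp0' : ENNReal.ofReal p ≠ 0 := by simpa using hp0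
  have hq0' : ENNReal.ofReal q ≠ 0 := by simpa using hq0
  have key : ∀ n : ℕ, ∫⁻ x in {x | ‖v x‖ ≤ n}, ‖v x‖ₑ ^ q ∂μ ≤ ENNReal.ofReal M ^ q := by
    intro n
    set S := {x | ‖v x‖ ≤ (n : ℝ)} with hS
    have hSm : MeasurableSet S := hv.norm.measurable measurableSet_Iic
    set G : Plane → Plane := S.indicator fun x => ‖v x‖ ^ (q - 2) • v x with hG
    have hGm : StronglyMeasurable G :=
      (((hv.norm.measurable.pow_const (q - 2)).stronglyMeasurable).smul hv).indicator hSm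
    have hnorm : ∀ x, ‖‖v x‖ ^ (q - 2) • v x‖ = ‖v x‖ ^ (q - 1) := by
      intro x
      rcases eq_or_ne (v x) 0 with h0 | h0
      · simp [h0, Real.zero_rpow (sub_pos.2 hq1).ne']
      · rw [norm_smul, Real.norm_of_nonneg (by positivity), ← Real.rpow_add_one (by simpa using h0)]
        ring_nf
    have hGn : ∀ x, ‖G x‖ ≤ (n : ℝ) ^ (q - 1) := by
      intro x
      by_cases hx : x ∈ S
      · rw [hG, indicator_of_mem hx, hnorm]
        exact Real.rpow_le_rpow (norm_nonneg _) hx (sub_pos.2 hq1).le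
      · rw [hG, indicator_of_notMem hx, norm_zero]
        positivity
    have h1 := h G _ hGm hGn
    have hinner : ∀ x, inner ℝ (G x) (v x) = S.indicator (fun x => ‖v x‖ ^ q) x := by
      intro x
      by_cases hx : x ∈ S
      · rw [hG, indicator_of_mem hx, indicator_of_mem hx, real_inner_smul_left,
          real_inner_self_eq_norm_sq]
        rcases eq_or_ne (v x) 0 with h0 | h0
        · simp [h0, Real.zero_rpow hq0.ne']
        · rw [← Real.rpow_natCast, ← Real.rpow_add (by simpa using h0)]
          norm_num
      · rw [hG, indicator_of_notMem hx, indicator_of_notMem hx, inner_zero_left]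
    set I := ∫⁻ x in S, ‖v x‖ₑ ^ q ∂μ with hI
    have henorm : ∀ x, ENNReal.ofReal (‖v x‖ ^ q) = ‖v x‖ₑ ^ q := by
      intro x
      rw [← ofReal_norm, ENNReal.ofReal_rpow_of_nonneg (norm_nonneg _) hq0.le]
    have hIfin : I ≠ ∞ := by
      refine ne_top_of_le_ne_top (b := ∫⁻ x in S, ENNReal.ofReal ((n : ℝ) ^ q) ∂μ) ?_
        (setLIntegral_mono measurable_const fun x hx => ?_)
      · rw [lintegral_const]
        exact ENNReal.mul_ne_top ENNReal.ofReal_ne_top (measure_ne_top _ _)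
      · rw [← henorm]
        exact ENNReal.ofReal_le_ofReal (Real.rpow_le_rpow (norm_nonneg _) hx hq0.le)
    have hleft : ∫ x, inner ℝ (G x) (v x) ∂μ = I.toReal := by
      simp only [hinner]
      rw [integral_indicator hSm, integral_eq_lintegral_of_nonneg_ae
        (Eventually.of_forall fun x => by positivity)
        (hv.norm.measurable.pow_const q).aestronglyMeasurable]
      simp only [henorm, hI]
    have hright : eLpNorm G (ENNReal.ofReal p) μ = I ^ (1 / p) := by
      rw [eLpNorm_eq_lintegral_rpow_enorm_toReal hp0' ENNReal.ofReal_ne_top,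
        ENNReal.toReal_ofReal hp0.le, hI, ← lintegral_indicator hSm]
      congr 2
      ext x
      by_cases hx : x ∈ S
      · rw [hG, indicator_of_mem hx, indicator_of_mem hx, ← ofReal_norm, hnorm,
          ENNReal.ofReal_rpow_of_nonneg (by positivity) hp0.le, ← Real.rpow_mul (norm_nonneg _),
          hpq.symm.sub_one_mul_conj, henorm]
      · rw [hG, indicator_of_notMem hx, indicator_of_notMem hx]
        simp [hp0]
    rw [hleft, hright, ← ENNReal.toReal_rpow] at h1
    set t := I.toReal with ht
    have ht0 : 0 ≤ t := ENNReal.toReal_nonneg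
    have h2 : t ≤ M ^ q := by
      rcases ht0.eq_or_lt with h0 | h0
      · rw [← h0]
        positivity
      · have h3 : t ^ (1 / q) ≤ M := by
          have h4 : t = t ^ (1 / q) * t ^ (1 / p) := by
            rw [← Real.rpow_add h0, one_div, one_div, hpq.symm.inv_add_inv_eq_one, Real.rpow_one]
          nth_rewrite 1 [h4] at h1
          exact le_of_mul_le_mul_right h1 (by positivity)
        calc t = (t ^ (1 / q)) ^ q := by
              rw [← Real.rpow_mul ht0, one_div_mul_cancel hq0.ne', Real.rpow_one]
          _ ≤ M ^ q := Real.rpow_le_rpow (by positivity) h3 hq0.le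
    rw [← ENNReal.ofReal_toReal hIfin, ENNReal.ofReal_rpow_of_nonneg hM hq0.le]
    exact ENNReal.ofReal_le_ofReal h2
  have hmono : Monotone fun n : ℕ => {x | ‖v x‖ ≤ (n : ℝ)} := fun a b hab x hx =>
    le_trans (show ‖v x‖ ≤ (a : ℝ) from hx) (by exact_mod_cast hab)
  have hunion : ⋃ n : ℕ, {x | ‖v x‖ ≤ (n : ℝ)} = univ :=
    eq_univ_of_forall fun x => mem_iUnion.2 (exists_nat_ge ‖v x‖)
  have htot : ∫⁻ x, ‖v x‖ₑ ^ q ∂μ ≤ ENNReal.ofReal M ^ q := by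
    rw [← setLIntegral_univ, ← hunion, setLIntegral_iUnion_of_directed _ hmono.directed_le]
    exact iSup_le key
  rw [eLpNorm_eq_lintegral_rpow_enorm_toReal hq0' ENNReal.ofReal_ne_top,
    ENNReal.toReal_ofReal hq0.le, one_div, ENNReal.rpow_inv_le_iff hq0]
  exact htot

/-- The dual of the continuous fields with the norm of `L^p(μ)` is `L^q(μ)`, for a finite measure
`μ` on a compact set. -/
theorem exists_density_of_le_eLpNorm {X : Set Plane} (hX : IsCompact X) {μ : Measure Plane}
    [IsFiniteMeasure μ] (hμX : μ Xᶜ = 0) {p q : ℝ} (hpq : p.HolderConjugate q)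
    (L : C(Plane, Plane) →ₗ[ℝ] ℝ) {M : ℝ} (hM : 0 ≤ M)
    (hL : ∀ G : C(Plane, Plane), L G ≤ M * (eLpNorm G (ENNReal.ofReal p) μ).toReal) :
    ∃ v : Plane → Plane, StronglyMeasurable v ∧ eLpNorm v (ENNReal.ofReal q) μ ≤ ENNReal.ofReal M ∧
      ∀ G : C(Plane, Plane), L G = ∫ x, inner ℝ (G x) (v x) ∂μ := by
  have hp1 : 1 ≤ ENNReal.ofReal p := by simpa using hpq.lt.le
  have hp0 : ENNReal.ofReal p ≠ 0 := (zero_lt_one.trans_le hp1).ne'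
  have hμXae : ∀ᵐ x ∂μ, x ∈ X := mem_ae_iff.2 hμX
  have hsup : ∀ G : C(Plane, Plane), (eLpNorm G (ENNReal.ofReal p) μ).toReal ≤
      (μ univ ^ p⁻¹).toReal * supSeminorm hX G := by
    intro G
    have h1 := eLpNorm_le_of_ae_bound (p := ENNReal.ofReal p) (hμXae.mono fun x hx =>
      norm_le_supSeminorm hX G hx)
    rw [ENNReal.toReal_ofReal hpq.nonneg] at h1
    have h2 := ENNReal.toReal_mono (ENNReal.mul_ne_top (ENNReal.rpow_ne_top_of_nonneg
      hpq.inv_nonneg (measure_ne_top μ univ)) ENNReal.ofReal_ne_top) h1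
    rwa [ENNReal.toReal_mul, ENNReal.toReal_ofReal (apply_nonneg _ _)] at h2
  obtain ⟨m, σ', hm, hmX, hσ', -, hLσ'⟩ := exists_measure_density_of_le_supSeminorm hX L
    (M := M * (μ univ ^ p⁻¹).toReal) (by positivity)
    (fun G => (hL G).trans (by rw [mul_assoc]; exact mul_le_mul_of_nonneg_left (hsup G) hM))
  obtain ⟨σ, hσm, hσσ'⟩ := hσ'.1
  have hσ : MemLp σ 2 m := (memLp_congr_ae hσσ').1 hσ'
  have hLσ : ∀ G : C(Plane, Plane), L G = ∫ x, inner ℝ (G x) (σ x) ∂m := fun G => by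
    rw [hLσ']
    exact integral_congr_ae (hσσ'.mono fun x hx => by simp only [hx])
  have hbound : ∀ (G : Plane → Plane) (C : ℝ), StronglyMeasurable G → (∀ x, ‖G x‖ ≤ C) →
      ∫ x, inner ℝ (G x) (σ x) ∂m ≤ M * (eLpNorm G (ENNReal.ofReal p) μ).toReal :=
    fun G C hG hGC => integral_inner_le_of_bounded hp1 ENNReal.ofReal_ne_top hσ
      (fun g => (hLσ g).symm.trans_le (hL g)) hG hGC
  set S := {x | σ x ≠ 0} with hS
  have hSm : MeasurableSet S := (hσm.measurable (measurableSet_singleton 0)).compl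
  -- Only the part of `m` where `σ ≠ 0` matters, and it is absolutely continuous.
  have hac : m.restrict S ≪ μ := by
    refine Measure.AbsolutelyContinuous.mk fun B hB hB0 => ?_
    rw [Measure.restrict_apply hB]
    have hn : ∀ n : ℕ, m ((B ∩ S) ∩ {x | ‖σ x‖ ≤ (n : ℝ)}) = 0 := by
      intro n
      set T := B ∩ {x | ‖σ x‖ ≤ (n : ℝ)} with hT
      have hTm : MeasurableSet T := hB.inter (hσm.norm.measurable measurableSet_Iic)
      have h1 := hbound (T.indicator σ) n (hσm.indicator hTm) (by
        intro x
        by_cases hx : x ∈ T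
        · rw [indicator_of_mem hx]
          exact hx.2
        · rw [indicator_of_notMem hx, norm_zero]
          positivity)
      have h2 : eLpNorm (T.indicator σ) (ENNReal.ofReal p) μ = 0 := by
        rw [eLpNorm_eq_zero_iff (hσm.indicator hTm).aestronglyMeasurable hp0]
        have : μ T = 0 := measure_mono_null inter_subset_left hB0
        exact indicator_meas_zero this
      rw [h2, ENNReal.toReal_zero, mul_zero] at h1
      have h3 : ∀ x, inner ℝ (T.indicator σ x) (σ x) = T.indicator (fun x => ‖σ x‖ ^ 2) x := by
        intro x
        by_cases hx : x ∈ T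
        · rw [indicator_of_mem hx, indicator_of_mem hx, real_inner_self_eq_norm_sq]
        · rw [indicator_of_notMem hx, indicator_of_notMem hx, inner_zero_left]
      simp only [h3] at h1
      have h4 : Integrable (T.indicator fun x => ‖σ x‖ ^ 2) m :=
        (hσ.integrable_norm_pow two_ne_zero).indicator hTm
      have h5 : ∀ x, 0 ≤ T.indicator (fun x => ‖σ x‖ ^ 2) x :=
        fun x => indicator_nonneg (fun x _ => by positivity) x
      have h6 := (integral_eq_zero_iff_of_nonneg h5 h4).1 (le_antisymm h1 (integral_nonneg h5))
      refine measure_mono_null (fun x hx => ?_) (ae_iff.1 h6)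
      have hxT : x ∈ T := ⟨hx.1.1, hx.2⟩
      have hx0 : σ x ≠ 0 := hx.1.2
      simpa [hxT] using hx0
    have hU : B ∩ S = ⋃ n : ℕ, (B ∩ S) ∩ {x | ‖σ x‖ ≤ (n : ℝ)} := by
      have hcov : ⋃ n : ℕ, {x | ‖σ x‖ ≤ (n : ℝ)} = univ :=
        eq_univ_of_forall fun x => mem_iUnion.2 (exists_nat_ge ‖σ x‖)
      rw [← inter_iUnion, hcov, inter_univ]
    rw [hU]
    exact measure_iUnion_null hn
  have hdec : (m.restrict S).HaveLebesgueDecomposition μ :=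
    Measure.haveLebesgueDecomposition_of_sigmaFinite _ _
  set ρ := (m.restrict S).rnDeriv μ with hρ
  have hρm : Measurable ρ := Measure.measurable_rnDeriv _ _
  have hρtop : ∀ᵐ x ∂μ, ρ x < ∞ := Measure.rnDeriv_lt_top _ _
  have hμρ : μ.withDensity ρ = m.restrict S := Measure.withDensity_rnDeriv_eq _ _ hac
  have hint : ∀ G : Plane → Plane,
      ∫ x, inner ℝ (G x) (σ x) ∂m = ∫ x, inner ℝ (G x) ((ρ x).toReal • σ x) ∂μ := by
    intro G
    have h1 : ∫ x, inner ℝ (G x) (σ x) ∂m = ∫ x in S, inner ℝ (G x) (σ x) ∂m := by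
      refine (setIntegral_eq_integral_of_forall_compl_eq_zero fun x hx => ?_).symm
      rw [show σ x = 0 from not_not.1 hx, inner_zero_right]
    rw [h1, ← hμρ, integral_withDensity_eq_integral_toReal_smul hρm hρtop]
    simp only [real_inner_smul_right, smul_eq_mul]
  have hvm : StronglyMeasurable fun x => (ρ x).toReal • σ x :=
    hρm.ennreal_toReal.stronglyMeasurable.smul hσm
  refine ⟨fun x => (ρ x).toReal • σ x, hvm, ?_, fun G => (hLσ G).trans (hint G)⟩
  refine eLpNorm_le_of_forall_bounded hpq hvm hM fun G C hG hGC => ?_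
  rw [← hint]
  exact hbound G C hG hGC

/-! ### Duality of the `L^q` norm -/

/-- The norm of `L^p(μ)`, as a seminorm on the continuous fields, for a finite measure `μ` on a
compact set. -/
def lpSeminorm {X : Set Plane} (hX : IsCompact X) (μ : Measure Plane) [IsFiniteMeasure μ]
    (hμX : μ Xᶜ = 0) (p : ℝ≥0∞) (hp : 1 ≤ p) : Seminorm ℝ C(Plane, Plane) :=
  Seminorm.of (fun G => (eLpNorm G p μ).toReal)
    (fun G H => by
      have hG := memLp_of_continuous_of_isCompact hX hμX G.continuous p
      have hH := memLp_of_continuous_of_isCompact hX hμX H.continuous p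
      rw [← ENNReal.toReal_add hG.2.ne hH.2.ne]
      exact ENNReal.toReal_mono (ENNReal.add_ne_top.2 ⟨hG.2.ne, hH.2.ne⟩)
        (eLpNorm_add_le hG.1 hH.1 hp))
    (fun c G => by
      rw [ContinuousMap.coe_smul, eLpNorm_const_smul, ENNReal.toReal_mul]
      simp)

/-- The pairing of a field in `L^q` with a vector field. -/
def lqPair {Ω : Set Plane} {q : ℝ} (v : LqField Ω q) (G : Plane → Plane) : ℝ :=
  ∫ x in Ω, inner ℝ (G x) (v x)

/-- The norm of `L^q`. -/
def lqNorm {Ω : Set Plane} {q : ℝ} (v : LqField Ω q) : ℝ≥0∞ :=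
  eLpNorm v (ENNReal.ofReal q) (volume.restrict Ω)

theorem lqEnergy_eq {Ω : Set Plane} {q : ℝ} (hq : 1 < q) (v : LqField Ω q) :
    lqEnergy v = ENNReal.ofReal (1 / q) * lqNorm v ^ q := by
  have hq0 : 0 < q := zero_lt_one.trans hq
  rw [lqEnergy, lqNorm, eLpNorm_eq_lintegral_rpow_enorm_toReal (by simpa using hq0)
    ENNReal.ofReal_ne_top, ENNReal.toReal_ofReal hq0.le, ← ENNReal.rpow_mul,
    one_div_mul_cancel hq0.ne', ENNReal.rpow_one]

theorem lqNorm_lt_top {Ω : Set Plane} {q : ℝ} (v : LqField Ω q) : lqNorm v < ∞ :=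
  Lp.eLpNorm_lt_top v

theorem isFiniteMeasure_restrict_of_isBounded {Ω : Set Plane} (hΩb : Bornology.IsBounded Ω) :
    IsFiniteMeasure (volume.restrict Ω) :=
  ⟨by simpa using hΩb.measure_lt_top⟩

theorem restrict_compl_closure (Ω : Set Plane) : volume.restrict Ω (closure Ω)ᶜ = 0 := by
  rw [Measure.restrict_apply isClosed_closure.measurableSet.compl]
  have : (closure Ω)ᶜ ∩ Ω = ∅ := by
    ext x
    simpa using fun h hx => h (subset_closure hx)
  rw [this, measure_empty]

theorem lqPair_integrable {Ω : Set Plane} {p q : ℝ} (hΩb : Bornology.IsBounded Ω)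
    (hpq : p.HolderConjugate q) (v : LqField Ω q) (G : C(Plane, Plane)) :
    Integrable (fun x => inner ℝ (G x) (v x)) (volume.restrict Ω) ∧
    |lqPair v G| ≤ (lqNorm v).toReal * (eLpNorm G (ENNReal.ofReal p) (volume.restrict Ω)).toReal := by
  have := isFiniteMeasure_restrict_of_isBounded hΩb
  have hG := memLp_of_continuous_of_isCompact hΩb.isCompact_closure (restrict_compl_closure Ω)
    G.continuous (ENNReal.ofReal p)
  have hv := Lp.memLp v
  have := hpq.ennrealOfReal
  have h1 := eLpNorm_le_eLpNorm_mul_eLpNorm'_of_norm (p := ENNReal.ofReal p)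
    (q := ENNReal.ofReal q) (r := 1) hG.1 hv.1
    (fun a b => inner ℝ a b) 1 (Eventually.of_forall fun x => by
      simpa using norm_inner_le_norm (𝕜 := ℝ) (G x) (v x))
  rw [ENNReal.coe_one, one_mul] at h1
  have htop := ENNReal.mul_ne_top hG.2.ne hv.2.ne
  have hint : Integrable (fun x => inner ℝ (G x) (v x)) (volume.restrict Ω) :=
    memLp_one_iff_integrable.1 ⟨hG.1.inner hv.1, h1.trans_lt htop.lt_top⟩
  refine ⟨hint, ?_⟩
  rw [mul_comm, lqNorm, ← ENNReal.toReal_mul]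
  refine (abs_integral_le_integral_abs).trans ?_
  simp only [← Real.norm_eq_abs]
  rw [integral_norm_eq_lintegral_enorm hint.1, ← eLpNorm_one_eq_lintegral_enorm]
  exact ENNReal.toReal_mono htop h1

/-- The space `L^q(Ω)` is the dual of the continuous fields with the norm of `L^p(Ω)`. -/
theorem energyDuality_lq {Ω : Set Plane} (hΩb : Bornology.IsBounded Ω) {p q : ℝ}
    (hpq : p.HolderConjugate q) :
    haveI := isFiniteMeasure_restrict_of_isBounded hΩb
    EnergyDuality (closure Ω) (lqNorm (Ω := Ω) (q := q)) lqPair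
      (lpSeminorm hΩb.isCompact_closure (volume.restrict Ω) (restrict_compl_closure Ω)
        (ENNReal.ofReal p) (by simpa using hpq.lt.le)) := by
  have := isFiniteMeasure_restrict_of_isBounded hΩb
  refine ⟨fun v _ G H => ?_, fun v _ c G => ?_, fun v _ G => ?_, fun L M hM hL => ?_,
    fun G H h => ?_⟩
  · rw [lqPair, lqPair, lqPair, ← integral_add (lqPair_integrable hΩb hpq v G).1
      (lqPair_integrable hΩb hpq v H).1]
    simp [inner_add_left]
  · rw [lqPair, lqPair, ← integral_const_mul]
    simp [real_inner_smul_left]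
  · exact (le_abs_self _).trans (lqPair_integrable hΩb hpq v G).2
  · obtain ⟨v, hvm, hvM, hLv⟩ := exists_density_of_le_eLpNorm hΩb.isCompact_closure
      (restrict_compl_closure Ω) hpq L hM hL
    have hv : MemLp v (ENNReal.ofReal q) (volume.restrict Ω) :=
      ⟨hvm.aestronglyMeasurable, hvM.trans_lt ENNReal.ofReal_lt_top⟩
    refine ⟨hv.toLp v, ?_, fun G => ?_⟩
    · rw [lqNorm, eLpNorm_congr_ae hv.coeFn_toLp]
      exact hvM
    · rw [hLv, lqPair]
      exact integral_congr_ae (hv.coeFn_toLp.mono fun x hx => by simp only [hx])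
  · have hae : ∀ᵐ x ∂(volume.restrict Ω), x ∈ closure Ω := mem_ae_iff.2 (restrict_compl_closure Ω)
    exact ENNReal.toReal_mono (memLp_of_continuous_of_isCompact hΩb.isCompact_closure
      (restrict_compl_closure Ω) H.continuous _).2.ne
      (eLpNorm_mono_ae (hae.mono fun x hx => h x hx))

/-! ### Test functions and fields with nonnegative `div v + f` -/

/-- A `C¹` approximation of the positive part of a real number, from below and vanishing for
nonpositive numbers. -/
theorem exists_soft_posPart {ε : ℝ} (hε : 0 < ε) :
    ∃ r r' : ℝ → ℝ, (∀ t, HasDerivAt r (r' t) t) ∧ Continuous r' ∧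
      (∀ t, 0 ≤ r' t ∧ r' t ≤ 1) ∧ (∀ t ≤ 0, r t = 0) ∧ ∀ t, t - ε ≤ r t := by
  set r' : ℝ → ℝ := fun t => min (max (t / ε) 0) 1 with hr'
  have hc : Continuous r' := by fun_prop
  have h01 : ∀ t, 0 ≤ r' t ∧ r' t ≤ 1 := fun t =>
    ⟨le_min (le_max_right _ _) zero_le_one, min_le_right _ _⟩
  have h0 : ∀ t ≤ 0, r' t = 0 := fun t ht => by
    have : t / ε ≤ 0 := div_nonpos_of_nonpos_of_nonneg ht hε.le
    simp [hr', this]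
  have h1 : ∀ t, ε ≤ t → r' t = 1 := fun t ht => by
    have : 1 ≤ t / ε := (one_le_div hε).2 ht
    simp [hr', this]
  have hint : ∀ a b, IntervalIntegrable r' volume a b := fun a b => hc.intervalIntegrable a b
  have hderiv : ∀ t, HasDerivAt (fun t => ∫ u in (0 : ℝ)..t, r' u) (r' t) t := fun t =>
    intervalIntegral.integral_hasDerivAt_right (hint 0 t) (hc.stronglyMeasurableAtFilter _ _)
      hc.continuousAt
  have hneg : ∀ t ≤ 0, ∫ u in (0 : ℝ)..t, r' u = 0 := fun t ht => by
    rw [intervalIntegral.integral_symm, neg_eq_zero]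
    refine intervalIntegral.integral_zero_ae (Eventually.of_forall fun u hu => h0 u ?_)
    rw [uIoc_of_le ht] at hu
    exact hu.2
  have hnonneg : ∀ a b, a ≤ b → 0 ≤ ∫ u in a..b, r' u := fun a b hab =>
    intervalIntegral.integral_nonneg hab fun u _ => (h01 u).1
  have hpos : ∀ t, 0 ≤ ∫ u in (0 : ℝ)..t, r' u := fun t => by
    rcases le_total t 0 with ht | ht
    · exact (hneg t ht).ge
    · exact hnonneg 0 t ht
  refine ⟨fun t => ∫ u in (0 : ℝ)..t, r' u, r', hderiv, hc, h01, hneg, fun t => ?_⟩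
  rcases le_total t ε with ht | ht
  · exact (sub_nonpos.2 ht).trans (hpos t)
  · change t - ε ≤ ∫ u in (0 : ℝ)..t, r' u
    rw [← intervalIntegral.integral_add_adjacent_intervals (hint 0 ε) (hint ε t)]
    have h2 : ∫ u in ε..t, r' u = t - ε := by
      rw [intervalIntegral.integral_congr (g := fun _ => (1 : ℝ))]
      · simp
      · intro u hu
        rw [uIcc_of_le ht] at hu
        exact h1 u hu.1
    rw [h2]
    linarith [hpos ε]

/-- The space of `C¹` functions on the plane. -/
def C1Fun : Submodule ℝ (Plane → ℝ) where
  carrier := {ψ | ContDiff ℝ 1 ψ}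
  zero_mem' := (contDiff_const : ContDiff ℝ 1 fun _ : Plane => (0 : ℝ))
  add_mem' {a b} (h : ContDiff ℝ 1 a) (h' : ContDiff ℝ 1 b) := h.add h'
  smul_mem' c a (h : ContDiff ℝ 1 a) := h.const_smul c

theorem C1Fun.contDiff (ψ : C1Fun) : ContDiff ℝ 1 (ψ : Plane → ℝ) :=
  ψ.2

/-- The constant functions, as elements of the space of `C¹` functions. -/
def C1Fun.const (r : ℝ) : C1Fun :=
  ⟨fun _ => r, (contDiff_const : ContDiff ℝ 1 fun _ : Plane => r)⟩

theorem continuous_gradient {ψ : Plane → ℝ} (hψ : ContDiff ℝ 1 ψ) :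
    Continuous fun x => gradient ψ x :=
  (InnerProductSpace.toDual ℝ Plane).symm.continuous.comp (hψ.continuous_fderiv one_ne_zero)

theorem gradient_add' {ψ φ : Plane → ℝ} (hψ : ContDiff ℝ 1 ψ) (hφ : ContDiff ℝ 1 φ) (x : Plane) :
    gradient (ψ + φ) x = gradient ψ x + gradient φ x := by
  rw [gradient, fderiv_add (hψ.differentiable one_ne_zero x) (hφ.differentiable one_ne_zero x),
    map_add]
  rfl

theorem gradient_smul' {ψ : Plane → ℝ} (hψ : ContDiff ℝ 1 ψ) (c : ℝ) (x : Plane) :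
    gradient (c • ψ) x = c • gradient ψ x := by
  rw [gradient, fderiv_const_smul (hψ.differentiable one_ne_zero x), map_smulₛₗ]
  rfl

/-- The gradient, as a linear map from the `C¹` functions to the continuous vector fields. -/
def gradMap : C1Fun →ₗ[ℝ] C(Plane, Plane) where
  toFun ψ := ⟨fun x => gradient (ψ : Plane → ℝ) x, continuous_gradient (C1Fun.contDiff ψ)⟩
  map_add' ψ φ := by
    ext1 x
    exact gradient_add' (C1Fun.contDiff ψ) (C1Fun.contDiff φ) x
  map_smul' c ψ := by
    ext1 x
    exact gradient_smul' (C1Fun.contDiff ψ) c x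

theorem contDiff_comp_of_hasDerivAt {r r' : ℝ → ℝ} (hr : ∀ t, HasDerivAt r (r' t) t)
    (hr' : Continuous r') {ψ : Plane → ℝ} (hψ : ContDiff ℝ 1 ψ) : ContDiff ℝ 1 (r ∘ ψ) := by
  refine ContDiff.comp ?_ hψ
  rw [contDiff_one_iff_deriv]
  refine ⟨fun t => (hr t).differentiableAt, ?_⟩
  rwa [show deriv r = r' from funext fun t => (hr t).deriv]

theorem gradient_comp_of_hasDerivAt {r r' : ℝ → ℝ} (hr : ∀ t, HasDerivAt r (r' t) t)
    {ψ : Plane → ℝ} (hψ : ContDiff ℝ 1 ψ) (x : Plane) :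
    gradient (r ∘ ψ) x = r' (ψ x) • gradient ψ x := by
  have h := (hr (ψ x)).comp_hasFDerivAt x (hψ.differentiable one_ne_zero x).hasFDerivAt
  rw [gradient, h.fderiv, map_smulₛₗ]
  rfl

section Source

variable {Ω : Set Plane} {f : Plane → ℝ}

theorem integrable_source_mul (hΩb : Bornology.IsBounded Ω) (hf : IntegrableOn f Ω)
    {ψ : Plane → ℝ} (hψ : Continuous ψ) :
    Integrable (fun x => f x * ψ x) (volume.restrict Ω) := by
  obtain ⟨C, hC⟩ := hΩb.isCompact_closure.exists_bound_of_continuousOn hψ.continuousOn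
  have hae : ∀ᵐ x ∂(volume.restrict Ω), x ∈ closure Ω := mem_ae_iff.2 (restrict_compl_closure Ω)
  exact hf.mul_bdd hψ.aestronglyMeasurable (hae.mono fun x hx => hC x hx)

/-- The functional `ψ ↦ ∫_Ω f ψ dx` on the `C¹` functions. -/
def sourceMap (hΩb : Bornology.IsBounded Ω) (hf : IntegrableOn f Ω) : C1Fun →ₗ[ℝ] ℝ where
  toFun ψ := ∫ x in Ω, f x * (ψ : Plane → ℝ) x
  map_add' ψ φ := by
    rw [← integral_add (integrable_source_mul hΩb hf (C1Fun.contDiff ψ).continuous)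
      (integrable_source_mul hΩb hf (C1Fun.contDiff φ).continuous)]
    simp [mul_add]
  map_smul' c ψ := by
    rw [RingHom.id_apply, smul_eq_mul, ← integral_const_mul]
    refine integral_congr_ae (Eventually.of_forall fun x => ?_)
    simp only [Submodule.coe_smul, Pi.smul_apply, smul_eq_mul]
    ring

theorem integral_source_mono (hΩb : Bornology.IsBounded Ω) (hf : IntegrableOn f Ω)
    (hf0 : ∀ᵐ x ∂(volume.restrict Ω), 0 ≤ f x) {ψ φ : Plane → ℝ} (hψ : Continuous ψ)
    (hφ : Continuous φ) {c : ℝ} (h : ∀ x ∈ closure Ω, ψ x - c ≤ φ x) :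
    (∫ x in Ω, f x * ψ x) - c * ∫ x in Ω, f x ≤ ∫ x in Ω, f x * φ x := by
  have hae : ∀ᵐ x ∂(volume.restrict Ω), x ∈ closure Ω := mem_ae_iff.2 (restrict_compl_closure Ω)
  have hψi := integrable_source_mul hΩb hf hψ
  rw [← integral_const_mul, ← integral_sub hψi (hf.const_mul c)]
  refine integral_mono_ae (hψi.sub (hf.const_mul c)) (integrable_source_mul hΩb hf hφ) ?_
  filter_upwards [hae, hf0] with x hx hx0
  nlinarith [h x hx]

/-- The field with gradient pairing `T` balances the source `f` off `K`, with Neumann conditions: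
`-div v = f` there in the weak sense. -/
def IsBalancedOff (Ω : Set Plane) (f : Plane → ℝ) (K : Set Plane) (T : (Plane → ℝ) → ℝ) : Prop :=
  ∀ ψ : Plane → ℝ, ContDiff ℝ 1 ψ → (∀ x ∈ K, ψ x = 0) → T ψ = ∫ x in Ω, f x * ψ x

/-- The distribution `div v + f` on `closure Ω` is nonnegative, where `T` is the gradient pairing of
the field `v`. -/
def IsDivNonneg (Ω : Set Plane) (f : Plane → ℝ) (T : (Plane → ℝ) → ℝ) : Prop :=
  ∀ ψ : Plane → ℝ, ContDiff ℝ 1 ψ → (∀ x ∈ closure Ω, 0 ≤ ψ x) → T ψ ≤ ∫ x in Ω, f x * ψ x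

/-- The functional `ψ ↦ ∫ ∇ψ · dv`, for the pairing `P` of the field `v` with vector fields. -/
def gradPair {V : Type*} (P : V → (Plane → Plane) → ℝ) (v : V) (ψ : Plane → ℝ) : ℝ :=
  P v fun x => gradient ψ x

end Source

namespace EnergyDuality

variable {V : Type*} {Ω : Set Plane} {f : Plane → ℝ} {N : V → ℝ≥0∞} {P : V → (Plane → Plane) → ℝ}
  {s : Seminorm ℝ C(Plane, Plane)}

/-- The pairing of a field of finite size with gradients, as a linear functional. -/
def pairMap (h : EnergyDuality (closure Ω) N P s) {v : V} (hv : N v < ∞) : C1Fun →ₗ[ℝ] ℝ where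
  toFun ψ := gradPair P v ψ
  map_add' ψ φ :=
    (congrArg (fun G : C(Plane, Plane) => P v G) (gradMap.map_add ψ φ)).trans
      (h.map_add v hv (gradMap ψ) (gradMap φ))
  map_smul' c ψ :=
    (congrArg (fun G : C(Plane, Plane) => P v G) (gradMap.map_smul c ψ)).trans
      (h.map_smul v hv c (gradMap ψ))

/-- Duality: a source that is bounded by `M` on a cone of test functions is dominated there by the
divergence of a field of size at most `M`. -/
theorem exists_field_of_le_on_cone (h : EnergyDuality (closure Ω) N P s)
    (hΩb : Bornology.IsBounded Ω) (hf : IntegrableOn f Ω) (D : PointedCone ℝ C1Fun) {M : ℝ}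
    (hM : 0 ≤ M) (hD : ∀ ψ ∈ D, sourceMap hΩb hf ψ ≤ M * s (gradMap ψ)) :
    ∃ v, N v ≤ ENNReal.ofReal M ∧ ∀ ψ ∈ D, sourceMap hΩb hf ψ ≤ gradPair P v ψ := by
  obtain ⟨L, hLM, hL⟩ := exists_linear_le_sublinear_of_le_on_cone (fun G => M * s G)
    (fun c hc x => by
      simp only [map_smul_eq_mul, Real.norm_of_nonneg hc.le]
      ring)
    (fun x y => by
      rw [← mul_add]
      exact mul_le_mul_of_nonneg_left (map_add_le_add s x y) hM) gradMap (sourceMap hΩb hf) D hD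
  obtain ⟨v, hv, hvL⟩ := h.exists_rep L M hM hLM
  exact ⟨v, hv, fun ψ hψ => (hL ψ hψ).trans_eq (hvL (gradMap ψ)).symm⟩

theorem source_le_of_isBalancedOff (h : EnergyDuality (closure Ω) N P s)
    (hΩb : Bornology.IsBounded Ω) (hf : IntegrableOn f Ω)
    (hf0 : ∀ᵐ x ∂(volume.restrict Ω), 0 ≤ f x) {K : Set Plane} {v : V}
    (hv : N v < ∞) (hvK : IsBalancedOff Ω f K (gradPair P v)) (ψ : C1Fun)
    (hψ : ∀ x ∈ K, (ψ : Plane → ℝ) x ≤ 0) :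
    sourceMap hΩb hf ψ ≤ (N v).toReal * s (gradMap ψ) := by
  refine le_of_forall_pos_le_add fun ε hε => ?_
  have hI : 0 ≤ ∫ x in Ω, f x := integral_nonneg_of_ae hf0
  set δ := ε / (1 + ∫ x in Ω, f x) with hδ
  have hδ0 : 0 < δ := by positivity
  have hδε : δ * (∫ x in Ω, f x) ≤ ε := by
    rw [hδ, div_mul_eq_mul_div, div_le_iff₀ (by positivity)]
    nlinarith
  obtain ⟨r, r', hr, hr'c, hr'01, hr0, hrδ⟩ := exists_soft_posPart hδ0
  have hrψ : ContDiff ℝ 1 (r ∘ (ψ : Plane → ℝ)) := contDiff_comp_of_hasDerivAt hr hr'c (C1Fun.contDiff ψ)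
  have h1 := integral_source_mono hΩb hf hf0 (C1Fun.contDiff ψ).continuous hrψ.continuous (c := δ)
    (fun x _ => hrδ _)
  have h2 := hvK _ hrψ fun x hx => hr0 _ (hψ x hx)
  have h3 := h.le v hv (gradMap ⟨_, hrψ⟩)
  have h4 : s (gradMap ⟨_, hrψ⟩) ≤ s (gradMap ψ) := h.mono _ _ fun x _ => by
    change ‖gradient (r ∘ (ψ : Plane → ℝ)) x‖ ≤ ‖gradient (ψ : Plane → ℝ) x‖
    rw [gradient_comp_of_hasDerivAt hr (C1Fun.contDiff ψ), norm_smul, Real.norm_of_nonneg (hr'01 _).1]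
    exact mul_le_of_le_one_left (norm_nonneg _) (hr'01 _).2
  have h5 : (N v).toReal * s (gradMap ⟨_, hrψ⟩) ≤ (N v).toReal * s (gradMap ψ) :=
    mul_le_mul_of_nonneg_left h4 ENNReal.toReal_nonneg
  have h6 : gradPair P v (r ∘ (ψ : Plane → ℝ)) ≤ (N v).toReal * s (gradMap ⟨_, hrψ⟩) := h3
  change ∫ x in Ω, f x * (ψ : Plane → ℝ) x ≤ _
  linarith

/-- A field that balances `f` off `K` can be replaced by one that is not larger and for which
`div v + f` is nonnegative. By duality, this holds because the positive part of a test function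
that is nonpositive on `K` vanishes on `K` and has a smaller gradient. -/
theorem exists_isDivNonneg (h : EnergyDuality (closure Ω) N P s)
    (hΩb : Bornology.IsBounded Ω) (hf : IntegrableOn f Ω)
    (hf0 : ∀ᵐ x ∂(volume.restrict Ω), 0 ≤ f x) {K : Set Plane} (hK : K ⊆ closure Ω) {v : V}
    (hv : N v < ∞) (hvK : IsBalancedOff Ω f K (gradPair P v)) :
    ∃ v', N v' ≤ N v ∧ IsBalancedOff Ω f K (gradPair P v') ∧ IsDivNonneg Ω f (gradPair P v') := by
  obtain ⟨v', hv'N, hv'⟩ := h.exists_field_of_le_on_cone hΩb hf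
    { carrier := {ψ | ∀ x ∈ K, (ψ : Plane → ℝ) x ≤ 0}
      zero_mem' := fun x _ => le_rfl
      smul_mem' := by
        rintro ⟨c, hc⟩ ψ hψ x hx
        exact mul_nonpos_of_nonneg_of_nonpos hc (hψ x hx)
      add_mem' := fun hψ hφ x hx => add_nonpos (hψ x hx) (hφ x hx) }
    (ENNReal.toReal_nonneg (a := N v)) (h.source_le_of_isBalancedOff hΩb hf hf0 hv hvK)
  rw [ENNReal.ofReal_toReal hv.ne] at hv'N
  have hneg : ∀ ψ : C1Fun, (∀ x ∈ K, 0 ≤ (ψ : Plane → ℝ) x) →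
      gradPair P v' ψ ≤ sourceMap hΩb hf ψ := by
    intro ψ hψ
    have h1 := hv' (-ψ) fun x hx => neg_nonpos.2 (hψ x hx)
    have h2 := (h.pairMap (hv'N.trans_lt hv)).map_neg ψ
    rw [map_neg] at h1
    change gradPair P v' _ = -gradPair P v' _ at h2
    linarith
  refine ⟨v', hv'N, fun ψ hψ hψK => ?_, fun ψ hψ hψ0 => hneg ⟨ψ, hψ⟩ fun x hx => hψ0 x (hK hx)⟩
  exact le_antisymm (hneg ⟨ψ, hψ⟩ fun x hx => (hψK x hx).ge)
    (hv' ⟨ψ, hψ⟩ fun x hx => (hψK x hx).le)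

end EnergyDuality

/-! ### Smallest fields -/

namespace EnergyDuality

variable {V : Type*} {Ω : Set Plane} {f : Plane → ℝ} {N : V → ℝ≥0∞} {P : V → (Plane → Plane) → ℝ}
  {s : Seminorm ℝ C(Plane, Plane)}

/-- Absence of a duality gap: the size of a smallest field that balances `f` off `K` is almost
reached by `∫_Ω f ψ dx` for a test function `ψ` that vanishes on `K`. -/
theorem exists_almost_optimal (h : EnergyDuality (closure Ω) N P s)
    (hΩb : Bornology.IsBounded Ω) (hf : IntegrableOn f Ω) {K : Set Plane} {v : V}
    (hmin : ∀ v', IsBalancedOff Ω f K (gradPair P v') → N v ≤ N v') {η : ℝ}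
    (hη : 0 < η) :
    ∃ ψ : C1Fun, (∀ x ∈ K, (ψ : Plane → ℝ) x = 0) ∧ s (gradMap ψ) ≤ 1 ∧
      (N v).toReal - η ≤ sourceMap hΩb hf ψ := by
  by_contra! hcon
  set M := (N v).toReal - η with hM
  have hM0 : 0 < M := by simpa using hcon 0 (fun x _ => rfl) (by simp)
  have key : ∀ ψ : C1Fun, (∀ x ∈ K, (ψ : Plane → ℝ) x = 0) →
      sourceMap hΩb hf ψ ≤ M * s (gradMap ψ) := by
    intro ψ hψ
    have hscale : ∀ c : ℝ, 0 ≤ c → c * s (gradMap ψ) ≤ 1 → c * sourceMap hΩb hf ψ < M := by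
      intro c hc hcs
      have := hcon (c • ψ) (fun x hx => by simp [hψ x hx])
        (by rwa [_root_.map_smul, map_smul_eq_mul, Real.norm_of_nonneg hc])
      rwa [_root_.map_smul, smul_eq_mul] at this
    rcases (apply_nonneg s (gradMap ψ)).eq_or_lt with h0 | h0
    · rw [← h0, mul_zero]
      by_contra! hpos
      have := hscale (M / sourceMap hΩb hf ψ) (by positivity) (by rw [← h0]; simp)
      rw [div_mul_cancel₀ _ hpos.ne'] at this
      exact lt_irrefl _ this
    · have := hscale (s (gradMap ψ))⁻¹ (by positivity) (by rw [inv_mul_cancel₀ h0.ne'])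
      rw [inv_mul_lt_iff₀ h0] at this
      linarith
  obtain ⟨v', hv'N, hv'⟩ := h.exists_field_of_le_on_cone hΩb hf
    { carrier := {ψ | ∀ x ∈ K, (ψ : Plane → ℝ) x = 0}
      zero_mem' := fun x _ => rfl
      smul_mem' := by
        rintro ⟨c, hc⟩ ψ hψ x hx
        exact mul_eq_zero_of_right c (hψ x hx)
      add_mem' := fun {a b} hψ hφ x hx => by
        change (a : Plane → ℝ) x + (b : Plane → ℝ) x = 0
        rw [hψ x hx, hφ x hx, add_zero] } hM0.le key
  have hbal : IsBalancedOff Ω f K (gradPair P v') := by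
    intro ψ hψ hψK
    have h1 := hv' ⟨ψ, hψ⟩ hψK
    have h2 := hv' (-⟨ψ, hψ⟩) fun x hx => neg_eq_zero.2 (hψK x hx)
    have h3 := (h.pairMap (hv'N.trans_lt ENNReal.ofReal_lt_top)).map_neg ⟨ψ, hψ⟩
    rw [map_neg] at h2
    change gradPair P v' _ = -gradPair P v' _ at h3
    exact le_antisymm (by
      change gradPair P v' _ ≤ sourceMap hΩb hf ⟨ψ, hψ⟩
      linarith) h1
  have := ENNReal.toReal_le_of_le_ofReal hM0.le ((hmin v' hbal).trans hv'N)
  linarith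

/-- When the size of a field is its total mass, `div v + f` is nonnegative for every smallest field
`v` that balances `f` off `K`. To see this, take an almost optimal test function `ψ` and compare it
with the positive part of `ψ - t φ`, where `φ` is nonnegative and `t` is small: as both `∇ψ` and
`t ∇φ` are bounded by one, the change in the pairing is at least `t ∫ ∇φ · dv`. -/
theorem isDivNonneg_of_minimal {hX : IsCompact (closure Ω)}
    (h : EnergyDuality (closure Ω) N P (supSeminorm hX))
    (hΩb : Bornology.IsBounded Ω) (hf : IntegrableOn f Ω)
    (hf0 : ∀ᵐ x ∂(volume.restrict Ω), 0 ≤ f x) {K : Set Plane} (hK : K ⊆ closure Ω) {v : V}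
    (hv : N v < ∞) (hvK : IsBalancedOff Ω f K (gradPair P v))
    (hmin : ∀ v', IsBalancedOff Ω f K (gradPair P v') → N v ≤ N v') :
    IsDivNonneg Ω f (gradPair P v) := by
  intro φ hφ hφ0
  set s := supSeminorm (E := Plane) hX
  set M := (N v).toReal
  set Φ : C1Fun := ⟨φ, hφ⟩
  set t := (1 + s (gradMap Φ))⁻¹ with ht
  have hs0 : 0 ≤ s (gradMap Φ) := apply_nonneg _ _
  have ht0 : 0 < t := by positivity
  have htφ : ∀ x ∈ closure Ω, t * ‖gradient φ x‖ ≤ 1 := fun x hx => by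
    rw [ht, inv_mul_le_iff₀ (by positivity)]
    have : ‖gradient φ x‖ ≤ s (gradMap Φ) := norm_le_supSeminorm hX (gradMap Φ) hx
    linarith
  have hI : 0 ≤ ∫ x in Ω, f x := integral_nonneg_of_ae hf0
  have key : ∀ η : ℝ, 0 < η →
      t * (gradPair P v φ - sourceMap hΩb hf Φ) ≤ η * (1 + ∫ x in Ω, f x) := by
    intro η hη
    obtain ⟨ψ, hψK, hψs, hψM⟩ := h.exists_almost_optimal hΩb hf hmin hη
    obtain ⟨r, r', hr, hr'c, hr'01, hr0, hrη⟩ := exists_soft_posPart hη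
    set w : C1Fun := ψ - t • Φ with hw
    have hwx : ∀ x, (w : Plane → ℝ) x = (ψ : Plane → ℝ) x - t * φ x := fun x => rfl
    have hχ : ContDiff ℝ 1 (r ∘ (w : Plane → ℝ)) :=
      contDiff_comp_of_hasDerivAt hr hr'c (C1Fun.contDiff w)
    have h1 := integral_source_mono hΩb hf hf0 (C1Fun.contDiff w).continuous hχ.continuous
      (c := η) (fun x _ => hrη _)
    have h2 := hvK _ hχ fun x hx => hr0 _ <| by
      rw [hwx, hψK x hx]
      have := hφ0 x (hK hx)
      nlinarith
    have h3 : sourceMap hΩb hf w = sourceMap hΩb hf ψ - t * sourceMap hΩb hf Φ := by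
      rw [hw, map_sub, _root_.map_smul, smul_eq_mul]
    change sourceMap hΩb hf w - _ ≤ _ at h1
    set H : C(Plane, Plane) := gradMap ⟨_, hχ⟩ + t • gradMap Φ with hH
    have h4 : P v H = gradPair P v (r ∘ (w : Plane → ℝ)) + t * gradPair P v φ := by
      rw [hH, h.map_add v hv, h.map_smul v hv]
      rfl
    have h5 : s H ≤ 1 := by
      refine (supSeminorm_le_iff hX zero_le_one).2 fun x hx => ?_
      have hg : gradient (r ∘ (w : Plane → ℝ)) x =
          r' ((w : Plane → ℝ) x) • (gradient (ψ : Plane → ℝ) x - t • gradient φ x) := by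
        rw [gradient_comp_of_hasDerivAt hr (C1Fun.contDiff w)]
        congr 1
        exact congrArg (fun G : C(Plane, Plane) => G x)
          ((gradMap.map_sub ψ (t • Φ)).trans (by rw [_root_.map_smul]))
      have hHx : H x = r' ((w : Plane → ℝ) x) • gradient (ψ : Plane → ℝ) x +
          (1 - r' ((w : Plane → ℝ) x)) • (t • gradient φ x) := by
        change gradient (r ∘ (w : Plane → ℝ)) x + t • gradient φ x = _
        rw [hg]
        module
      have hψx : ‖gradient (ψ : Plane → ℝ) x‖ ≤ 1 :=
        (norm_le_supSeminorm hX (gradMap ψ) hx).trans hψs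
      obtain ⟨hρ0, hρ1⟩ := hr'01 ((w : Plane → ℝ) x)
      rw [hHx]
      refine (norm_add_le _ _).trans ?_
      rw [norm_smul, norm_smul, norm_smul, Real.norm_of_nonneg hρ0,
        Real.norm_of_nonneg (sub_nonneg.2 hρ1), Real.norm_of_nonneg ht0.le]
      nlinarith [htφ x hx, mul_le_mul_of_nonneg_left hψx hρ0,
        mul_le_mul_of_nonneg_left (htφ x hx) (sub_nonneg.2 hρ1)]
    have h6 := (h.le v hv H).trans (mul_le_of_le_one_right ENNReal.toReal_nonneg h5)
    rw [h4, h2] at h6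
    linarith
  have : t * (gradPair P v φ - sourceMap hΩb hf Φ) ≤ 0 := by
    refine le_of_forall_pos_le_add fun ε hε => ?_
    have := key (ε / (1 + ∫ x in Ω, f x)) (by positivity)
    rwa [div_mul_cancel₀ _ (by positivity), ← zero_add ε] at this
  exact sub_nonpos.1 (nonpos_of_mul_nonpos_right this ht0)

end EnergyDuality

theorem norm_midpoint_rpow_lt {q : ℝ} (hq : 1 < q) {x y : Plane} (hxy : x ≠ y) :
    ‖(1 / 2 : ℝ) • (x + y)‖ ^ q < (‖x‖ ^ q + ‖y‖ ^ q) / 2 := by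
  have hq0 : 0 < q := zero_lt_one.trans hq
  have hn : ‖(1 / 2 : ℝ) • (x + y)‖ = ‖x + y‖ / 2 := by
    rw [norm_smul]
    norm_num
    ring
  rw [hn]
  rcases eq_or_ne ‖x‖ ‖y‖ with h | h
  · have h1 : ‖x + y‖ < ‖x‖ + ‖y‖ :=
      norm_add_lt_of_not_sameRay fun hr => hxy ((sameRay_iff_of_norm_eq h).1 hr)
    have h2 : ‖x + y‖ / 2 < ‖y‖ := by linarith
    rw [h]
    have := Real.rpow_lt_rpow (by positivity) h2 hq0
    linarith
  · have h1 := (strictConvexOn_rpow hq).2 (mem_Ici.2 (norm_nonneg x)) (mem_Ici.2 (norm_nonneg y)) h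
      one_half_pos one_half_pos (add_halves (1 : ℝ))
    simp only [smul_eq_mul] at h1
    have h2 : ‖x + y‖ / 2 ≤ 1 / 2 * ‖x‖ + 1 / 2 * ‖y‖ := by linarith [norm_add_le x y]
    have := Real.rpow_le_rpow (by positivity) h2 hq0.le
    linarith

theorem lqNorm_le_lqNorm_iff {Ω : Set Plane} {q : ℝ} (hq : 1 < q) (v u : LqField Ω q) :
    lqNorm v ≤ lqNorm u ↔ ∫ x in Ω, ‖v x‖ ^ q ≤ ∫ x in Ω, ‖u x‖ ^ q := by
  have hq0 : 0 < q := zero_lt_one.trans hq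
  have h0 : ∀ w : LqField Ω q, 0 ≤ ∫ x in Ω, ‖w x‖ ^ q := fun w =>
    integral_nonneg fun x => by positivity
  have h : ∀ w : LqField Ω q,
      lqNorm w = ENNReal.ofReal ((∫ x in Ω, ‖w x‖ ^ q) ^ q⁻¹) := fun w => by
    rw [lqNorm, MemLp.eLpNorm_eq_integral_rpow_norm (by simpa using hq0) ENNReal.ofReal_ne_top
      (Lp.memLp w), ENNReal.toReal_ofReal hq0.le]
  rw [h, h, ENNReal.ofReal_le_ofReal_iff (Real.rpow_nonneg (h0 u) _),
    Real.rpow_le_rpow_iff (h0 v) (h0 u) (inv_pos.2 hq0)]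

/-- By strict convexity, at most one `L^q` field is smallest among those that balance `f` off
`K`. -/
theorem lq_eq_of_isBalancedOff {Ω : Set Plane} {f : Plane → ℝ} (hΩb : Bornology.IsBounded Ω)
    {q : ℝ} (hq : 1 < q) {K : Set Plane} {v v' : LqField Ω q}
    (hvK : IsBalancedOff Ω f K (gradPair lqPair v))
    (hmin : ∀ u : LqField Ω q, IsBalancedOff Ω f K (gradPair lqPair u) → lqNorm v ≤ lqNorm u)
    (hv'K : IsBalancedOff Ω f K (gradPair lqPair v')) (hv' : lqNorm v' ≤ lqNorm v) : v' = v := by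
  have hq0 : 0 < q := zero_lt_one.trans hq
  have hpq := (Real.HolderConjugate.conjExponent hq).symm
  set w : LqField Ω q := (1 / 2 : ℝ) • (v + v')
  have hwae : ∀ᵐ x ∂(volume.restrict Ω), w x = (1 / 2 : ℝ) • (v x + v' x) := by
    filter_upwards [Lp.coeFn_smul (1 / 2 : ℝ) (v + v'), Lp.coeFn_add v v'] with x h1 h2
    rw [h1, Pi.smul_apply, h2, Pi.add_apply]
  have hw : IsBalancedOff Ω f K (gradPair lqPair w) := by
    intro ψ hψ hψK
    have h1 := hvK ψ hψ hψK
    have h2 := hv'K ψ hψ hψK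
    have h3 : gradPair lqPair w ψ = 1 / 2 * (gradPair lqPair v ψ + gradPair lqPair v' ψ) := by
      have e : gradPair lqPair w ψ = ∫ x in Ω, 1 / 2 *
          (inner ℝ (gradient ψ x) (v x) + inner ℝ (gradient ψ x) (v' x)) := by
        refine integral_congr_ae (hwae.mono fun x hx => ?_)
        simp only [hx, inner_smul_right, inner_add_right]
      rw [e, integral_const_mul]
      exact congrArg (1 / 2 * ·) (integral_add (lqPair_integrable hΩb hpq v (gradMap ⟨ψ, hψ⟩)).1
        (lqPair_integrable hΩb hpq v' (gradMap ⟨ψ, hψ⟩)).1)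
    rw [h3, h1, h2]
    ring
  have hint : ∀ u : LqField Ω q, Integrable (fun x => ‖u x‖ ^ q) (volume.restrict Ω) := fun u => by
    have := (Lp.memLp u).integrable_norm_rpow (by simpa using hq0) ENNReal.ofReal_ne_top
    rwa [ENNReal.toReal_ofReal hq0.le] at this
  have h1 := (lqNorm_le_lqNorm_iff hq _ _).1 (hmin w hw)
  have h2 := (lqNorm_le_lqNorm_iff hq _ _).1 hv'
  have hadd : Integrable (fun x => ‖v x‖ ^ q + ‖v' x‖ ^ q) (volume.restrict Ω) :=
    (hint v).add (hint v')
  have hg : Integrable (fun x => (‖v x‖ ^ q + ‖v' x‖ ^ q) / 2 - ‖w x‖ ^ q) (volume.restrict Ω) :=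
    (hadd.div_const 2).sub (hint w)
  have hle : ∀ᵐ x ∂(volume.restrict Ω), 0 ≤ (‖v x‖ ^ q + ‖v' x‖ ^ q) / 2 - ‖w x‖ ^ q := by
    filter_upwards [hwae] with x hx
    rw [hx]
    rcases eq_or_ne (v x) (v' x) with h | h
    · rw [h, ← two_smul ℝ (v' x), smul_smul]
      norm_num
    · exact (sub_pos.2 (norm_midpoint_rpow_lt hq h)).le
  have h0 : ∫ x in Ω, ((‖v x‖ ^ q + ‖v' x‖ ^ q) / 2 - ‖w x‖ ^ q) = 0 := by
    refine le_antisymm ?_ (integral_nonneg_of_ae hle)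
    rw [integral_sub (hadd.div_const 2) (hint w), integral_div,
      integral_add (hint v) (hint v')]
    linarith
  refine Lp.ext ?_
  filter_upwards [(integral_eq_zero_iff_of_nonneg_ae hle hg).1 h0, hwae] with x hx hwx
  by_contra hne
  have := norm_midpoint_rpow_lt hq (Ne.symm hne)
  rw [← hwx] at this
  simp only [Pi.zero_apply] at hx
  linarith

/-! ### Measures as divergences -/

theorem volume_eq_zero_of_hausdorffMeasure_lt_top {K : Set Plane} (hK : μH[1] K < ∞) :
    volume K = 0 := by
  have h2 : μH[2] K = 0 := by
    rcases Measure.hausdorffMeasure_zero_or_top (show (1 : ℝ) < 2 by norm_num) K with h | h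
    · exact h
    · exact absurd h hK.ne
  have : (μH[2] : Measure Plane).IsAddHaarMeasure := by
    have := isAddHaarMeasure_hausdorffMeasure (E := Plane)
    simpa using this
  exact Measure.absolutelyContinuous_isAddHaarMeasure volume (μH[2] : Measure Plane) h2

theorem integrable_of_continuous_of_isCompact {X : Set Plane} (hX : IsCompact X)
    {m : Measure Plane} [IsFiniteMeasure m] (hmX : m Xᶜ = 0) {g : Plane → ℝ} (hg : Continuous g) :
    Integrable g m :=
  (memLp_of_continuous_of_isCompact hX hmX hg 1).integrable le_rfl

/-- Finite measures are determined by the integrals of the `C¹` functions, since the indicator of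
an open set is an increasing limit of such functions. -/
theorem measure_eq_of_forall_contDiff {α β : Measure Plane} [IsFiniteMeasure α]
    [IsFiniteMeasure β] (h : ∀ ψ : Plane → ℝ, ContDiff ℝ 1 ψ → ∫ x, ψ x ∂α = ∫ x, ψ x ∂β) :
    α = β := by
  have hopen : ∀ U : Set Plane, IsOpen U → α U = β U := by
    intro U hU
    obtain ⟨g, hgU, hg, hg01⟩ := hU.exists_contDiff_support_eq (n := 1)
    have hg01' : ∀ x, 0 ≤ g x ∧ g x ≤ 1 := fun x => hg01 (mem_range_self x)
    have hψ : ∀ n : ℕ, ContDiff ℝ 1 fun x => 1 - (1 - g x) ^ n := fun n =>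
      contDiff_const.sub ((contDiff_const.sub hg).pow n)
    have hlim : ∀ m : Measure Plane, ∀ _ : IsFiniteMeasure m,
        Tendsto (fun n : ℕ => ∫ x, (1 - (1 - g x) ^ n) ∂m) atTop (𝓝 (m.real U)) := by
      intro m _
      rw [← integral_indicator_one hU.measurableSet]
      refine tendsto_integral_of_dominated_convergence (fun _ => (1 : ℝ))
        (fun n => (hψ n).continuous.aestronglyMeasurable) (integrable_const _)
        (fun n => Eventually.of_forall fun x => ?_) (Eventually.of_forall fun x => ?_)
      · have h1 : 0 ≤ (1 - g x) ^ n := pow_nonneg (sub_nonneg.2 (hg01' x).2) n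
        have h2 : (1 - g x) ^ n ≤ 1 :=
          pow_le_one₀ (sub_nonneg.2 (hg01' x).2) (by linarith [(hg01' x).1])
        rw [Real.norm_of_nonneg (by linarith)]
        linarith
      · by_cases hx : x ∈ U
        · rw [indicator_of_mem hx, Pi.one_apply]
          rw [← hgU, Function.mem_support] at hx
          have := tendsto_pow_atTop_nhds_zero_of_lt_one (sub_nonneg.2 (hg01' x).2)
            (by linarith [(hg01' x).1.lt_of_ne' hx])
          simpa using this.const_sub 1
        · rw [indicator_of_notMem hx]
          rw [← hgU, Function.notMem_support] at hx
          simp [hx]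
    have h1 := hlim α inferInstance
    simp only [h _ (hψ _)] at h1
    have := tendsto_nhds_unique h1 (hlim β inferInstance)
    rwa [measureReal_eq_measureReal_iff] at this
  refine ext_of_generate_finite _ BorelSpace.measurable_eq isPiSystem_isOpen
    (fun s hs => hopen s hs) (hopen univ isOpen_univ)

theorem integral_toSignedMeasure_sub {α β : Measure Plane} [IsFiniteMeasure α]
    [IsFiniteMeasure β] {g : Plane → ℝ} (hα : Integrable g α) (hβ : Integrable g β) :
    (α.toSignedMeasure - β.toSignedMeasure).integral g (ContinuousLinearMap.lsmul ℝ ℝ) =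
      ∫ x, g x ∂α - ∫ x, g x ∂β := by
  have hflip : (ContinuousLinearMap.lsmul ℝ ℝ : ℝ →L[ℝ] ℝ →L[ℝ] ℝ) =
      (ContinuousLinearMap.lsmul ℝ ℝ).flip := by
    ext
    simp
  rw [← Measure.variation_toSignedMeasure (μ := α)] at hα
  rw [← Measure.variation_toSignedMeasure (μ := β)] at hβ
  rw [VectorMeasure.integral_sub_vectorMeasure hα hβ, hflip,
    VectorMeasure.integral_toSignedMeasure, VectorMeasure.integral_toSignedMeasure]

/-- The Jordan decomposition of a signed measure that is concentrated on `X`. -/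
theorem exists_eq_toSignedMeasure_sub {X : Set Plane} {μ : SignedMeasure Plane}
    (hμ : μ.variation Xᶜ = 0) :
    ∃ (α β : Measure Plane) (_ : IsFiniteMeasure α) (_ : IsFiniteMeasure β),
      α Xᶜ = 0 ∧ β Xᶜ = 0 ∧ μ = α.toSignedMeasure - β.toSignedMeasure := by
  refine ⟨μ.toJordanDecomposition.posPart, μ.toJordanDecomposition.negPart, inferInstance,
    inferInstance, ?_, ?_, ?_⟩
  · rw [← SignedMeasure.totalVariation_eq_variation] at hμ
    exact le_antisymm ((le_add_right le_rfl).trans hμ.le) bot_le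
  · rw [← SignedMeasure.totalVariation_eq_variation] at hμ
    exact le_antisymm ((le_add_left le_rfl).trans hμ.le) bot_le
  · exact μ.toSignedMeasure_toJordanDecomposition.symm

section Divergence

variable {Ω : Set Plane} {f : Plane → ℝ} {T : (Plane → ℝ) → ℝ}

theorem IsDivergence.unique (hΩb : Bornology.IsBounded Ω) {μ μ' : SignedMeasure Plane}
    (h : IsDivergence Ω T μ) (h' : IsDivergence Ω T μ') : μ = μ' := by
  obtain ⟨α, β, _, _, hα, hβ, rfl⟩ := exists_eq_toSignedMeasure_sub h.1
  obtain ⟨α', β', _, _, hα', hβ', rfl⟩ := exists_eq_toSignedMeasure_sub h'.1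
  have hX := hΩb.isCompact_closure
  have key : α + β' = α' + β := by
    refine measure_eq_of_forall_contDiff fun ψ hψ => ?_
    have i1 := integrable_of_continuous_of_isCompact hX hα hψ.continuous
    have i2 := integrable_of_continuous_of_isCompact hX hβ hψ.continuous
    have i3 := integrable_of_continuous_of_isCompact hX hα' hψ.continuous
    have i4 := integrable_of_continuous_of_isCompact hX hβ' hψ.continuous
    have h1 := h.2 ψ hψ
    rw [h'.2 ψ hψ, integral_toSignedMeasure_sub i1 i2, integral_toSignedMeasure_sub i3 i4] at h1
    rw [integral_add_measure i1 i4, integral_add_measure i3 i2]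
    linarith
  rw [sub_eq_sub_iff_add_eq_add, ← Measure.toSignedMeasure_add, ← Measure.toSignedMeasure_add]
  exact Measure.toSignedMeasure_congr key

theorem IsDivergence.divergence_eq (hΩb : Bornology.IsBounded Ω) {μ : SignedMeasure Plane}
    (h : IsDivergence Ω T μ) : divergence Ω T = μ := by
  have hex : HasMeasureDivergence Ω T := ⟨μ, h⟩
  rw [divergence, dif_pos hex]
  exact hex.choose_spec.unique hΩb h

theorem HasMeasureDivergence.isDivergence (h : HasMeasureDivergence Ω T) :
    IsDivergence Ω T (divergence Ω T) := by
  rw [divergence, dif_pos h]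
  exact h.choose_spec

/-- The measure `f dx` on `Ω`. -/
def sourceMeasure (Ω : Set Plane) (f : Plane → ℝ) : Measure Plane :=
  (volume.restrict Ω).withDensity fun x => ENNReal.ofReal (f x)

theorem isFiniteMeasure_sourceMeasure (hf : IntegrableOn f Ω) :
    IsFiniteMeasure (sourceMeasure Ω f) :=
  isFiniteMeasure_withDensity_ofReal hf.2

theorem sourceMeasure_eq_zero {s : Set Plane} (hs : volume.restrict Ω s = 0) :
    sourceMeasure Ω f s = 0 :=
  withDensity_absolutelyContinuous _ _ hs

theorem sourceMeasure_univ (hf : IntegrableOn f Ω)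
    (hf0 : ∀ᵐ x ∂(volume.restrict Ω), 0 ≤ f x) :
    sourceMeasure Ω f univ = ENNReal.ofReal (∫ x in Ω, f x) := by
  rw [sourceMeasure, withDensity_apply _ MeasurableSet.univ, Measure.restrict_univ,
    ofReal_integral_eq_lintegral_ofReal hf hf0]

theorem integral_sourceMeasure (hf : IntegrableOn f Ω)
    (hf0 : ∀ᵐ x ∂(volume.restrict Ω), 0 ≤ f x) (ψ : Plane → ℝ) :
    ∫ x, ψ x ∂(sourceMeasure Ω f) = ∫ x in Ω, f x * ψ x := by
  rw [sourceMeasure, integral_withDensity_eq_integral_toReal_smul₀ hf.1.aemeasurable.ennreal_ofReal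
    (Eventually.of_forall fun x => ENNReal.ofReal_lt_top)]
  refine integral_congr_ae (hf0.mono fun x hx => ?_)
  simp only [ENNReal.toReal_ofReal hx, smul_eq_mul]

theorem withDensityᵥ_eq_toSignedMeasure (hf : IntegrableOn f Ω)
    (hf0 : ∀ᵐ x ∂(volume.restrict Ω), 0 ≤ f x) :
    haveI := isFiniteMeasure_sourceMeasure hf
    (volume.restrict Ω).withDensityᵥ f = (sourceMeasure Ω f).toSignedMeasure := by
  have h1 : (volume.restrict Ω).withDensityᵥ f =
      (volume.restrict Ω).withDensityᵥ fun x => (ENNReal.ofReal (f x)).toReal :=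
    WithDensityᵥEq.congr_ae (hf0.mono fun x hx => (ENNReal.toReal_ofReal hx).symm)
  rw [h1]
  exact withDensityᵥ_toReal hf.1.aemeasurable.ennreal_ofReal hf.lintegral_lt_top.ne

end Divergence

/-! ### The divergence when `div v + f` is nonnegative -/

variable {Ω : Set Plane} {f : Plane → ℝ}

namespace EnergyDuality

variable {V : Type*} {N : V → ℝ≥0∞} {P : V → (Plane → Plane) → ℝ} {s : Seminorm ℝ C(Plane, Plane)}

theorem gradPair_const (h : EnergyDuality (closure Ω) N P s) {v : V} (hv : N v < ∞) (c : ℝ) :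
    gradPair P v (fun _ => c) = 0 := by
  have h0 := h.map_smul v hv 0 0
  rw [zero_mul] at h0
  rw [← h0]
  refine congrArg (P v) (funext fun x => ?_)
  simp

/-- If `div v + f` is nonnegative as a distribution, then it is a nonnegative measure, of total mass
`∫_Ω f` as `v` satisfies the Neumann condition. -/
theorem exists_measure_of_isDivNonneg (h : EnergyDuality (closure Ω) N P s)
    (hΩb : Bornology.IsBounded Ω) (hf : IntegrableOn f Ω) {v : V} (hv : N v < ∞)
    (hvf : IsDivNonneg Ω f (gradPair P v)) :
    ∃ ν : Measure Plane, IsFiniteMeasure ν ∧ ν (closure Ω)ᶜ = 0 ∧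
      ∀ ψ : Plane → ℝ, ContDiff ℝ 1 ψ →
        ∫ x, ψ x ∂ν = (∫ x in Ω, f x * ψ x) - gradPair P v ψ := by
  have hX := hΩb.isCompact_closure
  set c := ∫ x in Ω, f x
  set b : C1Fun →ₗ[ℝ] ℝ := sourceMap hΩb hf - h.pairMap hv
  have hb : ∀ ψ : C1Fun, b ψ = (∫ x in Ω, f x * (ψ : Plane → ℝ) x) - gradPair P v ψ := fun ψ => rfl
  have hb_const : ∀ r : ℝ, b (C1Fun.const r) = r * c := fun r => by
    rw [hb]
    simp only [C1Fun.const, h.gradPair_const hv, sub_zero, integral_mul_const]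
    ring
  have hb_nonneg : ∀ ψ : C1Fun, (∀ x ∈ closure Ω, 0 ≤ (ψ : Plane → ℝ) x) → 0 ≤ b ψ :=
    fun ψ hψ => sub_nonneg.2 (hvf ψ (C1Fun.contDiff ψ) hψ)
  have hc : 0 ≤ c := by
    have := hb_nonneg (C1Fun.const 1) fun x _ => zero_le_one
    rwa [hb_const, one_mul] at this
  let A : C1Fun →ₗ[ℝ] C(Plane, ℝ) :=
    { toFun := fun ψ => ⟨ψ, (C1Fun.contDiff ψ).continuous⟩
      map_add' := fun _ _ => rfl
      map_smul' := fun _ _ => rfl }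
  obtain ⟨L, hLp, hLb⟩ := exists_linear_le_sublinear_of_le_on_cone
    (fun g : C(Plane, ℝ) => c * supSeminorm hX g)
    (fun a ha x => by
      simp only [map_smul_eq_mul, Real.norm_of_nonneg ha.le]
      ring)
    (fun x y => by
      rw [← mul_add]
      exact mul_le_mul_of_nonneg_left (map_add_le_add _ x y) hc) A b ⊤ (fun ψ _ => by
      have h1 := hb_nonneg (C1Fun.const (supSeminorm hX (A ψ)) - ψ) fun x hx =>
        sub_nonneg.2 ((le_abs_self _).trans (norm_le_supSeminorm hX (A ψ) hx))
      rw [_root_.map_sub, hb_const] at h1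
      linarith)
  have hLA : ∀ ψ, L (A ψ) = b ψ := fun ψ => by
    refine le_antisymm ?_ (hLb ψ trivial)
    have := hLb (-ψ) trivial
    rw [_root_.map_neg, _root_.map_neg, _root_.map_neg] at this
    linarith
  obtain ⟨ν, hν, hνX, hνL⟩ := exists_measure_of_nonneg_on_isCompact hX L fun g hg => by
    set r := supSeminorm hX g
    have h1 : supSeminorm hX (A (C1Fun.const r) - g) ≤ r := by
      refine (supSeminorm_le_iff hX (apply_nonneg _ _)).2 fun x hx => ?_
      change |r - g x| ≤ r
      have := (le_abs_self _).trans (norm_le_supSeminorm hX g hx)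
      rw [abs_le]
      constructor <;> linarith [hg x hx]
    have h2 := (hLp _).trans (mul_le_mul_of_nonneg_left h1 hc)
    rw [_root_.map_sub, hLA, hb_const] at h2
    linarith
  exact ⟨ν, hν, hνX, fun ψ hψ => (hνL (A ⟨ψ, hψ⟩)).trans (hLA ⟨ψ, hψ⟩)⟩

/-- If `v` balances `f` off `K` and `div v + f` is nonnegative, then `div v + f` is a nonnegative
measure on `K` with total mass `∫_Ω f`. -/
theorem exists_isDivergence (h : EnergyDuality (closure Ω) N P s)
    (hΩb : Bornology.IsBounded Ω) (hf : IntegrableOn f Ω)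
    (hf0 : ∀ᵐ x ∂(volume.restrict Ω), 0 ≤ f x) {K : Set Plane} (hK : IsClosed K) {v : V}
    (hv : N v < ∞) (hvK : IsBalancedOff Ω f K (gradPair P v))
    (hvf : IsDivNonneg Ω f (gradPair P v)) :
    haveI := isFiniteMeasure_sourceMeasure hf
    ∃ (ν : Measure Plane) (_ : IsFiniteMeasure ν), ν Kᶜ = 0 ∧
      ν univ = ENNReal.ofReal (∫ x in Ω, f x) ∧
      IsDivergence Ω (gradPair P v) (ν.toSignedMeasure - (sourceMeasure Ω f).toSignedMeasure) := by
  have := isFiniteMeasure_sourceMeasure hf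
  have hX := hΩb.isCompact_closure
  obtain ⟨ν, hν, hνX, hνψ⟩ := h.exists_measure_of_isDivNonneg hΩb hf hv hvf
  have hfX : sourceMeasure Ω f (closure Ω)ᶜ = 0 := sourceMeasure_eq_zero (restrict_compl_closure Ω)
  refine ⟨ν, hν, ?_, ?_, ?_, fun ψ hψ => ?_⟩
  · obtain ⟨g, hgK, hg, hg01⟩ := hK.isOpen_compl.exists_contDiff_support_eq (n := 1)
    have hg0 : ∀ x ∈ K, g x = 0 := fun x hx => by
      rw [← Function.notMem_support, hgK]
      exact not_not.2 hx
    have h1 : ∫ x, g x ∂ν = 0 := by rw [hνψ g hg, hvK g hg hg0, sub_self]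
    have h2 := (integral_eq_zero_iff_of_nonneg (fun x => (hg01 (mem_range_self x)).1)
      (integrable_of_continuous_of_isCompact hX hνX hg.continuous)).1 h1
    refine measure_mono_null (fun x hx => ?_) (ae_iff.1 h2)
    rwa [← hgK, Function.mem_support] at hx
  · have := hνψ (fun _ => 1) contDiff_const
    rw [h.gradPair_const hv] at this
    simp only [mul_one, sub_zero, integral_const, smul_eq_mul] at this
    rw [← this, ofReal_measureReal]
  · have hle := VectorMeasure.variation_sub_le (μ := ν.toSignedMeasure)
      (ν := (sourceMeasure Ω f).toSignedMeasure) (closure Ω)ᶜ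
    rw [Measure.variation_toSignedMeasure, Measure.variation_toSignedMeasure, Measure.add_apply,
      hνX, hfX, add_zero] at hle
    exact le_antisymm hle bot_le
  · rw [integral_toSignedMeasure_sub (integrable_of_continuous_of_isCompact hX hνX hψ.continuous)
      (integrable_of_continuous_of_isCompact hX hfX hψ.continuous), hνψ ψ hψ,
      integral_sourceMeasure hf hf0]
    ring

/-- The cost of the divergence and the support of `div v + f`, when this measure is nonnegative. -/
theorem divergence_properties (h : EnergyDuality (closure Ω) N P s)
    (hΩb : Bornology.IsBounded Ω) (hf : IntegrableOn f Ω)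
    (hf0 : ∀ᵐ x ∂(volume.restrict Ω), 0 ≤ f x) (hfpos : 0 < ∫ x in Ω, f x) {K : Set Plane}
    (hK : IsClosed K) {v : V} (hv : N v < ∞) (hvK : IsBalancedOff Ω f K (gradPair P v))
    (hvf : IsDivNonneg Ω f (gradPair P v)) :
    HasMeasureDivergence Ω (gradPair P v) ∧
      (divergence Ω (gradPair P v)).variation univ ≤ ENNReal.ofReal (2 * ∫ x in Ω, f x) ∧
      sourceSupport Ω f (gradPair P v) ⊆ K ∧ (sourceSupport Ω f (gradPair P v)).Nonempty := by
  have := isFiniteMeasure_sourceMeasure hf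
  obtain ⟨ν, hν, hνK, hνuniv, hdiv⟩ := h.exists_isDivergence hΩb hf hf0 hK hv hvK hvf
  have heq := hdiv.divergence_eq hΩb
  have hsupp : sourceSupport Ω f (gradPair P v) = ν.support := by
    rw [sourceSupport, heq, withDensityᵥ_eq_toSignedMeasure hf hf0, sub_add_cancel,
      Measure.variation_toSignedMeasure]
  refine ⟨⟨_, hdiv⟩, ?_, ?_, ?_⟩
  · rw [heq]
    refine (VectorMeasure.variation_sub_le univ).trans ?_
    rw [Measure.variation_toSignedMeasure, Measure.variation_toSignedMeasure, Measure.add_apply,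
      hνuniv, sourceMeasure_univ hf hf0, ← two_mul, ENNReal.ofReal_mul zero_le_two]
    simp
  · rw [hsupp]
    exact Measure.support_subset_of_isClosed hK (mem_ae_iff.2 hνK)
  · rw [hsupp]
    refine Measure.nonempty_support fun h0 => ?_
    rw [h0, Measure.coe_zero, Pi.zero_apply] at hνuniv
    exact (ENNReal.ofReal_pos.2 hfpos).ne hνuniv

/-- If `div v + f` is a measure on a set `K` of finite length, then `v` balances `f` off `K`, and the
total variation of `div v` is at least `2 ∫_Ω f`: the divergence is `-f` off the Lebesgue null set
`K`, and its total mass is zero. -/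
theorem isBalancedOff_of_sourceSupport_subset (h : EnergyDuality (closure Ω) N P s)
    (hΩb : Bornology.IsBounded Ω) (hf : IntegrableOn f Ω)
    (hf0 : ∀ᵐ x ∂(volume.restrict Ω), 0 ≤ f x) {K : Set Plane} (hK : IsClosed K)
    (hKvol : volume K = 0) {v : V} (hv : N v < ∞)
    (hdiv : HasMeasureDivergence Ω (gradPair P v))
    (hsupp : sourceSupport Ω f (gradPair P v) ⊆ K) :
    IsBalancedOff Ω f K (gradPair P v) ∧
      ENNReal.ofReal (2 * ∫ x in Ω, f x) ≤ (divergence Ω (gradPair P v)).variation univ := by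
  have := isFiniteMeasure_sourceMeasure hf
  have hX := hΩb.isCompact_closure
  have hfX : sourceMeasure Ω f (closure Ω)ᶜ = 0 := sourceMeasure_eq_zero (restrict_compl_closure Ω)
  have hμ := hdiv.isDivergence
  set μ := divergence Ω (gradPair P v) with hμdef
  have hκK : (μ + (sourceMeasure Ω f).toSignedMeasure).variation Kᶜ = 0 := by
    refine measure_mono_null (compl_subset_compl.2 hsupp) ?_
    rw [sourceSupport, withDensityᵥ_eq_toSignedMeasure hf hf0]
    exact Measure.measure_compl_support
  obtain ⟨α, β, _, _, hα, hβ, hμαβ⟩ := exists_eq_toSignedMeasure_sub hμ.1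
  constructor
  · intro ψ hψ hψK
    have i1 := integrable_of_continuous_of_isCompact hX hα hψ.continuous
    have i2 := integrable_of_continuous_of_isCompact hX hβ hψ.continuous
    have i3 := integrable_of_continuous_of_isCompact hX hfX hψ.continuous
    have i4 : Integrable ψ (α + sourceMeasure Ω f) := i1.add_measure i3
    have h1 := hμ.2 ψ hψ
    rw [hμαβ, integral_toSignedMeasure_sub i1 i2] at h1
    have h2 : μ + (sourceMeasure Ω f).toSignedMeasure =
        (α + sourceMeasure Ω f).toSignedMeasure - β.toSignedMeasure := by
      rw [hμαβ, Measure.toSignedMeasure_add]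
      abel
    have h3 : (μ + (sourceMeasure Ω f).toSignedMeasure).integral ψ
        (ContinuousLinearMap.lsmul ℝ ℝ) = 0 :=
      VectorMeasure.integral_eq_zero_of_ae
        (Eventually.mono (show ∀ᵐ x ∂_, x ∈ K from mem_ae_iff.2 hκK) fun x hx => hψK x hx)
    rw [h2, integral_toSignedMeasure_sub i4 i2, integral_add_measure i1 i3,
      integral_sourceMeasure hf hf0] at h3
    linarith
  · have hμuniv : μ univ = 0 := by
      have h1 := hμ.2 (fun _ => 1) contDiff_const
      rw [h.gradPair_const hv, hμαβ,
        integral_toSignedMeasure_sub (integrable_const _) (integrable_const _)] at h1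
      rw [hμαβ, Measure.toSignedMeasure_sub_apply MeasurableSet.univ]
      simp only [integral_const, smul_eq_mul, mul_one] at h1
      linarith
    have hsub : ∀ S, MeasurableSet S → (μ + (sourceMeasure Ω f).toSignedMeasure) S =
        μ S + (sourceMeasure Ω f).real S := fun S hS => by
      rw [_root_.add_apply, Measure.toSignedMeasure_apply_measurable hS]
    have hsK : sourceMeasure Ω f K = 0 :=
      sourceMeasure_eq_zero (le_antisymm ((Measure.restrict_apply_le _ _).trans hKvol.le) bot_le)
    have hreal : (sourceMeasure Ω f).real Kᶜ = ∫ x in Ω, f x := by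
      have h1 := measureReal_add_measureReal_compl (μ := sourceMeasure Ω f) hK.measurableSet
      rw [measureReal_def, hsK, ENNReal.toReal_zero, zero_add] at h1
      rw [h1, measureReal_def, sourceMeasure_univ hf hf0,
        ENNReal.toReal_ofReal (integral_nonneg_of_ae hf0)]
    have hKc : μ Kᶜ = -∫ x in Ω, f x := by
      have h1 := (VectorMeasure.enorm_measure_le_variation _ _).trans hκK.le
      rw [nonpos_iff_eq_zero, enorm_eq_zero, hsub _ hK.measurableSet.compl, hreal] at h1
      linarith
    have hKm : μ K = ∫ x in Ω, f x := by
      have h1 := VectorMeasure.of_add_of_sdiff (v := μ) hK.measurableSet MeasurableSet.univ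
        (subset_univ K)
      rw [← compl_eq_univ_sdiff, hKc, hμuniv] at h1
      linarith
    have hI : 0 ≤ ∫ x in Ω, f x := integral_nonneg_of_ae hf0
    rw [← measure_add_measure_compl hK.measurableSet, two_mul, ENNReal.ofReal_add hI hI]
    refine add_le_add ?_ ?_
    · refine le_trans (le_of_eq ?_) (VectorMeasure.enorm_measure_le_variation μ K)
      rw [hKm, Real.enorm_of_nonneg hI]
    · refine le_trans (le_of_eq ?_) (VectorMeasure.enorm_measure_le_variation μ Kᶜ)
      rw [hKc, enorm_neg, Real.enorm_of_nonneg hI]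

end EnergyDuality

/-! ### The direct method -/

theorem exists_tendsto_ultrafilter {ι X : Type*} [TopologicalSpace X] [CompactSpace X]
    (l : Ultrafilter ι) (u : ι → X) : ∃ x, Tendsto u l (𝓝 x) := by
  obtain ⟨x, -, hx⟩ := isCompact_univ.ultrafilter_le_nhds (l.map u) (by simp)
  exact ⟨x, hx⟩

theorem exists_tendsto_ultrafilter_of_abs_le {ι : Type*} (l : Ultrafilter ι) {u : ι → ℝ} {C : ℝ}
    (hu : ∀ᶠ i in (l : Filter ι), |u i| ≤ C) : ∃ x, Tendsto u l (𝓝 x) := by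
  obtain ⟨x, -, hx⟩ := (isCompact_Icc (a := -C) (b := C)).ultrafilter_le_nhds (l.map u)
    (by
      rw [le_principal_iff, Ultrafilter.mem_coe, Ultrafilter.mem_map]
      exact hu.mono fun i hi => abs_le.1 hi)
  exact ⟨x, hx⟩

/-- The infimum of an extended nonnegative function on a nonempty set is the limit along an
ultrafilter of its values. -/
theorem exists_minimizing_sequence {α : Type*} {A : Set α} (hA : A.Nonempty) (J : α → ℝ≥0∞) :
    ∃ u : ℕ → α, (∀ n, u n ∈ A) ∧
      Tendsto (fun n => J (u n)) (hyperfilter ℕ : Ultrafilter ℕ) (𝓝 (⨅ a ∈ A, J a)) := by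
  obtain ⟨t, -, ht, htA⟩ := exists_seq_tendsto_sInf (hA.image J) (OrderBot.bddBelow _)
  choose u hu hut using htA
  refine ⟨u, hu, ?_⟩
  simp only [hut]
  rw [sInf_image] at ht
  exact ht.mono_left (Nat.hyperfilter_le_atTop)

/-- Existence of a shortest continuum containing a given set. -/
theorem exists_hausdorffMeasure_eq_steinerLength (hΩb : Bornology.IsBounded Ω) {A : Set Plane}
    (hA : ∃ K ∈ continua Ω, A ⊆ K) :
    ∃ K ∈ continua Ω, A ⊆ K ∧ μH[1] K = steinerLength Ω A := by
  obtain ⟨K, hK, hlim⟩ := exists_minimizing_sequence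
    (A := {K | K ∈ continua Ω ∧ A ⊆ K}) hA fun K => μH[1] K
  obtain ⟨K', hK'Ω, hK'cl, hK'conn, hK'O, hK'b⟩ := exists_continuum_limit hΩb.isCompact_closure
    (fun n => (hK n).1.1) (fun n => (hK n).1.2.1) (fun n => (hK n).1.2.2) (hyperfilter ℕ)
  have hAK : A ⊆ K' := fun y hy => by
    by_contra hyK
    obtain ⟨n, hn⟩ := (hK'O {y}ᶜ isOpen_compl_singleton fun z hz hzy => hyK (hzy ▸ hz)).exists
    exact hn ((hK n).2 hy) rfl
  refine ⟨K', ⟨hK'Ω, hK'cl, hK'conn⟩, hAK, le_antisymm (hK'b _ hlim) ?_⟩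
  exact iInf₂_le_of_le K' ⟨⟨hK'Ω, hK'cl, hK'conn⟩, hAK⟩ le_rfl

namespace EnergyDuality

variable {V : Type*} {N : V → ℝ≥0∞} {P : V → (Plane → Plane) → ℝ} {s : Seminorm ℝ C(Plane, Plane)}

/-- Weak compactness: fields of bounded size converge along an ultrafilter, and their size is lower
semicontinuous. -/
theorem exists_weak_limit (h : EnergyDuality (closure Ω) N P s) {ι : Type*} (l : Ultrafilter ι)
    {v : ι → V} {a : ℝ≥0∞} (ha : a < ∞) (hv : Tendsto (fun i => N (v i)) l (𝓝 a)) :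
    ∃ w, N w ≤ a ∧ ∀ G : C(Plane, Plane), Tendsto (fun i => P (v i) G) l (𝓝 (P w G)) := by
  have hfin : ∀ᶠ i in (l : Filter ι), N (v i) < a + 1 :=
    hv.eventually_lt_const (ENNReal.lt_add_right ha.ne one_ne_zero)
  have ha1 : a + 1 ≠ ∞ := ENNReal.add_ne_top.2 ⟨ha.ne, ENNReal.one_ne_top⟩
  have hex : ∀ G : C(Plane, Plane), ∃ x, Tendsto (fun i => P (v i) G) l (𝓝 x) := fun G => by
    refine exists_tendsto_ultrafilter_of_abs_le l (C := (a + 1).toReal * s G)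
      (hfin.mono fun i hi => ?_)
    have hi' : N (v i) < ∞ := hi.trans ha1.lt_top
    have hmul : (N (v i)).toReal * s G ≤ (a + 1).toReal * s G :=
      mul_le_mul_of_nonneg_right (ENNReal.toReal_mono ha1 hi.le) (apply_nonneg s G)
    have h1 := h.le _ hi' G
    have h2 := h.le _ hi' ((-1 : ℝ) • G)
    rw [h.map_smul _ hi', map_smul_eq_mul, norm_neg, norm_one, one_mul] at h2
    exact abs_le.2 ⟨by linarith, by linarith⟩
  choose L hL using hex
  let Llin : C(Plane, Plane) →ₗ[ℝ] ℝ :=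
    { toFun := L
      map_add' := fun G H => tendsto_nhds_unique (hL (G + H)) <|
        ((hL G).add (hL H)).congr' <| hfin.mono fun i hi =>
          (h.map_add _ (hi.trans ha1.lt_top) G H).symm
      map_smul' := fun c G => tendsto_nhds_unique (hL (c • G)) <|
        ((hL G).const_mul c).congr' <| hfin.mono fun i hi =>
          (h.map_smul _ (hi.trans ha1.lt_top) c G).symm }
  obtain ⟨w, hw, hwL⟩ := h.exists_rep Llin a.toReal ENNReal.toReal_nonneg fun G =>
    le_of_tendsto_of_tendsto (hL G)
      (((ENNReal.tendsto_toReal ha.ne).comp hv).mul_const (s G))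
      (hfin.mono fun i hi => h.le _ (hi.trans ha1.lt_top) G)
  rw [ENNReal.ofReal_toReal ha.ne] at hw
  refine ⟨w, hw, fun G => ?_⟩
  rw [hwL G]
  exact hL G

/-- The conditions on a field pass to limits in which the continua converge. A test function that
is nonpositive on `K'` is replaced by the positive part of `ψ - ε`, which vanishes near `K'` and so
on the approximating continua; the error is small since `div v + f` is nonnegative. -/
theorem isBalancedOff_of_tendsto (h : EnergyDuality (closure Ω) N P s)
    (hΩb : Bornology.IsBounded Ω) (hf : IntegrableOn f Ω)
    (hf0 : ∀ᵐ x ∂(volume.restrict Ω), 0 ≤ f x) {ι : Type*} (l : Ultrafilter ι)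
    {K : ι → Set Plane} {K' : Set Plane}
    (hK : ∀ O, IsOpen O → K' ⊆ O → ∀ᶠ i in (l : Filter ι), K i ⊆ O) {v : ι → V} {w : V}
    (hw : N w < ∞)
    (hvw : ∀ G : C(Plane, Plane), Tendsto (fun i => P (v i) G) l (𝓝 (P w G)))
    (hvK : ∀ i, IsBalancedOff Ω f (K i) (gradPair P (v i)))
    (hvf : ∀ i, IsDivNonneg Ω f (gradPair P (v i))) :
    IsBalancedOff Ω f K' (gradPair P w) ∧ IsDivNonneg Ω f (gradPair P w) := by
  have hlim : ∀ ψ : C1Fun, Tendsto (fun i => gradPair P (v i) ψ) l (𝓝 (gradPair P w ψ)) :=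
    fun ψ => hvw (gradMap ψ)
  have hwf : IsDivNonneg Ω f (gradPair P w) := fun ψ hψ hψ0 =>
    le_of_tendsto' (hlim ⟨ψ, hψ⟩) fun i => hvf i ψ hψ hψ0
  refine ⟨?_, hwf⟩
  set b : C1Fun →ₗ[ℝ] ℝ := sourceMap hΩb hf - h.pairMap hw with hb_def
  have hb : ∀ ψ : C1Fun, b ψ = (∫ x in Ω, f x * (ψ : Plane → ℝ) x) - gradPair P w ψ := fun ψ => rfl
  have hI : 0 ≤ ∫ x in Ω, f x := integral_nonneg_of_ae hf0
  have key : ∀ ψ : C1Fun, (∀ x ∈ K', (ψ : Plane → ℝ) x ≤ 0) → b ψ ≤ 0 := by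
    intro ψ hψ
    have hε : ∀ ε : ℝ, 0 < ε → b ψ ≤ ε * (2 * ∫ x in Ω, f x) := by
      intro ε hε
      obtain ⟨r, r', hr, hr'c, -, hr0, hrε⟩ := exists_soft_posPart hε
      set φ : C1Fun := ψ - C1Fun.const ε
      have hχ : ContDiff ℝ 1 (r ∘ (φ : Plane → ℝ)) :=
        contDiff_comp_of_hasDerivAt hr hr'c (C1Fun.contDiff φ)
      set χ : C1Fun := ⟨_, hχ⟩
      have hO : IsOpen {x | (ψ : Plane → ℝ) x < ε} :=
        isOpen_lt (C1Fun.contDiff ψ).continuous continuous_const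
      have hbχ : b χ = 0 := by
        rw [hb, sub_eq_zero]
        refine tendsto_nhds_unique ?_ (hlim χ)
        refine (tendsto_const_nhds (f := (l : Filter ι))).congr' ?_
        refine (hK _ hO fun x hx => (hψ x hx).trans_lt hε).mono fun i hi => ?_
        refine (hvK i _ hχ fun x hx => hr0 _ ?_).symm
        exact sub_nonpos.2 (hi hx).le
      have h1 : 0 ≤ b (χ + C1Fun.const (2 * ε) - ψ) := by
        refine sub_nonneg.2 (hwf _ (C1Fun.contDiff _) fun x _ => ?_)
        have : (ψ : Plane → ℝ) x - ε - ε ≤ r ((ψ : Plane → ℝ) x - ε) := hrε _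
        change 0 ≤ r ((ψ : Plane → ℝ) x - ε) + 2 * ε - (ψ : Plane → ℝ) x
        linarith
      have h2 : b (C1Fun.const (2 * ε)) = 2 * ε * ∫ x in Ω, f x := by
        rw [hb]
        simp only [C1Fun.const, h.gradPair_const hw, sub_zero, integral_mul_const]
        ring
      rw [_root_.map_sub, _root_.map_add, hbχ, h2] at h1
      linarith
    refine le_of_forall_pos_le_add fun δ hδ => ?_
    have := hε (δ / (1 + 2 * ∫ x in Ω, f x)) (by positivity)
    refine this.trans ?_
    rw [zero_add, div_mul_eq_mul_div, div_le_iff₀ (by positivity)]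
    nlinarith
  intro ψ hψ hψK
  have h1 := key ⟨ψ, hψ⟩ fun x hx => (hψK x hx).le
  have h2 := key (-⟨ψ, hψ⟩) fun x hx => (neg_eq_zero.2 (hψK x hx)).le
  rw [_root_.map_neg] at h2
  have h3 := hb ⟨ψ, hψ⟩
  change b ⟨ψ, hψ⟩ = (∫ x in Ω, f x * ψ x) - gradPair P w ψ at h3
  linarith

/-- The direct method for the dual problem, along a minimizing sequence of fields for which
`div v + f` is nonnegative. -/
theorem exists_minimal_pair (h : EnergyDuality (closure Ω) N P s)
    (hΩb : Bornology.IsBounded Ω) (hf : IntegrableOn f Ω)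
    (hf0 : ∀ᵐ x ∂(volume.restrict Ω), 0 ≤ f x) {θ : ℝ≥0∞ → ℝ≥0∞} (hθ : Continuous θ)
    (hθm : Monotone θ) (hθtop : θ ⊤ = ⊤)
    (hex : ∃ p ∈ admissiblePairs (gradPair P) Ω f, dualFunctional (θ ∘ N) p < ⊤) :
    ∃ p ∈ admissiblePairs (gradPair P) Ω f, IsDivNonneg Ω f (gradPair P p.2) ∧
      ∀ p' ∈ admissiblePairs (gradPair P) Ω f,
        dualFunctional (θ ∘ N) p ≤ dualFunctional (θ ∘ N) p' := by
  set A := {p | p ∈ admissiblePairs (gradPair P) Ω f ∧ dualFunctional (θ ∘ N) p < ⊤}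
  have hNfin : ∀ p ∈ A, N p.2 < ∞ := fun p hp => by
    by_contra hcon
    rw [not_lt_top_iff] at hcon
    have : dualFunctional (θ ∘ N) p = ⊤ := by simp [dualFunctional, hcon, hθtop]
    exact hp.2.ne this
  obtain ⟨u, hu, hlim⟩ := exists_minimizing_sequence (A := A) hex (dualFunctional (θ ∘ N))
  set l : Ultrafilter ℕ := hyperfilter ℕ
  choose v hvN hvK hvf using fun n =>
    h.exists_isDivNonneg hΩb hf hf0 (hu n).1.1.1 (hNfin _ (hu n)) (hu n).1.2
  set m := ⨅ p ∈ A, dualFunctional (θ ∘ N) p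
  have hm : m < ⊤ := by
    obtain ⟨p, hp⟩ := hex
    exact (iInf₂_le (f := fun p (_ : p ∈ A) => dualFunctional (θ ∘ N) p) p hp).trans_lt hp.2
  obtain ⟨a, ha⟩ := exists_tendsto_ultrafilter l fun n => N (v n)
  obtain ⟨b, hb⟩ := exists_tendsto_ultrafilter l fun n => μH[1] (u n).1
  have hab : θ a + b ≤ m := by
    refine le_of_tendsto_of_tendsto' (((hθ.tendsto a).comp ha).add hb) hlim fun n => ?_
    exact add_le_add_left (hθm (hvN n)) _
  have ha_top : a < ∞ := by
    by_contra hcon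
    rw [not_lt_top_iff] at hcon
    rw [hcon, hθtop, top_add] at hab
    exact hm.not_ge hab
  obtain ⟨w, hwa, hw⟩ := h.exists_weak_limit l ha_top ha
  obtain ⟨K', hK'Ω, hK'cl, hK'conn, hK'O, hK'b⟩ := exists_continuum_limit hΩb.isCompact_closure
    (fun n => (hu n).1.1.1) (fun n => (hu n).1.1.2.1) (fun n => (hu n).1.1.2.2) l
  obtain ⟨hwK, hwf⟩ := h.isBalancedOff_of_tendsto hΩb hf hf0 l hK'O (hwa.trans_lt ha_top) hw hvK hvf
  refine ⟨(K', w), ⟨⟨hK'Ω, hK'cl, hK'conn⟩, hwK⟩, hwf, fun p' hp' => ?_⟩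
  have h1 : dualFunctional (θ ∘ N) (K', w) ≤ m :=
    (add_le_add (hθm hwa) (hK'b b hb)).trans hab
  rcases lt_or_ge (dualFunctional (θ ∘ N) p') ⊤ with hp | hp
  · exact h1.trans (iInf₂_le (f := fun p (_ : p ∈ A) => dualFunctional (θ ∘ N) p) p' ⟨hp', hp⟩)
  · exact le_top.trans hp

end EnergyDuality

/-! ### The limit functional and the dual problem -/

theorem exists_Lp_eq_one (hΩb : Bornology.IsBounded Ω) :
    ∃ φ : Lp ℝ 2 (volume.restrict Ω), φ =ᵐ[volume.restrict Ω] fun _ => (1 : ℝ) :=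
  haveI := isFiniteMeasure_restrict_of_isBounded hΩb
  ⟨(memLp_const (1 : ℝ)).toLp _, MemLp.coeFn_toLp _⟩

theorem limitFunctional_lt_top_iff {V : Type*} {e : V → ℝ≥0∞} {T : V → (Plane → ℝ) → ℝ}
    {z : V × Lp ℝ 2 (volume.restrict Ω) × closure Ω} :
    limitFunctional e T Ω f z < ⊤ ↔
      (HasMeasureDivergence Ω (T z.1) ∧ (z.2.2 : Plane) ∈ sourceSupport Ω f (T z.1) ∧
        z.2.1 =ᵐ[volume.restrict Ω] fun _ => (1 : ℝ)) ∧
      limitFunctional e T Ω f z =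
        e z.1 + (divergence Ω (T z.1)).variation univ + connectedLength Ω f (T z.1) ∧
      e z.1 < ⊤ ∧ connectedLength Ω f (T z.1) < ⊤ := by
  constructor
  · intro hz
    by_cases hc : HasMeasureDivergence Ω (T z.1) ∧ (z.2.2 : Plane) ∈ sourceSupport Ω f (T z.1) ∧
        z.2.1 =ᵐ[volume.restrict Ω] fun _ => (1 : ℝ)
    · have heq : limitFunctional e T Ω f z =
          e z.1 + (divergence Ω (T z.1)).variation univ + connectedLength Ω f (T z.1) := if_pos hc
      refine ⟨hc, heq, ?_⟩
      rw [heq, ENNReal.add_lt_top, ENNReal.add_lt_top] at hz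
      exact ⟨hz.1.1, hz.2⟩
    · exact absurd (show limitFunctional e T Ω f z = ⊤ from if_neg hc) hz.ne
  · rintro ⟨hc, heq, he, hl⟩
    rw [heq]
    have : (divergence Ω (T z.1)).variation univ < ⊤ := by
      rw [← SignedMeasure.totalVariation_eq_variation]
      exact measure_lt_top _ _
    exact ENNReal.add_lt_top.2 ⟨ENNReal.add_lt_top.2 ⟨he, this⟩, hl⟩

namespace EnergyDuality

variable {V : Type*} {N : V → ℝ≥0∞} {P : V → (Plane → Plane) → ℝ} {s : Seminorm ℝ C(Plane, Plane)}
  {θ : ℝ≥0∞ → ℝ≥0∞}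

theorem lt_top_of_comp_lt_top (hθtop : θ ⊤ = ⊤) {v : V} (hv : (θ ∘ N) v < ⊤) : N v < ⊤ := by
  by_contra hcon
  rw [not_lt_top_iff] at hcon
  rw [Function.comp_apply, hcon, hθtop] at hv
  exact lt_irrefl _ hv

/-- Every shortest continuum that contains the support of `div v + f` forms an admissible pair with
`v`, and the limit functional is bounded below by the value of this pair. -/
theorem dualFunctional_add_le (h : EnergyDuality (closure Ω) N P s)
    (hΩb : Bornology.IsBounded Ω) (hf : IntegrableOn f Ω)
    (hf0 : ∀ᵐ x ∂(volume.restrict Ω), 0 ≤ f x) (hθtop : θ ⊤ = ⊤)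
    {z : V × Lp ℝ 2 (volume.restrict Ω) × closure Ω}
    (hz : limitFunctional (θ ∘ N) (gradPair P) Ω f z < ⊤) {K : Set Plane} (hK : K ∈ continua Ω)
    (hsupp : sourceSupport Ω f (gradPair P z.1) ⊆ K)
    (hlen : μH[1] K = connectedLength Ω f (gradPair P z.1)) :
    (K, z.1) ∈ admissiblePairs (gradPair P) Ω f ∧
      dualFunctional (θ ∘ N) (K, z.1) + ENNReal.ofReal (2 * ∫ x in Ω, f x) ≤
        limitFunctional (θ ∘ N) (gradPair P) Ω f z := by
  obtain ⟨⟨hdiv, -, -⟩, heq, he, hl⟩ := limitFunctional_lt_top_iff.1 hz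
  obtain ⟨hbal, hle⟩ := h.isBalancedOff_of_sourceSupport_subset hΩb hf hf0 hK.2.1
    (volume_eq_zero_of_hausdorffMeasure_lt_top (hlen ▸ hl)) (lt_top_of_comp_lt_top hθtop he) hdiv
    hsupp
  refine ⟨⟨hK, hbal⟩, ?_⟩
  rw [heq, dualFunctional, hlen, add_right_comm]
  gcongr

theorem exists_dualFunctional_add_le (h : EnergyDuality (closure Ω) N P s)
    (hΩb : Bornology.IsBounded Ω) (hf : IntegrableOn f Ω)
    (hf0 : ∀ᵐ x ∂(volume.restrict Ω), 0 ≤ f x) (hθtop : θ ⊤ = ⊤)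
    {z : V × Lp ℝ 2 (volume.restrict Ω) × closure Ω}
    (hz : limitFunctional (θ ∘ N) (gradPair P) Ω f z < ⊤) :
    ∃ K, (K, z.1) ∈ admissiblePairs (gradPair P) Ω f ∧
      dualFunctional (θ ∘ N) (K, z.1) + ENNReal.ofReal (2 * ∫ x in Ω, f x) ≤
        limitFunctional (θ ∘ N) (gradPair P) Ω f z := by
  have hl := (limitFunctional_lt_top_iff.1 hz).2.2.2
  rw [connectedLength, steinerLength, iInf_lt_top] at hl
  obtain ⟨K₀, hK₀⟩ := hl
  rw [iInf_lt_top] at hK₀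
  obtain ⟨⟨hK₀, hK₀supp⟩, -⟩ := hK₀
  obtain ⟨K, hK, hsupp, hlen⟩ := exists_hausdorffMeasure_eq_steinerLength hΩb ⟨K₀, hK₀, hK₀supp⟩
  exact ⟨K, h.dualFunctional_add_le hΩb hf hf0 hθtop hz hK hsupp hlen⟩

/-- A pair `(K, v)` for which `div v + f` is nonnegative bounds the limit functional from above. -/
theorem limitFunctional_le (h : EnergyDuality (closure Ω) N P s)
    (hΩb : Bornology.IsBounded Ω) (hf : IntegrableOn f Ω)
    (hf0 : ∀ᵐ x ∂(volume.restrict Ω), 0 ≤ f x) (hfpos : 0 < ∫ x in Ω, f x) (hθtop : θ ⊤ = ⊤)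
    {K : Set Plane} {v : V} (hKv : (K, v) ∈ admissiblePairs (gradPair P) Ω f)
    (hfin : dualFunctional (θ ∘ N) (K, v) < ⊤) (hvf : IsDivNonneg Ω f (gradPair P v))
    {φ : Lp ℝ 2 (volume.restrict Ω)} (hφ : φ =ᵐ[volume.restrict Ω] fun _ => (1 : ℝ))
    {y : closure Ω} (hy : (y : Plane) ∈ sourceSupport Ω f (gradPair P v)) :
    limitFunctional (θ ∘ N) (gradPair P) Ω f (v, φ, y) ≤
      dualFunctional (θ ∘ N) (K, v) + ENNReal.ofReal (2 * ∫ x in Ω, f x) := by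
  obtain ⟨hdiv, hle, hsupp, -⟩ := h.divergence_properties hΩb hf hf0 hfpos hKv.1.2.1
    (lt_top_of_comp_lt_top hθtop (ENNReal.add_lt_top.1 hfin).1) hKv.2 hvf
  rw [limitFunctional, if_pos ⟨hdiv, hy, hφ⟩, dualFunctional, add_right_comm]
  exact add_le_add (add_le_add le_rfl (iInf₂_le K ⟨hKv.1, hsupp⟩)) hle

/-- The relation between the limit functional and the dual problem, for fields whose minimizers have
a nonnegative `div v + f`. -/
theorem limitFunctional_minimization (h : EnergyDuality (closure Ω) N P s)
    (hΩb : Bornology.IsBounded Ω) (hf : IntegrableOn f Ω)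
    (hf0 : ∀ᵐ x ∂(volume.restrict Ω), 0 ≤ f x) (hfpos : 0 < ∫ x in Ω, f x)
    (hθ : Continuous θ) (hθm : Monotone θ) (hθtop : θ ⊤ = ⊤)
    (hmin : ∀ K v, IsFiniteMinimizer (dualFunctional (θ ∘ N)) (admissiblePairs (gradPair P) Ω f)
      (K, v) → IsDivNonneg Ω f (gradPair P v)) :
    (∃ z, ∀ z', limitFunctional (θ ∘ N) (gradPair P) Ω f z ≤
      limitFunctional (θ ∘ N) (gradPair P) Ω f z') ∧
    ((∃ z, IsFiniteMinimizer (limitFunctional (θ ∘ N) (gradPair P) Ω f) univ z) ↔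
      ∃ p ∈ admissiblePairs (gradPair P) Ω f, dualFunctional (θ ∘ N) p < ⊤) ∧
    (⨅ z, limitFunctional (θ ∘ N) (gradPair P) Ω f z) =
      (⨅ p ∈ admissiblePairs (gradPair P) Ω f, dualFunctional (θ ∘ N) p) +
        ENNReal.ofReal (2 * ∫ x in Ω, f x) ∧
    (∀ (v : V) (φ : Lp ℝ 2 (volume.restrict Ω)) (y : closure Ω),
      IsFiniteMinimizer (limitFunctional (θ ∘ N) (gradPair P) Ω f) univ (v, φ, y) ↔
        φ =ᵐ[volume.restrict Ω] (fun _ => (1 : ℝ)) ∧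
        (y : Plane) ∈ sourceSupport Ω f (gradPair P v) ∧
        ∃ K, IsFiniteMinimizer (dualFunctional (θ ∘ N)) (admissiblePairs (gradPair P) Ω f)
          (K, v)) ∧
    (∀ (K : Set Plane) (v : V),
      IsFiniteMinimizer (dualFunctional (θ ∘ N)) (admissiblePairs (gradPair P) Ω f) (K, v) ↔
        K ∈ continua Ω ∧ sourceSupport Ω f (gradPair P v) ⊆ K ∧
        μH[1] K = connectedLength Ω f (gradPair P v) ∧
        ∃ φ y, IsFiniteMinimizer (limitFunctional (θ ∘ N) (gradPair P) Ω f) univ (v, φ, y)) := by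
  set F := limitFunctional (θ ∘ N) (gradPair P) Ω f with hF
  set A := admissiblePairs (gradPair P) Ω f
  set J : Set Plane × V → ℝ≥0∞ := dualFunctional (θ ∘ N) with hJ
  set I := ENNReal.ofReal (2 * ∫ x in Ω, f x) with hIdef
  have hI : I ≠ ⊤ := ENNReal.ofReal_ne_top
  obtain ⟨φ₁, hφ₁⟩ := exists_Lp_eq_one hΩb
  -- A minimizer of the dual problem gives minimizers of the limit functional.
  have hmin_le : ∀ K v, IsFiniteMinimizer J A (K, v) → ∀ z', J (K, v) + I ≤ F z' := by
    intro K v hKv z'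
    rcases lt_or_ge (F z') ⊤ with hz' | hz'
    · obtain ⟨K', hK'A, hK'⟩ := h.exists_dualFunctional_add_le hΩb hf hf0 hθtop hz'
      exact (add_le_add_left (hKv.2.2 _ hK'A) I).trans hK'
    · exact le_top.trans hz'
  have hbuild : ∀ K v, IsFiniteMinimizer J A (K, v) → ∀ (φ : Lp ℝ 2 (volume.restrict Ω))
      (y : closure Ω), φ =ᵐ[volume.restrict Ω] (fun _ => (1 : ℝ)) →
      (y : Plane) ∈ sourceSupport Ω f (gradPair P v) →
      F (v, φ, y) = J (K, v) + I ∧ IsFiniteMinimizer F univ (v, φ, y) := by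
    intro K v hKv φ y hφ hy
    have hle : F (v, φ, y) ≤ J (K, v) + I :=
      h.limitFunctional_le hΩb hf hf0 hfpos hθtop hKv.1 hKv.2.1 (hmin K v hKv) hφ hy
    exact ⟨le_antisymm hle (hmin_le K v hKv _), mem_univ _,
      hle.trans_lt (ENNReal.add_lt_top.2 ⟨hKv.2.1, hI.lt_top⟩),
      fun z' _ => hle.trans (hmin_le K v hKv z')⟩
  have hsupport : ∀ K v, IsFiniteMinimizer J A (K, v) →
      sourceSupport Ω f (gradPair P v) ⊆ K ∧ (sourceSupport Ω f (gradPair P v)).Nonempty := by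
    intro K v hKv
    exact (h.divergence_properties hΩb hf hf0 hfpos hKv.1.1.2.1
      (lt_top_of_comp_lt_top hθtop (ENNReal.add_lt_top.1 hKv.2.1).1) hKv.1.2
      (hmin K v hKv)).2.2
  have hbuild' : ∀ K v, IsFiniteMinimizer J A (K, v) →
      ∃ φ y, F (v, φ, y) = J (K, v) + I ∧ IsFiniteMinimizer F univ (v, φ, y) := by
    intro K v hKv
    obtain ⟨hsub, y, hy⟩ := hsupport K v hKv
    exact ⟨φ₁, ⟨y, hKv.1.1.1 (hsub hy)⟩, hbuild K v hKv _ _ hφ₁ hy⟩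
  have hdual : (∃ p ∈ A, J p < ⊤) → ∃ K v, IsFiniteMinimizer J A (K, v) := by
    rintro ⟨p₀, hp₀, hp₀fin⟩
    obtain ⟨p, hp, -, hpmin⟩ := h.exists_minimal_pair hΩb hf hf0 hθ hθm hθtop ⟨p₀, hp₀, hp₀fin⟩
    exact ⟨p.1, p.2, hp, (hpmin p₀ hp₀).trans_lt hp₀fin, hpmin⟩
  have hfinite : (∃ z, F z < ⊤) → ∃ p ∈ A, J p < ⊤ := by
    rintro ⟨z, hz⟩
    obtain ⟨K, hKA, hK⟩ := h.exists_dualFunctional_add_le hΩb hf hf0 hθtop hz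
    exact ⟨_, hKA, (le_self_add.trans hK).trans_lt hz⟩
  -- Conversely, a minimizer of the limit functional gives minimizers of the dual problem.
  have hconv : ∀ v φ y, IsFiniteMinimizer F univ (v, φ, y) → ∀ K, (K, v) ∈ A →
      J (K, v) + I ≤ F (v, φ, y) → IsFiniteMinimizer J A (K, v) := by
    intro v φ y hz K hKA hK
    obtain ⟨K₁, v₁, hKv₁⟩ := hdual (hfinite ⟨_, hz.2.1⟩)
    obtain ⟨φ', y', heq, -⟩ := hbuild' K₁ v₁ hKv₁
    refine ⟨hKA, (le_self_add.trans hK).trans_lt hz.2.1, fun p hp => ?_⟩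
    refine le_trans ?_ (hKv₁.2.2 p hp)
    refine (ENNReal.add_le_add_iff_right hI).1 ?_
    exact (hK.trans (hz.2.2 (v₁, φ', y') (mem_univ _))).trans heq.le
  refine ⟨?_, ⟨?_, ?_⟩, ?_, fun v φ y => ⟨?_, ?_⟩, fun K v => ⟨?_, ?_⟩⟩
  · by_cases hex : ∃ p ∈ A, J p < ⊤
    · obtain ⟨K, v, hKv⟩ := hdual hex
      obtain ⟨φ, y, -, hz⟩ := hbuild' K v hKv
      exact ⟨_, fun z' => hz.2.2 z' (mem_univ _)⟩
    · obtain ⟨v, -, -⟩ := h.exists_rep 0 0 le_rfl (fun G => by simp)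
      have hne : (closure Ω).Nonempty := by
        rw [closure_nonempty_iff, nonempty_iff_ne_empty]
        rintro rfl
        simp at hfpos
      obtain ⟨y, hy⟩ := hne
      refine ⟨(v, φ₁, ⟨y, hy⟩), fun z' => ?_⟩
      rcases lt_or_ge (F z') ⊤ with hz' | hz'
      · exact absurd (hfinite ⟨z', hz'⟩) hex
      · exact le_top.trans hz'
  · rintro ⟨z, hz⟩
    exact hfinite ⟨z, hz.2.1⟩
  · intro hex
    obtain ⟨K, v, hKv⟩ := hdual hex
    obtain ⟨φ, y, -, hz⟩ := hbuild' K v hKv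
    exact ⟨_, hz⟩
  · by_cases hex : ∃ p ∈ A, J p < ⊤
    · obtain ⟨K, v, hKv⟩ := hdual hex
      obtain ⟨φ, y, heq, hz⟩ := hbuild' K v hKv
      have h1 : (⨅ z, F z) = F (v, φ, y) :=
        le_antisymm (iInf_le _ _) (le_iInf fun z' => hz.2.2 z' (mem_univ _))
      have h2 : (⨅ p ∈ A, J p) = J (K, v) :=
        le_antisymm (iInf₂_le _ hKv.1) (le_iInf₂ hKv.2.2)
      rw [h1, h2, heq]
    · have h1 : (⨅ z, F z) = ⊤ := iInf_eq_top.2 fun z => by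
        by_contra hz
        exact hex (hfinite ⟨z, lt_top_iff_ne_top.2 hz⟩)
      have h2 : (⨅ p ∈ A, J p) = ⊤ := iInf₂_eq_top.2 fun p hp => by
        by_contra hz
        exact hex ⟨p, hp, lt_top_iff_ne_top.2 hz⟩
      rw [h1, h2, top_add]
  · intro hz
    obtain ⟨⟨-, hy, hφ⟩, -⟩ := limitFunctional_lt_top_iff.1 hz.2.1
    obtain ⟨K, hKA, hK⟩ := h.exists_dualFunctional_add_le hΩb hf hf0 hθtop hz.2.1
    exact ⟨hφ, hy, K, hconv v φ y hz K hKA hK⟩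
  · rintro ⟨hφ, hy, K, hKv⟩
    exact (hbuild K v hKv φ y hφ hy).2
  · intro hKv
    obtain ⟨hsub, -⟩ := hsupport K v hKv
    obtain ⟨φ, y, -, hz⟩ := hbuild' K v hKv
    refine ⟨hKv.1.1, hsub, le_antisymm ?_ (iInf₂_le K ⟨hKv.1.1, hsub⟩), φ, y, hz⟩
    obtain ⟨K₁, hK₁, hsub₁, hlen₁⟩ := exists_hausdorffMeasure_eq_steinerLength hΩb
      ⟨K, hKv.1.1, hsub⟩
    have hA₁ := (h.dualFunctional_add_le hΩb hf hf0 hθtop hz.2.1 hK₁ hsub₁ hlen₁).1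
    have hle := hKv.2.2 _ hA₁
    rw [connectedLength, ← hlen₁]
    exact (ENNReal.add_le_add_iff_left (ENNReal.add_lt_top.1 hKv.2.1).1.ne).1 hle
  · rintro ⟨hK, hsub, hlen, φ, y, hz⟩
    obtain ⟨hKA, hle⟩ := h.dualFunctional_add_le hΩb hf hf0 hθtop hz.2.1 hK hsub hlen
    exact hconv v φ y hz K hKA hle

end EnergyDuality

/-! ### The compliance and the average distance problem -/

/-- In a minimizing pair `(K, v)`, the field `v` is a smallest field that balances `f` off `K`. -/
theorem size_le_of_isFiniteMinimizer {V : Type*} {N : V → ℝ≥0∞} {P : V → (Plane → Plane) → ℝ}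
    {θ : ℝ≥0∞ → ℝ≥0∞} (hθ : StrictMono θ) {K : Set Plane} {v : V}
    (hKv : IsFiniteMinimizer (dualFunctional (θ ∘ N)) (admissiblePairs (gradPair P) Ω f) (K, v))
    (u : V) (hu : IsBalancedOff Ω f K (gradPair P u)) : N v ≤ N u := by
  have hle : θ (N v) + μH[1] K ≤ θ (N u) + μH[1] K := hKv.2.2 (K, u) ⟨hKv.1.1, hu⟩
  have hK : μH[1] K ≠ ⊤ := (ENNReal.add_lt_top.1 hKv.2.1).2.ne
  exact hθ.le_iff_le.1 ((ENNReal.add_le_add_iff_right hK).1 hle)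

theorem strictMono_const_mul_rpow {q : ℝ} (hq : 1 < q) :
    StrictMono fun M : ℝ≥0∞ => ENNReal.ofReal (1 / q) * M ^ q := by
  have hq0 : 0 < q := zero_lt_one.trans hq
  exact (ENNReal.mul_right_strictMono (by simpa using hq0) ENNReal.ofReal_ne_top).comp
    (ENNReal.strictMono_rpow_of_pos hq0)

/-- In the compliance problem, the smallest field is unique, so it is the one for which `div v + f` is
nonnegative. -/
theorem isDivNonneg_of_isFiniteMinimizer_dualLq (hΩb : Bornology.IsBounded Ω)
    (hf : IntegrableOn f Ω) (hf0 : ∀ᵐ x ∂(volume.restrict Ω), 0 ≤ f x) {q : ℝ} (hq : 1 < q)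
    {K : Set Plane} {v : LqField Ω q}
    (hKv : IsFiniteMinimizer (dualLq Ω q) (admissibleLq Ω f q) (K, v)) :
    IsDivNonneg Ω f (gradPair lqPair v) := by
  have hθ : (lqEnergy : LqField Ω q → ℝ≥0∞) =
      (fun M => ENNReal.ofReal (1 / q) * M ^ q) ∘ lqNorm := funext (lqEnergy_eq hq)
  rw [dualLq, hθ] at hKv
  have hsize := size_le_of_isFiniteMinimizer (P := lqPair) (strictMono_const_mul_rpow hq) hKv
  obtain ⟨v', hv', hv'K, hv'f⟩ := (energyDuality_lq hΩb
    (Real.HolderConjugate.conjExponent hq).symm).exists_isDivNonneg hΩb hf hf0 hKv.1.1.1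
    (lqNorm_lt_top v) hKv.1.2
  rwa [lq_eq_of_isBalancedOff hΩb hq hKv.1.2 hsize hv'K hv'] at hv'f

theorem isDivNonneg_of_isFiniteMinimizer_dualMass (hΩb : Bornology.IsBounded Ω)
    (hf : IntegrableOn f Ω) (hf0 : ∀ᵐ x ∂(volume.restrict Ω), 0 ≤ f x)
    {K : Set Plane} {v : MeasureField Ω}
    (hKv : IsFiniteMinimizer (dualMass Ω) (admissibleMass Ω f) (K, v)) :
    IsDivNonneg Ω f (gradPair massPair v) :=
  (energyDuality_mass hΩb).isDivNonneg_of_minimal hΩb hf hf0 hKv.1.1.1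
    (ENNReal.add_lt_top.1 hKv.2.1).1 hKv.1.2
    (size_le_of_isFiniteMinimizer (N := massEnergy) (P := massPair) strictMono_id hKv)

end ConnectedSets

end

open ConnectedSets in
theorem mainTheorem5 (Ω : Set Plane) (hΩ : IsOpen Ω) (hΩb : Bornology.IsBounded Ω)
    (f : Plane → ℝ) (hf : IntegrableOn f Ω) (hf0 : ∀ᵐ x ∂(volume.restrict Ω), 0 ≤ f x)
    (hfpos : 0 < ∫ x in Ω, f x) :
    -- the compliance problem
    (∀ q : ℝ, 1 < q →
      (∃ z, ∀ z', F0 Ω f q z ≤ F0 Ω f q z') ∧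
      ((∃ z, IsFiniteMinimizer (F0 Ω f q) univ z) ↔ ∃ p ∈ admissibleLq Ω f q, dualLq Ω q p < ⊤) ∧
      (⨅ z, F0 Ω f q z) =
        (⨅ p ∈ admissibleLq Ω f q, dualLq Ω q p) +
          ENNReal.ofReal (2 * ∫ x in Ω, f x) ∧
      (∀ (v : LqField Ω q) (φ : Lp ℝ 2 (volume.restrict Ω)) (y : closure Ω),
        IsFiniteMinimizer (F0 Ω f q) univ (v, φ, y) ↔
          φ =ᵐ[volume.restrict Ω] (fun _ => (1 : ℝ)) ∧
          (y : Plane) ∈ sourceSupport Ω f (lqPairing v) ∧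
          ∃ K, IsFiniteMinimizer (dualLq Ω q) (admissibleLq Ω f q) (K, v)) ∧
      (∀ (K : Set Plane) (v : LqField Ω q),
        IsFiniteMinimizer (dualLq Ω q) (admissibleLq Ω f q) (K, v) ↔
          K ∈ continua Ω ∧ sourceSupport Ω f (lqPairing v) ⊆ K ∧
          μH[1] K = connectedLength Ω f (lqPairing v) ∧
          ∃ φ y, IsFiniteMinimizer (F0 Ω f q) univ (v, φ, y))) ∧
    -- the average distance problem
    ((∃ z, ∀ z', F0Mass Ω f z ≤ F0Mass Ω f z') ∧
      ((∃ z, IsFiniteMinimizer (F0Mass Ω f) univ z) ↔ ∃ p ∈ admissibleMass Ω f, dualMass Ω p < ⊤) ∧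
      (⨅ z, F0Mass Ω f z) =
        (⨅ p ∈ admissibleMass Ω f, dualMass Ω p) +
          ENNReal.ofReal (2 * ∫ x in Ω, f x) ∧
      (∀ (v : MeasureField Ω) (φ : Lp ℝ 2 (volume.restrict Ω)) (y : closure Ω),
        IsFiniteMinimizer (F0Mass Ω f) univ (v, φ, y) ↔
          φ =ᵐ[volume.restrict Ω] (fun _ => (1 : ℝ)) ∧
          (y : Plane) ∈ sourceSupport Ω f (massPairing v) ∧
          ∃ K, IsFiniteMinimizer (dualMass Ω) (admissibleMass Ω f) (K, v)) ∧
      (∀ (K : Set Plane) (v : MeasureField Ω),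
        IsFiniteMinimizer (dualMass Ω) (admissibleMass Ω f) (K, v) ↔
          K ∈ continua Ω ∧ sourceSupport Ω f (massPairing v) ⊆ K ∧
          μH[1] K = connectedLength Ω f (massPairing v) ∧
          ∃ φ y, IsFiniteMinimizer (F0Mass Ω f) univ (v, φ, y))) := by
  refine ⟨fun q hq => ?_, ?_⟩
  · have hq0 : 0 < q := zero_lt_one.trans hq
    have hθ : (lqEnergy : LqField Ω q → ℝ≥0∞) =
        (fun M => ENNReal.ofReal (1 / q) * M ^ q) ∘ lqNorm := funext (lqEnergy_eq hq)
    have key := (energyDuality_lq hΩb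
      (Real.HolderConjugate.conjExponent hq).symm).limitFunctional_minimization hΩb hf hf0 hfpos
      (θ := fun M => ENNReal.ofReal (1 / q) * M ^ q)
      ((ENNReal.continuous_const_mul ENNReal.ofReal_ne_top).comp ENNReal.continuous_rpow_const)
      (strictMono_const_mul_rpow hq).monotone
      (by
        rw [ENNReal.top_rpow_of_pos hq0]
        exact ENNReal.mul_top (by simpa using hq0))
      (fun K v hKv => isDivNonneg_of_isFiniteMinimizer_dualLq hΩb hf hf0 hq (by
        rw [dualLq, hθ]
        exact hKv))
    rw [← hθ] at key
    exact key
  · exact (energyDuality_mass hΩb).limitFunctional_minimization hΩb hf hf0 hfpos (θ := id)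
      continuous_id monotone_id rfl
      (fun K v hKv => isDivNonneg_of_isFiniteMinimizer_dualMass hΩb hf hf0 hKv)
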